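/- **Setting.** An election has $n$ voters and $m$ candidates; each voter ranks all candidates, and $\mathrm{pos}_v(c)\in\{1,\dots,m\}$ is the position of candidate $c$ in the ranking of voter $v$. The rank of $c$ is $\mathrm{rank}(c)=\min_v \mathrm{pos}_v(c)$. For a committee size $k$, STV uses the quota $q=\lfloor n/(k+1)\rfloor+1$ and works in rounds until $k$ candidates are elected or no candidate is left: if some remaining candidate is ranked first (among the remaining candidates) by at least $q$ remaining voters, then one such candidate is elected and deleted from the rankings, together with exactly $q$ of the voters who rank it first; otherwise a candidate that is ranked first by the fewest remaining voters is eliminated. A committee of size $k$ wins if some way of breaking all ties (which candidate to elect or eliminate, which $q$ voters to delete) elects it. The committee size $k$ is called normal (for $n$ voters) if $kq\le n$, i.e. the rule never has to delete more voters than there are. In the problem STV Robustness Radius we are given an election, a committee size $k$ and an integer $B\ge 0$, and ask whether the set of winning committees of size $k$ can be changed by at most $B$ swaps of adjacent candidates in the voters' rankings; the smallest such $B$ is the robustness radius of the election. **Theorem.** STV Robustness Radius, restricted to instances with a normal committee size, is fixed-parameter tractable with respect to the number $n$ of voters: there are an algorithm (a random access machine with unit-cost addition and truncated subtraction), a computable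 function $f$ and a constant $c$ such that the algorithm decides every such instance $I$ in at most $f(n)\,|I|^{c}$ steps, where $|I|$ is the length of the binary encoding of $I$. Moreover, for every election with $n$ voters and $m$ candidates and every normal committee size $k$: 1. no candidate of rank greater than $n$ belongs to a winning committee; 2. if $1\le k<m$, then the robustness radius is at most $n^2$; 3. if the set of winning committees can be changed by at most $B$ swaps of adjacent candidates, then it can also be changed by at most $\min(B,n^2)$ swaps of adjacent candidates each of which moves at least one candidate whose rank in the original election is at most $n^2+n+1$. -/

import Mathlib

namespace STVRobust

/-! ### Elections, STV and adjacent swaps -/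

/-- An election with `n` voters and `m` candidates: `P v i` is the candidate that voter `v` puts in
the `i`-th place, counted from `0` (the most preferred candidate). -/
abbrev Profile (n m : ℕ) : Type := Fin n → Equiv.Perm (Fin m)

/-- The position of candidate `c` in the ranking of voter `v`; the top position is `1`. -/
def pos {n m : ℕ} (P : Profile n m) (v : Fin n) (c : Fin m) : ℕ := ((P v).symm c : ℕ) + 1

/-- The rank of a candidate: its best position over all voters. -/
noncomputable def rank {n m : ℕ} (P : Profile n m) (c : Fin m) : ℕ := ⨅ v, pos P v c

/-- The STV quota `⌊n / (k + 1)⌋ + 1`. -/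
def quota (n k : ℕ) : ℕ := n / (k + 1) + 1

/-- The committee size `k` is normal for `n` voters: the `k` deletions of `quota n k` voters that
fill the committee never require more voters than there are. -/
def Normal (n k : ℕ) : Prop := k * quota n k ≤ n

/-- The state of an STV count: remaining candidates, remaining voters, elected candidates. -/
structure State (n m : ℕ) where
  cands : Finset (Fin m)
  voters : Finset (Fin n)
  elected : Finset (Fin m)

/-- The remaining voters who rank `c` first among the remaining candidates. -/
def supporters {n m : ℕ} (P : Profile n m) (s : State n m) (c : Fin m) : Finset (Fin n) :=
  s.voters.filter fun v => c ∈ s.cands ∧ ∀ d ∈ s.cands, pos P v c ≤ pos P v d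

/-- One round of STV for committee size `k`, with every way of breaking ties. Rounds are executed
only while fewer than `k` candidates are elected. -/
inductive Round {n m : ℕ} (P : Profile n m) (k : ℕ) : State n m → State n m → Prop
  | elect (s : State n m) (c : Fin m) (D : Finset (Fin n))
      (hk : s.elected.card < k)
      (hc : c ∈ s.cands) (hq : quota n k ≤ (supporters P s c).card)
      (hD : D ⊆ supporters P s c) (hDq : D.card = quota n k) :
      Round P k s ⟨s.cands.erase c, s.voters \ D, insert c s.elected⟩
  | eliminate (s : State n m) (d : Fin m)
      (hk : s.elected.card < k)
      (hq : ∀ c ∈ s.cands, (supporters P s c).card < quota n k)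
      (hd : d ∈ s.cands)
      (hmin : ∀ c ∈ s.cands, (supporters P s d).card ≤ (supporters P s c).card) :
      Round P k s ⟨s.cands.erase d, s.voters, s.elected⟩

/-- The STV rule: all size-`k` committees that some way of breaking ties elects. -/
def STV {n m : ℕ} (P : Profile n m) (k : ℕ) : Set (Finset (Fin m)) :=
  {W | W.card = k ∧ ∃ s : State n m,
    Relation.ReflTransGen (Round P k) ⟨Finset.univ, Finset.univ, ∅⟩ s ∧ s.elected = W}

/-- Swap the candidates in the adjacent places `i` and `i + 1` of the ranking of voter `v`. -/
def swapAt {n m : ℕ} (P : Profile n m) (v : Fin n) (i : ℕ) (hi : i + 1 < m) : Profile n m :=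
  Function.update P v (P v * Equiv.swap ⟨i, Nat.lt_of_succ_lt hi⟩ ⟨i + 1, hi⟩)

/-- `SwapsTo S t P P'`: the profile `P'` arises from `P` by exactly `t` swaps of adjacent
candidates, each of which moves at least one candidate of `S`. -/
inductive SwapsTo {n m : ℕ} (S : Set (Fin m)) : ℕ → Profile n m → Profile n m → Prop
  | refl (P : Profile n m) : SwapsTo S 0 P P
  | step {t : ℕ} {P P' : Profile n m} (v : Fin n) (i : ℕ) (hi : i + 1 < m)
      (hS : P' v ⟨i, Nat.lt_of_succ_lt hi⟩ ∈ S ∨ P' v ⟨i + 1, hi⟩ ∈ S)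
      (h : SwapsTo S t P P') : SwapsTo S (t + 1) P (swapAt P' v i hi)

/-- At most `B` swaps of adjacent candidates, each moving at least one candidate of `S`, can change
the set of STV winning committees of size `k`. -/
def CanChangeWith {n m : ℕ} (S : Set (Fin m)) (P : Profile n m) (k B : ℕ) : Prop :=
  ∃ t ≤ B, ∃ P' : Profile n m, SwapsTo S t P P' ∧ STV P' k ≠ STV P k

/-- The question of STV Robustness Radius: can at most `B` swaps of adjacent candidates change
the set of winning committees? -/
def CanChange {n m : ℕ} (P : Profile n m) (k B : ℕ) : Prop := CanChangeWith Set.univ P k B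

/-- An input of STV Robustness Radius: an election, a committee size `k` and a budget `B`. -/
structure Instance where
  n : ℕ
  m : ℕ
  k : ℕ
  B : ℕ
  P : Profile n m

/-- An input as a list of numbers: `n`, `m`, `k`, `B`, and then the rankings of the voters one after
the other, each of them listed from its top candidate down. -/
def Instance.encode (I : Instance) : List ℕ :=
  [I.n, I.m, I.k, I.B] ++
    (List.finRange I.n).flatMap fun v => List.ofFn fun i => (I.P v i : ℕ)

/-! ### Random access machines with a step count -/

/-- Expressions over a memory that has number variables `var x` and arrays of numbers `a`, where
`get a e` is the entry of `a` at index `e`. -/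
inductive Expr : Type
  | num (c : ℕ)
  | var (x : ℕ)
  | get (a : ℕ) (e : Expr)
  | add (e₁ e₂ : Expr)
  | sub (e₁ e₂ : Expr)

/-- Structured programs of a random access machine: assignment to a variable, assignment to
an array entry, composition, branching and while loop (a condition holds if it is not `0`). -/
inductive Prog : Type
  | assign (x : ℕ) (e : Expr)
  | put (a : ℕ) (i e : Expr)
  | seq (p q : Prog)
  | ite (e : Expr) (p q : Prog)
  | loop (e : Expr) (p : Prog)

/-- Memory contents. A program mentions finitely many variables and arrays. -/
structure Memory where
  var : ℕ → ℕ
  arr : ℕ → ℕ → ℕ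

/-- Write the number `a` into variable `x`. -/
def Memory.setVar (s : Memory) (x a : ℕ) : Memory := ⟨Function.update s.var x a, s.arr⟩

/-- Write the number `b` into entry `i` of array `a`. -/
def Memory.setArr (s : Memory) (a i b : ℕ) : Memory :=
  ⟨s.var, Function.update s.arr a (Function.update (s.arr a) i b)⟩

/-- The value of an expression; `sub` is truncated subtraction. -/
def Expr.eval (s : Memory) : Expr → ℕ
  | num c => c
  | var x => s.var x
  | get a e => s.arr a (e.eval s)
  | add e₁ e₂ => e₁.eval s + e₂.eval s
  | sub e₁ e₂ => e₁.eval s - e₂.eval s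

/-- The number of steps that the evaluation of an expression takes: one per constant, variable,
array access, addition and subtraction. -/
def Expr.cost : Expr → ℕ
  | num _ => 1
  | var _ => 1
  | get _ e => e.cost + 1
  | add e₁ e₂ => e₁.cost + e₂.cost + 1
  | sub e₁ e₂ => e₁.cost + e₂.cost + 1

/-- `Exec p s t s'`: the program `p`, started with memory `s`, halts after exactly `t` steps with
memory `s'`. -/
inductive Exec : Prog → Memory → ℕ → Memory → Prop
  | assign (x : ℕ) (e : Expr) (s : Memory) :
      Exec (.assign x e) s (e.cost + 1) (s.setVar x (e.eval s))
  | put (a : ℕ) (i e : Expr) (s : Memory) :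
      Exec (.put a i e) s (i.cost + e.cost + 1)
        (s.setArr a (i.eval s) (e.eval s))
  | seq {p q : Prog} {s s' s'' : Memory} {t t' : ℕ}
      (hp : Exec p s t s') (hq : Exec q s' t' s'') : Exec (.seq p q) s (t + t') s''
  | ite_true {e : Expr} {p q : Prog} {s s' : Memory} {t : ℕ}
      (he : e.eval s ≠ 0) (hp : Exec p s t s') : Exec (.ite e p q) s (e.cost + 1 + t) s'
  | ite_false {e : Expr} {p q : Prog} {s s' : Memory} {t : ℕ}
      (he : e.eval s = 0) (hq : Exec q s t s') : Exec (.ite e p q) s (e.cost + 1 + t) s'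
  | loop_done {e : Expr} {p : Prog} {s : Memory}
      (he : e.eval s = 0) : Exec (.loop e p) s (e.cost + 1) s
  | loop_step {e : Expr} {p : Prog} {s s' s'' : Memory} {t t' : ℕ}
      (he : e.eval s ≠ 0) (hp : Exec p s t s') (hl : Exec (.loop e p) s' t' s'') :
      Exec (.loop e p) s (e.cost + 1 + t + t') s''

/-- Execution is deterministic: the running time and the final memory are unique. -/
theorem Exec.unique {p : Prog} {s s₁ s₂ : Memory} {t₁ t₂ : ℕ}
    (h₁ : Exec p s t₁ s₁) (h₂ : Exec p s t₂ s₂) : t₁ = t₂ ∧ s₁ = s₂ := by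
  induction h₁ generalizing t₂ s₂ with
  | assign x e s => cases h₂; exact ⟨rfl, rfl⟩
  | put a i e s => cases h₂; exact ⟨rfl, rfl⟩
  | seq _ _ ihp ihq =>
    cases h₂ with
    | seq hp hq =>
      obtain ⟨rfl, rfl⟩ := ihp hp
      obtain ⟨rfl, rfl⟩ := ihq hq
      exact ⟨rfl, rfl⟩
  | ite_true he _ ih =>
    cases h₂ with
    | ite_true _ hp => obtain ⟨rfl, rfl⟩ := ih hp; exact ⟨rfl, rfl⟩
    | ite_false he' _ => exact absurd he' he
  | ite_false he _ ih =>
    cases h₂ with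
    | ite_true he' _ => exact absurd he he'
    | ite_false _ hp => obtain ⟨rfl, rfl⟩ := ih hp; exact ⟨rfl, rfl⟩
  | loop_done he =>
    cases h₂ with
    | loop_done _ => exact ⟨rfl, rfl⟩
    | loop_step he' _ _ => exact absurd he he'
  | loop_step he _ _ ihp ihl =>
    cases h₂ with
    | loop_done he' => exact absurd he' he
    | loop_step _ hp hl =>
      obtain ⟨rfl, rfl⟩ := ihp hp
      obtain ⟨rfl, rfl⟩ := ihl hl
      exact ⟨rfl, rfl⟩

/-- The initial memory for the input `x`: array `0` holds `x`, everything else is `0`. -/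
def initMemory (x : List ℕ) : Memory where
  var _ := 0
  arr a i := if a = 0 then x.getD i 0 else 0

/-- The length of the encoding of an input: binary digits, with one separator per number. -/
def bitLength (x : List ℕ) : ℕ := (x.map fun a => Nat.size a + 1).sum

/-- The problem `L` on inputs of type `ι`, with encoding `enc` and parameter `κ`, is
fixed-parameter tractable: one program decides it (it accepts by leaving a nonzero number in
variable `0`) within `f (κ x) * |x| ^ c` steps, for a computable `f` and a constant `c`. -/
def IsFPT {ι : Type} (enc : ι → List ℕ) (κ : ι → ℕ) (L : ι → Prop) : Prop :=
  ∃ (p : Prog) (f : ℕ → ℕ) (c : ℕ), Computable f ∧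
    ∀ x : ι, ∃ (t : ℕ) (s : Memory), Exec p (initMemory (enc x)) t s ∧
      t ≤ f (κ x) * bitLength (enc x) ^ c ∧ (s.var 0 ≠ 0 ↔ L x)

end STVRobust

namespace STVRobust

/-! ### Basic facts on the count: filling the committee and eliminations without effect. -/

section Count

variable {n m : ℕ}

open Relation

/-! Candidates whom no voter places among the first `n` never influence the count. Every election
uses up at least one voter, so while only elections have happened and a voter is left, fewer than
`n` candidates are elected and this voter still has a remaining candidate in the top `n` places. Low
candidates therefore have no supporters. As soon as nobody reaches the quota, the fewest supporters
are zero; eliminating a candidate without supporters changes no support, so no election takes place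
until all low candidates are gone. This is `TopInvariant`. It shows that low candidates never win,
that the count may be run inside any set containing all top-`n` candidates
(`mem_STV_iff_restricted`), and that only the relative order inside such a set matters
(`STV_congr`).

For the bound on the radius, normality provides a winning committee `W` (`STV_nonempty`). At most
`k` swaps per voter put a candidate outside `W` on top of every ranking, and then `W` no longer wins
(`notMem_STV_of_top`); moreover `n * k ≤ n ^ 2`. A swap improves a position by at most one, so under
`B` swaps the candidates of rank above `B + n` stay low, and swaps that move no other candidate can
be omitted (`SwapsTo.exists_agree`). Together this gives `CanChange.kernel`.

For the algorithm, let `S` consist of the candidates that some voter has in the first `n ^ 2 + n +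
1` places. Their number is bounded in `n`. Long gaps between them, or to the ends of a ranking, need
not be known exactly, since a swap shortens a gap by at most one: cutting runs of irrelevant
candidates to length `n ^ 2 + 1` yields a table that behaves like the profile during `n ^ 2` swaps
(`SimOn.exchange`, `similar_of_walk`). By `canChange_iff_tableAnswer` the question becomes a finite
search on a table whose size and entries are bounded in `n` alone. The search is primitive
recursive, so a machine program performs it within a primitive recursive time bound
(`exists_computableIn`). Only the two scans that build the table depend on `m`, and they are linear
in `n * m` (`isFPT_canChange`). -/

theorem quota_pos (n k : ℕ) : 0 < quota n k := Nat.succ_pos _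

theorem mem_supporters {P : Profile n m} {s : State n m} {c : Fin m} {v : Fin n} :
    v ∈ supporters P s c ↔ v ∈ s.voters ∧ c ∈ s.cands ∧ ∀ d ∈ s.cands, pos P v c ≤ pos P v d := by
  simp [supporters]

theorem pos_le (P : Profile n m) (v : Fin n) (c : Fin m) : pos P v c ≤ m := by
  have := ((P v).symm c).isLt
  simp only [pos]; omega

/-- Every remaining voter supports someone as long as candidates remain. -/
theorem exists_mem_supporters (P : Profile n m) {s : State n m} (h : s.cands.Nonempty)
    {v : Fin n} (hv : v ∈ s.voters) : ∃ c ∈ s.cands, v ∈ supporters P s c := by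
  obtain ⟨c, hc, hmin⟩ := s.cands.exists_min_image (pos P v) h
  exact ⟨c, hc, mem_supporters.2 ⟨hv, hc, hmin⟩⟩

theorem card_voters_le (P : Profile n m) {s : State n m} (h : s.cands.Nonempty) :
    s.voters.card ≤ ∑ c ∈ s.cands, (supporters P s c).card := by
  classical
  refine (Finset.card_le_card fun v hv => ?_).trans (Finset.card_biUnion_le (t := supporters P s))
  obtain ⟨c, hc, hvc⟩ := exists_mem_supporters P h hv
  exact Finset.mem_biUnion.2 ⟨c, hc, hvc⟩

/-- A count that has not filled the committee can be continued to fill it. -/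
theorem exists_full_of_state (P : Profile n m) {k : ℕ} (hN : Normal n k) (s : State n m)
    (hd : Disjoint s.cands s.elected) (he : s.elected.card ≤ k)
    (hc : k ≤ s.elected.card + s.cands.card)
    (hv : s.voters.card + s.elected.card * quota n k = n) :
    ∃ s', ReflTransGen (Round P k) s s' ∧ s'.elected.card = k := by
  induction hr : s.cands.card generalizing s with
  | zero => exact ⟨s, .refl, by omega⟩
  | succ r ih =>
    obtain he' | he' := he.eq_or_lt
    · exact ⟨s, .refl, he'⟩
    have hne : s.cands.Nonempty := Finset.card_pos.1 (by omega)
    by_cases hq : ∃ c ∈ s.cands, quota n k ≤ (supporters P s c).card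
    · obtain ⟨c, hcs, hcq⟩ := hq
      obtain ⟨D, hD, hDq⟩ := Finset.exists_subset_card_eq hcq
      have hce : c ∉ s.elected := Finset.disjoint_left.1 hd hcs
      have hDv : D ⊆ s.voters := hD.trans (Finset.filter_subset _ _)
      obtain ⟨s', h1, h2⟩ := ih ⟨s.cands.erase c, s.voters \ D, insert c s.elected⟩
        (by
          rw [Finset.disjoint_insert_right]
          exact ⟨Finset.notMem_erase _ _, hd.mono_left (Finset.erase_subset _ _)⟩)
        (by rw [Finset.card_insert_of_notMem hce]; exact he')
        (by rw [Finset.card_insert_of_notMem hce, Finset.card_erase_of_mem hcs]; omega)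
        (by
          rw [Finset.card_insert_of_notMem hce, Finset.card_sdiff_of_subset hDv, add_mul, hDq]
          have := Finset.card_le_card hDv
          omega)
        (by rw [Finset.card_erase_of_mem hcs]; omega)
      exact ⟨s', .head (.elect s c D he' hcs hcq hD hDq) h1, h2⟩
    · push Not at hq
      obtain ⟨d, hds, hmin⟩ := s.cands.exists_min_image (fun c => (supporters P s c).card) hne
      -- Normality enters here. If just enough candidates were left to fill the committee, each with
      -- fewer than `q` supporters, there would be fewer than `(k - |elected|) * q` remaining
      -- voters, but `n - |elected| * q` is at least that number.
      have key : k < s.elected.card + s.cands.card := by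
        by_contra hlt
        have h1 : ∑ c ∈ s.cands, (supporters P s c).card < s.cands.card * quota n k := by
          simpa using Finset.sum_lt_sum_of_nonempty hne hq
        have h2 := card_voters_le P hne
        have h3 : k = s.elected.card + s.cands.card := by omega
        unfold Normal at hN
        rw [h3] at hN h1 hv
        rw [add_mul] at hN
        omega
      obtain ⟨s', h1, h2⟩ := ih ⟨s.cands.erase d, s.voters, s.elected⟩
        (hd.mono_left (Finset.erase_subset _ _)) he
        (by rw [Finset.card_erase_of_mem hds]; simp only; omega) hv
        (by rw [Finset.card_erase_of_mem hds]; omega)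
      exact ⟨s', .head (.eliminate s d he' hq hds hmin) h1, h2⟩

theorem STV_nonempty (P : Profile n m) {k : ℕ} (hN : Normal n k) (hk : k ≤ m) :
    (STV P k).Nonempty := by
  obtain ⟨s, h1, h2⟩ := exists_full_of_state P hN ⟨Finset.univ, Finset.univ, ∅⟩ (by simp)
    (by simp) (by simpa using hk) (by simp)
  exact ⟨s.elected, h2, s, h1, rfl⟩

theorem STV_zero (P : Profile n m) : STV P 0 = {∅} := by
  ext W
  constructor
  · rintro ⟨hW, -⟩
    simpa using hW
  · rintro rfl
    exact ⟨rfl, _, .refl, rfl⟩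

/-- For `k > m` nothing wins; for `k = m` the set of all candidates is the only possible winner, and
it wins because some committee does. -/
theorem STV_eq_of_le (P P' : Profile n m) {k : ℕ} (hN : Normal n k) (hk : m ≤ k) :
    STV P k = STV P' k := by
  have key : ∀ (Q : Profile n m), ∀ W ∈ STV Q k, m = k ∧ W = Finset.univ := by
    rintro Q W ⟨hW, -⟩
    have h1 : W.card ≤ m := by simpa using Finset.card_le_univ W
    exact ⟨by omega, by rw [← Finset.card_eq_iff_eq_univ]; simp; omega⟩
  have aux : ∀ (Q Q' : Profile n m), STV Q k ⊆ STV Q' k := by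
    intro Q Q' W hW
    obtain ⟨hmk, rfl⟩ := key Q W hW
    obtain ⟨W', hW'⟩ := STV_nonempty Q' hN hmk.ge
    rwa [← (key Q' W' hW').2]
  exact (aux _ _).antisymm (aux _ _)

theorem CanChangeWith.bounds {S : Set (Fin m)} {P : Profile n m} {k B : ℕ} (hN : Normal n k)
    (h : CanChangeWith S P k B) : 1 ≤ k ∧ k < m := by
  obtain ⟨t, -, P', -, hne⟩ := h
  constructor
  · by_contra h0
    obtain rfl : k = 0 := by omega
    exact hne (by rw [STV_zero, STV_zero])
  · by_contra h0
    exact hne (STV_eq_of_le _ _ hN (by omega))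

theorem Normal.le {k : ℕ} (h : Normal n k) : k ≤ n :=
  (Nat.le_mul_of_pos_right k (quota_pos n k)).trans h

/-- Eliminating a candidate without supporters does not change the support of the others. -/
theorem supporters_erase (P : Profile n m) {s : State n m} {d : Fin m}
    (hd : supporters P s d = ∅) {c : Fin m} (hc : c ≠ d) :
    supporters P ⟨s.cands.erase d, s.voters, s.elected⟩ c = supporters P s c := by
  ext v
  simp only [mem_supporters, Finset.mem_erase]
  constructor
  · rintro ⟨hv, ⟨-, hcs⟩, hmin⟩
    -- The voter's favourite before the deletion is not `d`, so it survives, and `c` is at least as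
    -- good for this voter.
    obtain ⟨c', hc's, hvc'⟩ := exists_mem_supporters P ⟨c, hcs⟩ hv
    have hne : c' ≠ d := by rintro rfl; simp [hd] at hvc'
    refine ⟨hv, hcs, fun x hx => (hmin c' ⟨hne, hc's⟩).trans ?_⟩
    exact (mem_supporters.1 hvc').2.2 x hx
  · rintro ⟨hv, hcs, hmin⟩
    exact ⟨hv, ⟨hc, hcs⟩, fun x hx => hmin x hx.2⟩

/-- No remaining candidate reaches the quota. -/
def NoQuota (P : Profile n m) (k : ℕ) (s : State n m) : Prop :=
  ∀ c ∈ s.cands, (supporters P s c).card < quota n k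

theorem NoQuota.erase {P : Profile n m} {k : ℕ} {s : State n m} (h : NoQuota P k s) {d : Fin m}
    (hd : supporters P s d = ∅) : NoQuota P k ⟨s.cands.erase d, s.voters, s.elected⟩ := by
  intro c hc
  rw [supporters_erase P hd (Finset.ne_of_mem_erase hc)]
  exact h c (Finset.mem_of_mem_erase hc)

/-- A minimal candidate has no supporters if some candidate has none. -/
theorem supporters_eq_empty_of_min {P : Profile n m} {s : State n m} {d z : Fin m}
    (hmin : ∀ c ∈ s.cands, (supporters P s d).card ≤ (supporters P s c).card)
    (hz : z ∈ s.cands) (hz0 : supporters P s z = ∅) : supporters P s d = ∅ := by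
  have := hmin z hz
  rw [hz0, Finset.card_empty] at this
  exact Finset.card_eq_zero.1 (by omega)

end Count

/-! ### Irrelevance of candidates below the top `n` places. -/

section Restrict

variable {n m : ℕ}

open Relation

/-- The invariant of a count in which only candidates of `T` occur in the top `n` places. -/
structure TopInvariant (P : Profile n m) (k : ℕ) (T : Finset (Fin m)) (s : State n m) : Prop where
  elected : s.elected ⊆ T
  phase : s.cands ⊆ T ∨ (∀ v ∈ s.voters, ∃ d ∈ s.cands, pos P v d ≤ n) ∧
    (s.cands ∪ s.elected = Finset.univ ∧ s.elected.card + s.voters.card ≤ n ∨ NoQuota P k s)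

theorem TopInvariant.supporters_eq_empty {P : Profile n m} {k : ℕ} {T : Finset (Fin m)}
    (hT : ∀ c ∉ T, ∀ v, n < pos P v c) {s : State n m} (h : TopInvariant P k T s) {z : Fin m}
    (hz : z ∉ T) : supporters P s z = ∅ := by
  rw [Finset.eq_empty_iff_forall_notMem]
  intro v hv
  obtain ⟨hvs, hzs, hmin⟩ := mem_supporters.1 hv
  rcases h.phase with h | ⟨h, -⟩
  · exact hz (h hzs)
  · obtain ⟨d, hd, hdn⟩ := h v hvs
    have := hmin d hd
    have := hT z hz v
    omega

/-- Pigeonhole: as long as nobody has been eliminated, a voter without a remaining top-`n` candidate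
would have all `n` of them elected. The candidate `z` ensures `n ≤ m`. -/
theorem exists_top_of_card {P : Profile n m} {s : State n m} {z : Fin m} {v : Fin n}
    (hz : n < pos P v z) (hu : s.cands ∪ s.elected = Finset.univ) (hc : s.elected.card < n) :
    ∃ d ∈ s.cands, pos P v d ≤ n := by
  by_contra hcon
  push Not at hcon
  have hnm : n ≤ m := (hz.trans_le (pos_le P v z)).le
  have hsub : (Finset.univ : Finset (Fin n)).map
      ((Fin.castLEEmb hnm).trans (P v).toEmbedding) ⊆ s.elected := by
    intro d hd
    obtain ⟨i, -, rfl⟩ := Finset.mem_map.1 hd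
    have hm : P v (Fin.castLE hnm i) ∈ s.cands ∪ s.elected := by rw [hu]; exact Finset.mem_univ _
    rcases Finset.mem_union.1 hm with h | h
    · have := hcon _ h
      simp only [pos, Equiv.symm_apply_apply, Fin.val_castLE] at this
      omega
    · exact h
  have := Finset.card_le_card hsub
  simp at this
  omega

theorem TopInvariant.init {P : Profile n m} {k : ℕ} {T : Finset (Fin m)}
    (hT : ∀ c ∉ T, ∀ v, n < pos P v c) :
    TopInvariant P k T ⟨Finset.univ, Finset.univ, ∅⟩ := by
  refine ⟨Finset.empty_subset _, ?_⟩
  by_cases h : ∃ z, z ∉ T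
  · obtain ⟨z, hz⟩ := h
    refine .inr ⟨fun v _ => exists_top_of_card (hT z hz v) (by simp) ?_, .inl (by simp)⟩
    simpa using v.pos
  · push Not at h
    exact .inl fun c _ => h c

/-- Before the first elimination, each election removes at least one voter and adds at most one
winner, which keeps `|elected| + |voters| ≤ n`. At an elimination with a candidate outside `T` still
present, the eliminated candidate has no supporters, so the absence of a quota and all favourites
persist. -/
theorem TopInvariant.step {P : Profile n m} {k : ℕ} {T : Finset (Fin m)}
    (hT : ∀ c ∉ T, ∀ v, n < pos P v c) {s s' : State n m} (h : TopInvariant P k T s)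
    (hr : Round P k s s') : TopInvariant P k T s' := by
  have h0 := fun z => h.supporters_eq_empty hT (z := z)
  cases hr with
  | elect c D hk hc hq hD hDq =>
    have hcT : c ∈ T := by
      by_contra hcT
      rw [h0 c hcT, Finset.card_empty] at hq
      exact absurd hq (quota_pos n k).not_ge
    refine ⟨Finset.insert_subset hcT h.elected, ?_⟩
    by_cases hsub : s.cands ⊆ T
    · exact .inl ((Finset.erase_subset _ _).trans hsub)
    obtain ⟨z, hz, hzT⟩ := Finset.not_subset.1 hsub
    rcases h.phase with h1 | ⟨-, ⟨hu, hcard⟩ | hno⟩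
    · exact absurd h1 hsub
    · have hDv : D ⊆ s.voters := hD.trans (Finset.filter_subset _ _)
      have hcard' : (insert c s.elected).card + (s.voters \ D).card ≤ n := by
        have := Finset.card_insert_le c s.elected
        have := Finset.card_le_card hDv
        have := quota_pos n k
        rw [Finset.card_sdiff_of_subset hDv]
        omega
      have hu' : s.cands.erase c ∪ insert c s.elected = Finset.univ := by
        rw [← hu]
        ext x
        by_cases hx : x = c <;> simp [hx, hc]
      refine .inr ⟨fun v hv => exists_top_of_card
        (s := ⟨s.cands.erase c, s.voters \ D, insert c s.elected⟩) (hT z hzT v) hu' ?_,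
        .inl ⟨hu', hcard'⟩⟩
      -- A surviving voter makes the bound on the number of elected candidates strict.
      have : 0 < (s.voters \ D).card := Finset.card_pos.2 ⟨v, hv⟩
      simp only
      omega
    · exact absurd (hno c hc) hq.not_gt
  | eliminate d hk hq hd hmin =>
    refine ⟨h.elected, ?_⟩
    by_cases hsub : s.cands ⊆ T
    · exact .inl ((Finset.erase_subset _ _).trans hsub)
    obtain ⟨z, hz, hzT⟩ := Finset.not_subset.1 hsub
    have hd0 := supporters_eq_empty_of_min hmin hz (h0 z hzT)
    refine .inr ⟨fun v hv => ?_, .inr (NoQuota.erase hq hd0)⟩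
    rcases h.phase with h1 | ⟨htop, -⟩
    · exact absurd h1 hsub
    obtain ⟨d0, hd0s, hd0n⟩ := htop v hv
    obtain ⟨c, hc, hvc⟩ := exists_mem_supporters P ⟨z, hz⟩ hv
    have hne : c ≠ d := by rintro rfl; simp [hd0] at hvc
    exact ⟨c, Finset.mem_erase.2 ⟨hne, hc⟩, ((mem_supporters.1 hvc).2.2 d0 hd0s).trans hd0n⟩

/-- Drop the candidates outside `T` from the race. -/
def State.restrict (s : State n m) (T : Finset (Fin m)) : State n m :=
  ⟨s.cands ∩ T, s.voters, s.elected⟩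

/-- If a candidate outside `T` remains, every remaining voter prefers to it some remaining top-`n`
candidate, which lies in `T`; so the outsiders never decide who is ranked first. -/
theorem TopInvariant.supporters_restrict {P : Profile n m} {k : ℕ} {T : Finset (Fin m)}
    (hT : ∀ c ∉ T, ∀ v, n < pos P v c) {s : State n m} (h : TopInvariant P k T s) {c : Fin m}
    (hc : c ∈ T) : supporters P (s.restrict T) c = supporters P s c := by
  ext v
  simp only [mem_supporters, State.restrict, Finset.mem_inter]
  constructor
  · rintro ⟨hv, ⟨hcs, -⟩, hmin⟩
    refine ⟨hv, hcs, fun d hd => ?_⟩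
    by_cases hdT : d ∈ T
    · exact hmin d ⟨hd, hdT⟩
    rcases h.phase with h1 | ⟨h1, -⟩
    · exact absurd (h1 hd) hdT
    · obtain ⟨x, hx, hxn⟩ := h1 v hv
      have hxT : x ∈ T := by
        by_contra hxT
        exact absurd hxn (hT x hxT v).not_ge
      exact ((hmin x ⟨hx, hxT⟩).trans hxn).trans (hT d hdT v).le
  · rintro ⟨hv, hcs, hmin⟩
    exact ⟨hv, ⟨hcs, hc⟩, fun d hd => hmin d hd.1⟩

/-- Eliminating a candidate outside `T` becomes zero rounds; every other round carries over because
the supports agree. -/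
theorem TopInvariant.restrict_step {P : Profile n m} {k : ℕ} {T : Finset (Fin m)}
    (hT : ∀ c ∉ T, ∀ v, n < pos P v c) {s s' : State n m} (h : TopInvariant P k T s)
    (hr : Round P k s s') : ReflTransGen (Round P k) (s.restrict T) (s'.restrict T) := by
  have hsupp := fun c => h.supporters_restrict hT (c := c)
  cases hr with
  | elect c D hk hc hq hD hDq =>
    have hcT : c ∈ T := by
      by_contra hcT
      rw [h.supporters_eq_empty hT hcT, Finset.card_empty] at hq
      exact absurd hq (quota_pos n k).not_ge
    rw [← hsupp c hcT] at hq hD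
    have := Round.elect (P := P) (k := k) (s.restrict T) c D hk (Finset.mem_inter.2 ⟨hc, hcT⟩)
      hq hD hDq
    simp only [State.restrict, Finset.erase_inter] at this ⊢
    exact .single this
  | eliminate d hk hq hd hmin =>
    by_cases hdT : d ∈ T
    · have := Round.eliminate (P := P) (k := k) (s.restrict T) d hk
        (fun c hc => by
          rw [hsupp c (Finset.mem_inter.1 hc).2]; exact hq c (Finset.mem_inter.1 hc).1)
        (Finset.mem_inter.2 ⟨hd, hdT⟩)
        (fun c hc => by
          rw [hsupp c (Finset.mem_inter.1 hc).2, hsupp d hdT]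
          exact hmin c (Finset.mem_inter.1 hc).1)
      simp only [State.restrict, Finset.erase_inter] at this ⊢
      exact .single this
    · have : s.cands.erase d ∩ T = s.cands ∩ T := by
        ext x
        simp only [Finset.mem_inter, Finset.mem_erase]
        constructor
        · rintro ⟨⟨-, h1⟩, h2⟩; exact ⟨h1, h2⟩
        · rintro ⟨h1, h2⟩; exact ⟨⟨fun hx => hdT (hx ▸ h2), h1⟩, h2⟩
      simp only [State.restrict, this]
      exact .refl

theorem TopInvariant.of_reachable {P : Profile n m} {k : ℕ} {T : Finset (Fin m)}
    (hT : ∀ c ∉ T, ∀ v, n < pos P v c) {s : State n m}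
    (h : ReflTransGen (Round P k) ⟨Finset.univ, Finset.univ, ∅⟩ s) :
    TopInvariant P k T s ∧
      ReflTransGen (Round P k) ⟨T, Finset.univ, ∅⟩ (s.restrict T) := by
  induction h with
  | refl => exact ⟨.init hT, by simp [State.restrict, ReflTransGen.refl]⟩
  | tail _ hr ih => exact ⟨ih.1.step hT hr, ih.2.trans (ih.1.restrict_step hT hr)⟩

/-- Without a quota, the candidates outside `T` can be eliminated one after the other. -/
theorem TopInvariant.reach_restrict {P : Profile n m} {k : ℕ} {T : Finset (Fin m)}
    (hT : ∀ c ∉ T, ∀ v, n < pos P v c) {s : State n m} (h : TopInvariant P k T s)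
    (hk : s.elected.card < k) (hq : NoQuota P k s) :
    ReflTransGen (Round P k) s (s.restrict T) := by
  induction hr : (s.cands \ T).card generalizing s with
  | zero =>
    have : s.cands ∩ T = s.cands :=
      Finset.inter_eq_left.2 (Finset.sdiff_eq_empty_iff_subset.1 (Finset.card_eq_zero.1 hr))
    simp only [State.restrict, this]
    exact .refl
  | succ r ih =>
    obtain ⟨z, hz⟩ := Finset.card_pos.1 (by omega : 0 < (s.cands \ T).card)
    obtain ⟨hzs, hzT⟩ := Finset.mem_sdiff.1 hz
    have hz0 := h.supporters_eq_empty hT hzT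
    have hstep : Round P k s ⟨s.cands.erase z, s.voters, s.elected⟩ :=
      .eliminate s z hk hq hzs (by simp [hz0])
    have := ih (h.step hT hstep) hk (hq.erase hz0)
      (by simp only [Finset.erase_sdiff_comm, Finset.card_erase_of_mem hz]; omega)
    have he : s.cands.erase z ∩ T = s.cands ∩ T := by
      ext x
      simp only [Finset.mem_inter, Finset.mem_erase]
      constructor
      · rintro ⟨⟨-, h1⟩, h2⟩; exact ⟨h1, h2⟩
      · rintro ⟨h1, h2⟩; exact ⟨⟨fun hx => hzT (hx ▸ h2), h1⟩, h2⟩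
    simp only [State.restrict, he] at this ⊢
    exact .head hstep this

/-- An election lifts as it stands. An elimination inside `T` may be illegal while candidates
without supporters remain outside `T`, so these are eliminated first, by
`TopInvariant.reach_restrict`. -/
theorem reachable_of_restricted {P : Profile n m} {k : ℕ} {T : Finset (Fin m)}
    (hT : ∀ c ∉ T, ∀ v, n < pos P v c) {s : State n m}
    (h : ReflTransGen (Round P k) ⟨T, Finset.univ, ∅⟩ s) :
    ∃ s', ReflTransGen (Round P k) ⟨Finset.univ, Finset.univ, ∅⟩ s' ∧ s'.restrict T = s := by
  induction h with
  | refl => exact ⟨_, .refl, by simp [State.restrict]⟩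
  | @tail s₁ s₂ _ hr ih =>
    obtain ⟨s', hs', rfl⟩ := ih
    have hJ := (TopInvariant.of_reachable hT hs').1
    have hsupp := fun c => hJ.supporters_restrict hT (c := c)
    cases hr with
    | elect c D hk hc hq hD hDq =>
      obtain ⟨hcs, hcT⟩ := Finset.mem_inter.1 hc
      rw [hsupp c hcT] at hq hD
      refine ⟨_, hs'.tail (.elect s' c D hk hcs hq hD hDq), ?_⟩
      simp [State.restrict, Finset.erase_inter]
    | eliminate d hk hq hd hmin =>
      have hno : NoQuota P k s' := by
        intro c hc
        by_cases hcT : c ∈ T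
        · rw [← hsupp c hcT]; exact hq c (Finset.mem_inter.2 ⟨hc, hcT⟩)
        · rw [hJ.supporters_eq_empty hT hcT]; exact quota_pos n k
      have hr' := hJ.reach_restrict hT hk hno
      refine ⟨_, (hs'.trans hr').tail (.eliminate _ d hk hq hd hmin), ?_⟩
      simp only [State.restrict, Finset.erase_inter, Finset.inter_assoc, Finset.inter_self]

/-- The rule is not affected by candidates that no voter has in the top `n` places. -/
theorem mem_STV_iff_restricted {P : Profile n m} {k : ℕ} {T : Finset (Fin m)}
    (hT : ∀ c ∉ T, ∀ v, n < pos P v c) {W : Finset (Fin m)} :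
    W ∈ STV P k ↔ W.card = k ∧ ∃ s : State n m,
      ReflTransGen (Round P k) ⟨T, Finset.univ, ∅⟩ s ∧ s.elected = W := by
  constructor
  · rintro ⟨hW, s, hs, rfl⟩
    exact ⟨hW, _, (TopInvariant.of_reachable hT hs).2, rfl⟩
  · rintro ⟨hW, s, hs, rfl⟩
    obtain ⟨s', hs', rfl⟩ := reachable_of_restricted hT hs
    exact ⟨hW, s', hs', rfl⟩

theorem subset_of_mem_STV {P : Profile n m} {k : ℕ} {T : Finset (Fin m)}
    (hT : ∀ c ∉ T, ∀ v, n < pos P v c) {W : Finset (Fin m)} (hW : W ∈ STV P k) : W ⊆ T := by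
  obtain ⟨-, s, hs, rfl⟩ := hW
  exact (TopInvariant.of_reachable hT hs).1.elected

theorem rank_le (P : Profile n m) (v : Fin n) (c : Fin m) : rank P c ≤ pos P v c :=
  ciInf_le ⟨0, fun _ _ => Nat.zero_le _⟩ v

/-- Here `T` may be taken to be everything except `c`. -/
theorem notMem_of_lt_rank {P : Profile n m} {k : ℕ} {c : Fin m} (hc : n < rank P c)
    {W : Finset (Fin m)} (hW : W ∈ STV P k) : c ∉ W := by
  intro hcW
  have := subset_of_mem_STV (T := Finset.univ.erase c) (P := P) (k := k) (fun d hd v => ?_) hW hcW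
  · simp at this
  · obtain rfl : d = c := by simpa using hd
    exact hc.trans_le (rank_le P v d)

/-- The count among the candidates of `S` depends only on the order of `S` in the rankings. -/
theorem reachable_congr {P P' : Profile n m} {k : ℕ} {S : Finset (Fin m)}
    (hS : ∀ c ∈ S, ∀ d ∈ S, ∀ v, pos P v c ≤ pos P v d ↔ pos P' v c ≤ pos P' v d)
    {s : State n m} (h : ReflTransGen (Round P k) ⟨S, Finset.univ, ∅⟩ s) :
    s.cands ⊆ S ∧ ReflTransGen (Round P' k) ⟨S, Finset.univ, ∅⟩ s := by
  induction h with
  | refl => exact ⟨subset_rfl, .refl⟩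
  | @tail s₁ s₂ _ hr ih =>
    obtain ⟨hsub, ih⟩ := ih
    have hsupp : ∀ c, supporters P s₁ c = supporters P' s₁ c := by
      intro c
      ext v
      simp only [mem_supporters]
      refine and_congr_right fun _ => and_congr_right fun hc => ?_
      exact forall₂_congr fun d hd => hS c (hsub hc) d (hsub hd) v
    cases hr with
    | elect c D hk hc hq hD hDq =>
      rw [hsupp] at hq hD
      exact ⟨(Finset.erase_subset _ _).trans hsub, ih.tail (.elect s₁ c D hk hc hq hD hDq)⟩
    | eliminate d hk hq hd hmin =>
      simp only [hsupp] at hq hmin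
      exact ⟨(Finset.erase_subset _ _).trans hsub, ih.tail (.eliminate s₁ d hk hq hd hmin)⟩

theorem STV_congr {P P' : Profile n m} {k : ℕ} {S : Finset (Fin m)}
    (hT : ∀ c ∉ S, ∀ v, n < pos P v c) (hT' : ∀ c ∉ S, ∀ v, n < pos P' v c)
    (hS : ∀ c ∈ S, ∀ d ∈ S, ∀ v, pos P v c ≤ pos P v d ↔ pos P' v c ≤ pos P' v d) :
    STV P k = STV P' k := by
  ext W
  rw [mem_STV_iff_restricted hT, mem_STV_iff_restricted hT']
  refine and_congr_right fun _ => exists_congr fun s => and_congr_left fun _ => ⟨fun h => ?_,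
    fun h => ?_⟩
  · exact (reachable_congr hS h).2
  · exact (reachable_congr (fun c hc d hd v => (hS c hc d hd v).symm) h).2

end Restrict

/-! ### Swaps: the bound on the radius and the restriction to candidates of small rank. -/

section Swaps

variable {n m : ℕ}

open Relation

theorem SwapsTo.trans {S : Set (Fin m)} {t t' : ℕ} {P Q R : Profile n m} (h : SwapsTo S t P Q)
    (h' : SwapsTo S t' Q R) : SwapsTo S (t + t') P R := by
  induction h' with
  | refl => exact h
  | step v i hi hS _ ih => exact .step v i hi hS (ih h)

theorem SwapsTo.mono {S S' : Set (Fin m)} (hS : S ⊆ S') {t : ℕ} {P Q : Profile n m}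
    (h : SwapsTo S t P Q) : SwapsTo S' t P Q := by
  induction h with
  | refl => exact .refl _
  | step v i hi hmem _ ih => exact .step v i hi (hmem.imp (@hS _) (@hS _)) ih

theorem CanChangeWith.mono {S S' : Set (Fin m)} (hS : S ⊆ S') {P : Profile n m} {k B B' : ℕ}
    (hB : B ≤ B') (h : CanChangeWith S P k B) : CanChangeWith S' P k B' := by
  obtain ⟨t, ht, P', hP, hne⟩ := h
  exact ⟨t, ht.trans hB, P', hP.mono hS, hne⟩

theorem swapAt_self (P : Profile n m) (v : Fin n) (i : ℕ) (hi : i + 1 < m) :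
    swapAt P v i hi v = P v * Equiv.swap ⟨i, Nat.lt_of_succ_lt hi⟩ ⟨i + 1, hi⟩ := by
  simp [swapAt]

theorem swapAt_of_ne (P : Profile n m) {u v : Fin n} (i : ℕ) (hi : i + 1 < m) (h : u ≠ v) :
    swapAt P v i hi u = P u := by
  simp [swapAt, h]

theorem symm_swapAt_self (P : Profile n m) (v : Fin n) (i : ℕ) (hi : i + 1 < m) (c : Fin m) :
    (swapAt P v i hi v).symm c =
      Equiv.swap ⟨i, Nat.lt_of_succ_lt hi⟩ ⟨i + 1, hi⟩ ((P v).symm c) := by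
  rw [swapAt_self, Equiv.symm_apply_eq]
  simp

theorem pos_le_pos_swapAt (P : Profile n m) (u v : Fin n) (i : ℕ) (hi : i + 1 < m) (c : Fin m) :
    pos P u c ≤ pos (swapAt P v i hi) u c + 1 := by
  by_cases huv : u = v
  · subst huv
    simp only [pos, symm_swapAt_self]
    rw [Equiv.swap_apply_def]
    split_ifs with h1 h2
    · simp [h1]
    · simp [h2]
    · omega
  · simp [pos, swapAt_of_ne P i hi huv]

theorem SwapsTo.pos_le {S : Set (Fin m)} {t : ℕ} {P P' : Profile n m} (h : SwapsTo S t P P')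
    (v : Fin n) (c : Fin m) : pos P v c ≤ pos P' v c + t := by
  induction h with
  | refl => simp
  | @step t P P' u i hi _ _ ih =>
    have := pos_le_pos_swapAt P' v u i hi c
    omega

/-- Omitting the swaps that move no candidate of `S` does not affect the places of `S`. -/
theorem SwapsTo.exists_agree (S : Set (Fin m)) {t : ℕ} {P P' : Profile n m}
    (h : SwapsTo Set.univ t P P') : ∃ t' ≤ t, ∃ P'', SwapsTo S t' P P'' ∧
      ∀ v i, P' v i ∈ S ∨ P'' v i ∈ S → P' v i = P'' v i := by
  induction h with
  | refl P => exact ⟨0, le_rfl, P, .refl P, fun _ _ _ => rfl⟩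
  | @step t P P' v i hi _ _ ih =>
    obtain ⟨t', ht', P'', hP'', hag⟩ := ih
    -- The pruned profile decides whether the swap is kept. If it is dropped, agreement shows that
    -- `P'` has no candidate of `S` in these two places either.
    by_cases hmem : P'' v ⟨i, Nat.lt_of_succ_lt hi⟩ ∈ S ∨ P'' v ⟨i + 1, hi⟩ ∈ S
    · refine ⟨t' + 1, by omega, _, .step v i hi hmem hP'', fun u j => ?_⟩
      by_cases huv : u = v
      · subst huv
        simpa only [swapAt_self, Equiv.Perm.mul_apply] using hag u _
      · simpa only [swapAt_of_ne _ i hi huv] using hag u j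
    · refine ⟨t', by omega, P'', hP'', fun u j => ?_⟩
      by_cases huv : u = v
      · subst huv
        have h1 : P' u ⟨i, Nat.lt_of_succ_lt hi⟩ ∉ S := fun h => by
          rw [hag u _ (.inl h)] at h; exact hmem (.inl h)
        have h2 : P' u ⟨i + 1, hi⟩ ∉ S := fun h => by
          rw [hag u _ (.inl h)] at h; exact hmem (.inr h)
        rw [swapAt_self, Equiv.Perm.mul_apply, Equiv.swap_apply_def]
        push Not at hmem
        split_ifs with h3 h4
        · subst h3
          exact fun h => (h.elim h2 hmem.1).elim
        · subst h4
          exact fun h => (h.elim h1 hmem.2).elim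
        · exact hag u j
      · simpa only [swapAt_of_ne _ i hi huv] using hag u j

theorem lt_pos_of_swapsTo {S : Set (Fin m)} {t r : ℕ} {P P' : Profile n m}
    (h : SwapsTo S t P P') {c : Fin m} (hc : t + r < rank P c) (v : Fin n) : r < pos P' v c := by
  have := h.pos_le v c
  have := rank_le P v c
  omega

/-- Only swaps that move a candidate of small rank matter. -/
theorem CanChange.restrict {P : Profile n m} {k B : ℕ} (h : CanChange P k B) :
    CanChangeWith {c | rank P c ≤ B + n} P k B := by
  classical
  obtain ⟨t, ht, P', hP', hne⟩ := h
  obtain ⟨t', ht', P'', hP'', hag⟩ := hP'.exists_agree {c | rank P c ≤ B + n}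
  refine ⟨t', ht'.trans ht, P'', hP'', fun heq => hne (heq ▸ ?_)⟩
  have hpl : ∀ c, rank P c ≤ B + n → ∀ v, pos P' v c = pos P'' v c := by
    intro c hc v
    have : P'' v ((P' v).symm c) = c := by
      rw [← hag v _ (.inl (by simpa using hc))]; simp
    have : (P' v).symm c = (P'' v).symm c := by rw [Equiv.eq_symm_apply, this]
    simp [pos, this]
  -- Candidates of rank above `B + n` stay below place `n` during `B` swaps, and the others have
  -- identical places in `P'` and `P''`.
  refine STV_congr (S := Finset.univ.filter fun c => rank P c ≤ B + n) (fun c hc v => ?_)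
    (fun c hc v => ?_) fun c hc d hd v => ?_
  · refine lt_pos_of_swapsTo hP' ?_ v
    simp at hc; omega
  · refine lt_pos_of_swapsTo hP'' ?_ v
    simp at hc; omega
  · rw [hpl c (by simpa using hc), hpl d (by simpa using hd)]

/-- The candidate bubbles up place by place and takes part in every swap. -/
theorem exists_raise (P : Profile n m) (v : Fin n) (i : ℕ) (hi : i < m) :
    ∃ P', SwapsTo {P v ⟨i, hi⟩} i P P' ∧ P' v ⟨0, by omega⟩ = P v ⟨i, hi⟩ ∧
      ∀ u ≠ v, P' u = P u := by
  induction i generalizing P with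
  | zero => exact ⟨P, .refl P, rfl, fun _ _ => rfl⟩
  | succ i ih =>
    have hQ : swapAt P v i hi v ⟨i, by omega⟩ = P v ⟨i + 1, hi⟩ := by simp [swapAt_self]
    obtain ⟨P', h1, h2, h3⟩ := ih (swapAt P v i hi) (by omega)
    rw [hQ] at h1 h2
    refine ⟨P', ?_, h2, fun u hu => by rw [h3 u hu, swapAt_of_ne P i hi hu]⟩
    have := (SwapsTo.step (S := {P v ⟨i + 1, hi⟩}) v i hi (.inr rfl) (.refl P)).trans h1
    rwa [Nat.zero_add, Nat.add_comm 1 i] at this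

/-- Swaps that move a candidate outside `W` to the top of every ranking. -/
theorem exists_raise_all (P : Profile n m) {k : ℕ} {W : Finset (Fin m)} (hW : W.card = k)
    (hk : k < m) : ∃ t ≤ n * k, ∃ P', SwapsTo {c | rank P c ≤ k + 1} t P P' ∧
      ∀ v, P' v ⟨0, by omega⟩ ∉ W := by
  suffices H : ∀ A : Finset (Fin n), ∃ t ≤ A.card * k, ∃ P',
      SwapsTo {c | rank P c ≤ k + 1} t P P' ∧ (∀ v ∈ A, P' v ⟨0, by omega⟩ ∉ W) ∧
        ∀ v ∉ A, P' v = P v by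
    obtain ⟨t, ht, P', h1, h2, -⟩ := H Finset.univ
    exact ⟨t, by simpa using ht, P', h1, fun v => h2 v (Finset.mem_univ v)⟩
  intro A
  induction A using Finset.induction_on with
  | empty => exact ⟨0, by simp, P, .refl P, by simp, fun _ _ => rfl⟩
  | insert v A hv ih =>
    obtain ⟨t, ht, Q, h1, h2, h3⟩ := ih
    -- Pigeonhole: `k + 1` places cannot all be filled from `W`. Raising the candidate found costs
    -- at most `k` swaps, and its rank is at most `k + 1`.
    obtain ⟨i, hi⟩ : ∃ i : Fin (k + 1), P v ⟨i, by omega⟩ ∉ W := by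
      by_contra hcon
      push Not at hcon
      have := Finset.card_le_card_of_injOn (s := Finset.univ) (t := W)
        (fun i : Fin (k + 1) => P v ⟨i, by omega⟩) (fun i _ => hcon i)
        (fun i _ j _ h => by simpa [Fin.ext_iff] using h)
      simp at this
      omega
    obtain ⟨P', g1, g2, g3⟩ := exists_raise Q v i (by omega)
    rw [h3 v hv] at g1 g2
    refine ⟨t + i, ?_, P', h1.trans (g1.mono ?_), fun u hu => ?_, fun u hu => ?_⟩
    · rw [Finset.card_insert_of_notMem hv, add_mul]; omega
    · rintro c rfl
      refine (rank_le P v _).trans ?_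
      simp [pos]; omega
    · by_cases huv : u = v
      · subst huv; rwa [g2]
      · rw [g3 u huv]; exact h2 u (Finset.mem_of_mem_insert_of_ne hu huv)
    · rw [g3 u fun h => hu (by simp [h]), h3 u fun h => hu (by simp [h])]

/-- A committee none of whose members is ranked first by anyone does not win. -/
theorem notMem_STV_of_top {P : Profile n m} {k : ℕ} (hm : 0 < m) {W : Finset (Fin m)}
    (hne : W.Nonempty) (hW : ∀ v, P v ⟨0, hm⟩ ∉ W) : W ∉ STV P k := by
  obtain ⟨w, hw⟩ := hne
  have h0 : ∀ c ∈ W, supporters P ⟨Finset.univ, Finset.univ, ∅⟩ c = ∅ := by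
    intro c hc
    rw [Finset.eq_empty_iff_forall_notMem]
    intro v hv
    have := (mem_supporters.1 hv).2.2 (P v ⟨0, hm⟩) (Finset.mem_univ _)
    simp only [pos, Equiv.symm_apply_apply] at this
    have h2 : (P v).symm c = ⟨0, hm⟩ := Fin.ext (by simp only; omega)
    rw [Equiv.symm_apply_eq] at h2
    exact hW v (h2 ▸ hc)
  rintro ⟨-, s, hs, rfl⟩
  -- The first round decides. Either it elects a candidate with supporters, hence one outside `W`,
  -- or nobody reaches the quota. In the latter case `w` has no supporters, so only candidates
  -- without supporters are eliminated, and no quota can arise until `w` itself is gone.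
  suffices H : ∀ s' : State n m,
      ReflTransGen (Round P k) ⟨Finset.univ, Finset.univ, ∅⟩ s' →
      s' = ⟨Finset.univ, Finset.univ, ∅⟩ ∨ (∃ c ∈ s'.elected, c ∉ s.elected) ∨
      w ∉ s'.elected ∧ (w ∉ s'.cands ∨ NoQuota P k s' ∧ supporters P s' w = ∅) by
    rcases H s hs with h | ⟨c, hc, hcn⟩ | ⟨h, -⟩
    · rw [h] at hw; simp at hw
    · exact hcn hc
    · exact h hw
  intro s' hs'
  induction hs' with
  | refl => exact .inl rfl
  | @tail s₁ s₂ _ hr ih =>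
    right
    have elim : ∀ d, supporters P s₁ w = ∅ → NoQuota P k s₁ → w ∈ s₁.cands →
        (∀ c ∈ s₁.cands, (supporters P s₁ d).card ≤ (supporters P s₁ c).card) →
        w ∉ s₁.cands.erase d ∨ NoQuota P k ⟨s₁.cands.erase d, s₁.voters, s₁.elected⟩ ∧
          supporters P ⟨s₁.cands.erase d, s₁.voters, s₁.elected⟩ w = ∅ := by
      intro d hw0 hno hws hmin
      have hd0 := supporters_eq_empty_of_min hmin hws hw0
      by_cases hwd : w = d
      · left; simp [hwd]
      · right
        exact ⟨hno.erase hd0, by rw [supporters_erase P hd0 hwd, hw0]⟩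
    rcases ih with rfl | ⟨c, hc, hcn⟩ | ⟨hwe, hph⟩
    · cases hr with
      | elect c D hk hc hq hD hDq =>
        refine .inl ⟨c, by simp, fun hcW => ?_⟩
        rw [h0 c hcW, Finset.card_empty] at hq
        exact absurd hq (quota_pos n k).not_ge
      | eliminate d hk hq hd hmin =>
        exact .inr ⟨by simp, elim d (h0 w hw) hq (Finset.mem_univ w) hmin⟩
    · left
      cases hr with
      | elect c' D hk hc hq hD hDq => exact ⟨c, Finset.mem_insert_of_mem ‹_›, hcn⟩
      | eliminate d hk hq hd hmin => exact ⟨c, hc, hcn⟩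
    · cases hr with
      | elect c D hk hc hq hD hDq =>
        rcases hph with hws | ⟨hno, -⟩
        · right
          have hcw : w ≠ c := by rintro rfl; exact hws hc
          refine ⟨by simp [hcw, hwe], .inl fun h => hws (Finset.mem_of_mem_erase h)⟩
        · exact absurd (hno c hc) hq.not_gt
      | eliminate d hk hq hd hmin =>
        right
        rcases hph with hws | ⟨hno, hw0⟩
        · exact ⟨hwe, .inl fun h => hws (Finset.mem_of_mem_erase h)⟩
        · by_cases hws : w ∈ s₁.cands
          · exact ⟨hwe, elim d hw0 hno hws hmin⟩
          · exact ⟨hwe, .inl fun h => hws (Finset.mem_of_mem_erase h)⟩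

/-- Normality yields a winning committee, and the raising swaps make this committee lose. -/
theorem canChangeWith_mul (P : Profile n m) {k : ℕ} (hN : Normal n k) (h1 : 1 ≤ k) (hk : k < m) :
    CanChangeWith {c | rank P c ≤ k + 1} P k (n * k) := by
  obtain ⟨W, hW⟩ := STV_nonempty P hN hk.le
  obtain ⟨t, ht, P', hP', htop⟩ := exists_raise_all P hW.1 hk
  refine ⟨t, ht, P', hP', fun heq => ?_⟩
  refine notMem_STV_of_top (P := P') (k := k) (by omega) ?_ htop (heq ▸ hW)
  exact Finset.card_pos.1 (by rw [hW.1]; omega)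

theorem canChange_sq (P : Profile n m) {k : ℕ} (hN : Normal n k) (h1 : 1 ≤ k) (hk : k < m) :
    CanChange P k (n ^ 2) :=
  (canChangeWith_mul P hN h1 hk).mono (Set.subset_univ _)
    (by rw [sq]; exact Nat.mul_le_mul_left n hN.le)

/-- A budget up to `n ^ 2` allows only ranks up to `B + n` to matter. A larger budget is replaced by
the `n * k` raising swaps, which move candidates of rank at most `k + 1`. -/
theorem CanChange.kernel {P : Profile n m} {k B : ℕ} (hN : Normal n k) (h : CanChange P k B) :
    CanChangeWith {c | rank P c ≤ n ^ 2 + n + 1} P k (min B (n ^ 2)) := by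
  obtain hB | hB := le_total B (n ^ 2)
  · rw [min_eq_left hB]
    exact h.restrict.mono (fun c hc => by simp only [Set.mem_ofPred_eq] at hc ⊢; omega) le_rfl
  · obtain ⟨h1, h2⟩ := CanChangeWith.bounds hN h
    have hk := hN.le
    rw [min_eq_right hB]
    refine (canChangeWith_mul P hN h1 h2).mono (fun c hc => ?_) ?_
    · simp only [Set.mem_ofPred_eq] at hc ⊢; omega
    · rw [sq]; exact Nat.mul_le_mul_left n hk

end Swaps

/-! ### Tables that imitate a profile up to a distance threshold. -/

section Kernel

variable {n m : ℕ}

/-- Two distances agree up to the threshold `r`. -/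
def Sim (r : ℕ) (x y : ℤ) : Prop := x = y ∨ (r < x ∧ r < y) ∨ (x < -r ∧ y < -r)

theorem Sim.mono {r r' : ℕ} (h : r ≤ r') {x y : ℤ} (hs : Sim r' x y) : Sim r x y := by
  unfold Sim at *; omega

/-- Two arrangements of points on a line have the same pairwise distances up to `r`. -/
def SimOn {ι : Type} (r : ℕ) (X Y : ι → ℤ) : Prop := ∀ x y, Sim r (X x - X y) (Y x - Y y)

/-- Exchange the places `p` and `q`. -/
def exch {α : Type} [DecidableEq α] (p q z : α) : α := if z = p then q else if z = q then p else z

theorem exch_of_ne {α : Type} [DecidableEq α] {p q z : α} (hp : z ≠ p) (hq : z ≠ q) :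
    exch p q z = z := by
  rw [exch, if_neg hp, if_neg hq]

theorem cast_exch (p q z : ℕ) : ((exch p q z : ℕ) : ℤ) = exch (p : ℤ) (q : ℤ) (z : ℤ) := by
  unfold exch
  push_cast
  simp only [Nat.cast_inj]

/-- Exchanging the points at two neighbouring places preserves similarity. -/
theorem SimOn.exchange {ι : Type} {r : ℕ} {X Y X' Y' : ι → ℤ} (h : SimOn (r + 1) X Y) {a : ι}
    {δ : ℤ} (hδ : δ = 1 ∨ δ = -1)
    (hX : ∀ x, X' x = exch (X a) (X a + δ) (X x))
    (hY : ∀ x, Y' x = exch (Y a) (Y a + δ) (Y x)) :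
    SimOn r X' Y' := by
  unfold exch at hX hY
  -- The threshold `r + 1` is at least one, so distances `0` and `δ` from `a` are exact: a point
  -- occupies one of the two places in `X` iff it does in `Y`.
  have key : ∀ x, X x = X a ∧ Y x = Y a ∧ X' x = X a + δ ∧ Y' x = Y a + δ ∨
      X x = X a + δ ∧ Y x = Y a + δ ∧ X' x = X a ∧ Y' x = Y a ∨
      X x ≠ X a ∧ X x ≠ X a + δ ∧ Y x ≠ Y a ∧ Y x ≠ Y a + δ ∧ X' x = X x ∧ Y' x = Y x := by
    intro x
    have h1 := h x a
    unfold Sim at h1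
    push_cast at h1
    by_cases hx : X x = X a
    · have hy : Y x = Y a := by omega
      exact .inl ⟨hx, hy, by rw [hX, if_pos hx], by rw [hY, if_pos hy]⟩
    have hy : Y x ≠ Y a := by omega
    by_cases hx' : X x = X a + δ
    · have hy' : Y x = Y a + δ := by omega
      exact .inr (.inl ⟨hx', hy', by rw [hX, if_neg hx, if_pos hx'],
        by rw [hY, if_neg hy, if_pos hy']⟩)
    have hy' : Y x ≠ Y a + δ := by omega
    exact .inr (.inr ⟨hx, hx', hy, hy', by rw [hX, if_neg hx, if_neg hx'],
      by rw [hY, if_neg hy, if_neg hy']⟩)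
  intro x y
  have h1 := h x y
  have h2 := h x a
  have h3 := h y a
  clear hX hY h
  unfold Sim at *
  push_cast at h1 h2 h3
  -- Distances beyond the threshold change by at most one, and equal short distances change equally.
  rcases key x with ⟨-, -, e1, e2⟩ | ⟨-, -, e1, e2⟩ | ⟨-, -, -, -, e1, e2⟩ <;>
    rcases key y with ⟨-, -, e3, e4⟩ | ⟨-, -, e3, e4⟩ | ⟨-, -, -, -, e3, e4⟩ <;>
    rw [e1, e2, e3, e4] <;> clear e1 e2 e3 e4 key <;> omega

/-- The places of the candidates of `S` and of the two ends in the ranking of voter `v`. -/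
def points (P : Profile n m) (S : Finset (Fin m)) (v : Fin n) : Option (Option S) → ℤ
  | none => -1
  | some none => m
  | some (some c) => ((P v).symm c : ℕ)

/-- The same for a table, which lists for each voter the end (in column `0`) and the places of
the candidates (in the columns given by `μ`). -/
def tablePoints (T : ℕ → ℕ → ℕ) (S : Finset (Fin m)) (μ : Fin m → ℕ) (v : ℕ) :
    Option (Option S) → ℤ
  | none => -1
  | some none => T v 0
  | some (some c) => T v (μ c)

/-- The table `T` describes the places of `S` in the profile `P` up to the threshold `r`. -/
def Similar (r : ℕ) (P : Profile n m) (S : Finset (Fin m)) (μ : Fin m → ℕ) (T : ℕ → ℕ → ℕ) :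
    Prop := ∀ v : Fin n, SimOn r (points P S v) (tablePoints T S μ v)

theorem Similar.mono {r r' : ℕ} (h : r ≤ r') {P : Profile n m} {S : Finset (Fin m)}
    {μ : Fin m → ℕ} {T : ℕ → ℕ → ℕ} (hs : Similar r' P S μ T) : Similar r P S μ T :=
  fun v x y => (hs v x y).mono h

theorem Similar.congr {r : ℕ} {P : Profile n m} {S : Finset (Fin m)} {μ : Fin m → ℕ}
    {T T' : ℕ → ℕ → ℕ} (hs : Similar r P S μ T) {N : ℕ} (hμ : ∀ c ∈ S, μ c ≤ N)
    (hT : ∀ v < n, ∀ a ≤ N, T' v a = T v a) : Similar r P S μ T' := by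
  intro v
  have : tablePoints T' S μ v = tablePoints T S μ v := by
    funext x
    rcases x with _ | _ | c
    · rfl
    · simp only [tablePoints, hT v v.isLt 0 (Nat.zero_le _)]
    · simp only [tablePoints, hT v v.isLt (μ c) (hμ c c.2)]
  rw [this]
  exact hs v

/-- Even threshold `0` preserves the sign of a difference. -/
theorem Similar.pos_le_iff {r : ℕ} {P : Profile n m} {S : Finset (Fin m)} {μ : Fin m → ℕ}
    {T : ℕ → ℕ → ℕ} (hs : Similar r P S μ T) {c d : Fin m} (hc : c ∈ S) (hd : d ∈ S) (v : Fin n) :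
    pos P v c ≤ pos P v d ↔ T v (μ c) ≤ T v (μ d) := by
  have := hs v (some (some ⟨c, hc⟩)) (some (some ⟨d, hd⟩))
  simp only [points, tablePoints, Sim] at this
  simp only [pos]
  omega

/-- Whether entry `a` of row `v` may move one place up or down. -/
def MoveAllowed (T : ℕ → ℕ → ℕ) (v a : ℕ) (up : Bool) : Prop :=
  up = true ∧ 0 < T v a ∨ up = false ∧ T v a + 1 < T v 0

instance (T : ℕ → ℕ → ℕ) (v a : ℕ) (up : Bool) : Decidable (MoveAllowed T v a up) :=
  inferInstanceAs (Decidable (_ ∨ _))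

/-- The place to which entry `a` of row `v` moves. -/
def moveTarget (T : ℕ → ℕ → ℕ) (v a : ℕ) (up : Bool) : ℕ :=
  bif up then T v a - 1 else T v a + 1

/-- The table after entry `a` of row `v` has moved one place up or down. -/
def moveTable (T : ℕ → ℕ → ℕ) (v a : ℕ) (up : Bool) (u x : ℕ) : ℕ :=
  if u = v ∧ MoveAllowed T v a up then
    exch (T v a) (moveTarget T v a up) (T v x)
  else T u x

theorem moveTable_of_not {T : ℕ → ℕ → ℕ} {v a : ℕ} {up : Bool} (h : ¬ MoveAllowed T v a up) :
    moveTable T v a up = T := by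
  funext u x
  simp [moveTable, h]

theorem points_swapAt_of_ne (P : Profile n m) (S : Finset (Fin m)) {u v : Fin n} (i : ℕ)
    (hi : i + 1 < m) (h : u ≠ v) : points (swapAt P v i hi) S u = points P S u := by
  funext x
  rcases x with _ | _ | c <;> simp [points, swapAt_of_ne P i hi h]

theorem tablePoints_moveTable_of_ne (T : ℕ → ℕ → ℕ) (S : Finset (Fin m)) (μ : Fin m → ℕ)
    {u v : ℕ} (a : ℕ) (up : Bool) (h : u ≠ v) :
    tablePoints (moveTable T v a up) S μ u = tablePoints T S μ u := by
  funext x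
  rcases x with _ | _ | c <;> simp [tablePoints, moveTable, h]

theorem points_swapAt_self (P : Profile n m) (S : Finset (Fin m)) (v : Fin n) (i : ℕ)
    (hi : i + 1 < m) (x : Option (Option S)) :
    points (swapAt P v i hi) S v x = exch (i : ℤ) ((i : ℤ) + 1) (points P S v x) := by
  rcases x with _ | _ | c
  · simp only [points]
    rw [exch_of_ne (by omega) (by omega)]
  · simp only [points]
    rw [exch_of_ne (by omega) (by omega)]
  · simp only [points, symm_swapAt_self, Equiv.swap_apply_def, Fin.ext_iff]
    rw [← Nat.cast_succ, ← cast_exch, exch]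
    split_ifs <;> rfl

/-- A swap that moves the candidate `c ∈ S` down corresponds to a move in the table. -/
theorem Similar.swapAt_down {r : ℕ} {P : Profile n m} {S : Finset (Fin m)} {μ : Fin m → ℕ}
    {T : ℕ → ℕ → ℕ} (hs : Similar (r + 1) P S μ T) {v : Fin n} {i : ℕ} (hi : i + 1 < m)
    {c : Fin m} (hc : c ∈ S) (hci : P v ⟨i, Nat.lt_of_succ_lt hi⟩ = c) :
    Similar r (swapAt P v i hi) S μ (moveTable T v (μ c) false) := by
  intro u
  by_cases huv : u = v
  · subst huv
    have hpc : points P S u (some (some ⟨c, hc⟩)) = i := by simp [points, ← hci]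
    -- The bottom end is at distance at least two, and a threshold of at least one distinguishes
    -- this from distance one.
    have hall : MoveAllowed T u (μ c) false := by
      right
      refine ⟨rfl, ?_⟩
      have := hs u (some none) (some (some ⟨c, hc⟩))
      rw [hpc] at this
      simp only [points, tablePoints, Sim] at this
      omega
    refine (hs u).exchange (a := some (some ⟨c, hc⟩)) (.inl rfl) (fun x => ?_) (fun x => ?_)
    · rw [points_swapAt_self, hpc]
    · have hlt : T u (μ c) + 1 < T u 0 := by simpa [MoveAllowed] using hall
      rcases x with _ | _ | d
      · simp only [tablePoints]
        rw [exch_of_ne (by omega) (by omega)]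
      · simp only [tablePoints, moveTable, moveTarget, hall, and_self, if_true, cond_false]
        rw [exch_of_ne (by omega) (by omega), exch_of_ne (by omega) (by omega)]
      · simp only [tablePoints, moveTable, moveTarget, hall, and_self, if_true, cond_false]
        rw [cast_exch]
        push_cast
        rfl
  · rw [points_swapAt_of_ne P S i hi huv,
      tablePoints_moveTable_of_ne T S μ _ _ (by simpa [Fin.ext_iff] using huv)]
    exact fun x y => (hs u x y).mono (Nat.le_succ r)

/-- A swap that moves the candidate `c ∈ S` up corresponds to a move in the table. -/
theorem Similar.swapAt_up {r : ℕ} {P : Profile n m} {S : Finset (Fin m)} {μ : Fin m → ℕ}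
    {T : ℕ → ℕ → ℕ} (hs : Similar (r + 1) P S μ T) {v : Fin n} {i : ℕ} (hi : i + 1 < m)
    {c : Fin m} (hc : c ∈ S) (hci : P v ⟨i + 1, hi⟩ = c) :
    Similar r (swapAt P v i hi) S μ (moveTable T v (μ c) true) := by
  intro u
  by_cases huv : u = v
  · subst huv
    have hpc : points P S u (some (some ⟨c, hc⟩)) = (i : ℤ) + 1 := by simp [points, ← hci]
    have hall : MoveAllowed T u (μ c) true := by
      left
      refine ⟨rfl, ?_⟩
      have := hs u none (some (some ⟨c, hc⟩))
      rw [hpc] at this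
      simp only [points, tablePoints, Sim] at this
      omega
    have hpos : 0 < T u (μ c) := by
      rcases hall with h | h
      · exact h.2
      · simp at h
    refine (hs u).exchange (a := some (some ⟨c, hc⟩)) (δ := -1) (.inr rfl) (fun x => ?_)
      (fun x => ?_)
    · rw [points_swapAt_self, hpc]
      unfold exch
      split_ifs <;> omega
    -- `exch` acts on all columns; this inequality ensures that the end in column `0` is not
    -- touched.
    · have hend : T u (μ c) < T u 0 := by
        have := hs u (some none) (some (some ⟨c, hc⟩))
        rw [hpc] at this
        simp only [points, tablePoints, Sim] at this
        omega
      rcases x with _ | _ | d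
      · simp only [tablePoints]
        rw [exch_of_ne (by omega) (by omega)]
      · simp only [tablePoints, moveTable, moveTarget, hall, and_self, if_true, cond_true]
        rw [exch_of_ne (by omega) (by omega), exch_of_ne (by omega) (by omega)]
      · simp only [tablePoints, moveTable, moveTarget, hall, and_self, if_true, cond_true]
        rw [cast_exch, Nat.cast_sub hpos]
        push_cast
        rfl
  · rw [points_swapAt_of_ne P S i hi huv,
      tablePoints_moveTable_of_ne T S μ _ _ (by simpa [Fin.ext_iff] using huv)]
    exact fun x y => (hs u x y).mono (Nat.le_succ r)

/-- Every move in the table corresponds to at most one swap. -/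
theorem Similar.exists_of_move {r : ℕ} {P : Profile n m} {S : Finset (Fin m)} {μ : Fin m → ℕ}
    {T : ℕ → ℕ → ℕ} (hs : Similar (r + 1) P S μ T) (v : Fin n) {c : Fin m} (hc : c ∈ S)
    (up : Bool) : ∃ t ≤ 1, ∃ P', SwapsTo (S : Set (Fin m)) t P P' ∧
      Similar r P' S μ (moveTable T v (μ c) up) := by
  obtain ⟨j, hj⟩ : ∃ j, (P v).symm c = j := ⟨_, rfl⟩
  have hjc : P v j = c := by simp [← hj]
  cases up with
  | false =>
    by_cases h : (j : ℕ) + 1 < m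
    · exact ⟨1, le_rfl, _, .step v j h (.inl (by simpa [hjc] using hc)) (.refl P),
        hs.swapAt_down h hc hjc⟩
    -- At the last place the end is exactly one away, also in the table, so the move is void and
    -- costs no swap.
    · rw [moveTable_of_not]
      · exact ⟨0, by omega, P, .refl P, hs.mono (Nat.le_succ r)⟩
      · rintro (h' | ⟨-, h'⟩)
        · simp at h'
        · have := hs v (some none) (some (some ⟨c, hc⟩))
          simp only [points, tablePoints, Sim, hj] at this
          omega
  | true =>
    by_cases h : 0 < (j : ℕ)
    · have hi : (j : ℕ) - 1 + 1 < m := by omega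
      have hji : P v ⟨(j : ℕ) - 1 + 1, hi⟩ = c := by
        rw [← hjc]; congr 1; ext; simp only; omega
      exact ⟨1, le_rfl, _, .step v (j - 1) hi (.inr (by simpa [hji] using hc)) (.refl P),
        hs.swapAt_up hi hc hji⟩
    · rw [moveTable_of_not]
      · exact ⟨0, by omega, P, .refl P, hs.mono (Nat.le_succ r)⟩
      · rintro (⟨-, h'⟩ | h')
        · have := hs v none (some (some ⟨c, hc⟩))
          simp only [points, tablePoints, Sim, hj] at this
          omega
        · simp at h'

/-- Every swap that moves a candidate of `S` corresponds to a move in the table. -/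
theorem Similar.exists_of_swapAt {r : ℕ} {P : Profile n m} {S : Finset (Fin m)} {μ : Fin m → ℕ}
    {T : ℕ → ℕ → ℕ} (hs : Similar (r + 1) P S μ T) (v : Fin n) (i : ℕ) (hi : i + 1 < m)
    (hS : P v ⟨i, Nat.lt_of_succ_lt hi⟩ ∈ (S : Set (Fin m)) ∨ P v ⟨i + 1, hi⟩ ∈ (S : Set (Fin m))) :
    ∃ c ∈ S, ∃ up, Similar r (swapAt P v i hi) S μ (moveTable T v (μ c) up) := by
  rcases hS with h | h
  · exact ⟨_, h, false, hs.swapAt_down hi h rfl⟩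
  · exact ⟨_, h, true, hs.swapAt_up hi h rfl⟩

/-- Entry `a` of row `v` in a table with `N + 1` columns that is stored row by row. -/
def entry (N : ℕ) (l : List ℕ) (v a : ℕ) : ℕ := l.getD (v * (N + 1) + a) 0

/-- `moveTable` for tables stored as lists. -/
def moveList (N : ℕ) (l : List ℕ) (v a : ℕ) (up : Bool) : List ℕ :=
  (List.range l.length).map fun j =>
    moveTable (entry N l) v a up (j / (N + 1)) (j % (N + 1))

theorem length_moveList (N : ℕ) (l : List ℕ) (v a : ℕ) (up : Bool) :
    (moveList N l v a up).length = l.length := by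
  simp [moveList]

theorem entry_moveList {N : ℕ} {l : List ℕ} (hl : l.length = n * (N + 1)) {v a : ℕ} {up : Bool}
    {u x : ℕ} (hu : u < n) (hx : x ≤ N) :
    entry N (moveList N l v a up) u x = moveTable (entry N l) v a up u x := by
  have h1 : u * (N + 1) + x < l.length := by
    rw [hl]
    calc u * (N + 1) + x < (u + 1) * (N + 1) := by rw [add_mul]; omega
      _ ≤ n * (N + 1) := Nat.mul_le_mul_right _ hu
  have h2 : (u * (N + 1) + x) / (N + 1) = u := by
    rw [mul_comm, Nat.mul_add_div (by omega), Nat.div_eq_of_lt (by omega), add_zero]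
  have h3 : (u * (N + 1) + x) % (N + 1) = x := by
    rw [mul_comm, Nat.mul_add_mod, Nat.mod_eq_of_lt (by omega)]
  rw [entry, List.getD_eq_getElem _ _ (by rwa [length_moveList])]
  simp only [moveList, List.getElem_map, List.getElem_range, h2, h3]

/-- All tables that arise by one move. -/
def moveAll (n N : ℕ) (l : List ℕ) : List (List ℕ) :=
  (List.range n).flatMap fun v => (List.range N).flatMap fun a =>
    [moveList N l v (a + 1) false, moveList N l v (a + 1) true]

theorem mem_moveAll {n N : ℕ} {l l' : List ℕ} : l' ∈ moveAll n N l ↔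
    ∃ v < n, ∃ a < N, ∃ up, l' = moveList N l v (a + 1) up := by
  simp [moveAll]

/-- All tables that arise by at most `B` moves. -/
def reachTables (n N B : ℕ) (l : List ℕ) : List (List ℕ) :=
  (fun acc : List (List ℕ) => acc ++ acc.flatMap (moveAll n N))^[B] [l]

theorem mem_reachTables_succ {n N B : ℕ} {l l' : List ℕ} : l' ∈ reachTables n N (B + 1) l ↔
    l' ∈ reachTables n N B l ∨ ∃ l₁ ∈ reachTables n N B l, l' ∈ moveAll n N l₁ := by
  simp only [reachTables, Function.iterate_succ_apply', List.mem_append, List.mem_flatMap]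

/-- `μ` numbers the candidates of `S` by `1, …, N`. -/
structure Lettering (S : Finset (Fin m)) (N : ℕ) (μ : Fin m → ℕ) : Prop where
  injOn : Set.InjOn μ S
  range : ∀ a, (∃ c ∈ S, μ c = a) ↔ 1 ≤ a ∧ a ≤ N

theorem Lettering.le {S : Finset (Fin m)} {N : ℕ} {μ : Fin m → ℕ} (h : Lettering S N μ)
    {c : Fin m} (hc : c ∈ S) : μ c ≤ N := ((h.range _).1 ⟨c, hc, rfl⟩).2

theorem length_of_mem_reachTables {n N B : ℕ} {l l' : List ℕ} (h : l' ∈ reachTables n N B l) :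
    l'.length = l.length := by
  induction B generalizing l' with
  | zero => simp [reachTables] at h; rw [h]
  | succ B ih =>
    rcases mem_reachTables_succ.1 h with h | ⟨l₁, h1, h2⟩
    · exact ih h
    · obtain ⟨v, -, a, -, up, rfl⟩ := mem_moveAll.1 h2
      rw [length_moveList, ih h1]

/-- Each swap uses up one unit of the threshold, hence the reserve `t`. -/
theorem SwapsTo.exists_reachTables {P P' : Profile n m} {S : Finset (Fin m)} {N : ℕ}
    {μ : Fin m → ℕ} (hμ : Lettering S N μ) {l : List ℕ} (hl : l.length = n * (N + 1)) {t : ℕ}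
    (h : SwapsTo (S : Set (Fin m)) t P P') {r : ℕ} (hs : Similar (r + t) P S μ (entry N l)) :
    ∃ l' ∈ reachTables n N t l, Similar r P' S μ (entry N l') := by
  induction h generalizing r with
  | refl => exact ⟨l, by simp [reachTables], hs⟩
  | @step t P P' v i hi hS _ ih =>
    obtain ⟨l', hl', hs'⟩ := ih (r := r + 1) (by rwa [Nat.add_right_comm])
    obtain ⟨c, hc, up, hup⟩ := hs'.exists_of_swapAt v i hi hS
    obtain ⟨h1, h2⟩ := (hμ.range _).1 ⟨c, hc, rfl⟩
    refine ⟨moveList N l' v (μ c) up, mem_reachTables_succ.2 (.inr ⟨l', hl', ?_⟩), ?_⟩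
    · refine mem_moveAll.2 ⟨v, v.isLt, μ c - 1, by omega, up, ?_⟩
      rw [Nat.sub_add_cancel h1]
    · exact hup.congr (fun c hc => hμ.le hc) fun u hu x hx =>
        entry_moveList ((length_of_mem_reachTables hl').trans hl) hu hx

/-- Void moves need no swap, so the number of swaps is only bounded by the number of moves; again
every move costs one unit of the threshold. -/
theorem exists_swapsTo_of_mem_reachTables {P : Profile n m} {S : Finset (Fin m)} {N : ℕ}
    {μ : Fin m → ℕ} (hμ : Lettering S N μ) {l l' : List ℕ} (hl : l.length = n * (N + 1)) {t : ℕ}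
    (h : l' ∈ reachTables n N t l) {r : ℕ} (hs : Similar (r + t) P S μ (entry N l)) :
    ∃ t' ≤ t, ∃ P', SwapsTo (S : Set (Fin m)) t' P P' ∧ Similar r P' S μ (entry N l') := by
  induction t generalizing r l' with
  | zero =>
    obtain rfl : l' = l := by simpa [reachTables] using h
    exact ⟨0, le_rfl, P, .refl P, hs⟩
  | succ t ih =>
    rcases mem_reachTables_succ.1 h with h | ⟨l₁, h1, h2⟩
    · obtain ⟨t', ht', P', h1, h2⟩ := ih h (r := r) (hs.mono (by omega))
      exact ⟨t', by omega, P', h1, h2⟩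
    · obtain ⟨t', ht', P₁, hP₁, hs₁⟩ := ih h1 (r := r + 1) (by rwa [Nat.add_right_comm])
      obtain ⟨v, hv, a, ha, up, rfl⟩ := mem_moveAll.1 h2
      obtain ⟨c, hc, hca⟩ := (hμ.range (a + 1)).2 ⟨by omega, by omega⟩
      obtain ⟨t₂, ht₂, P', hP', hs'⟩ := hs₁.exists_of_move ⟨v, hv⟩ hc up
      rw [hca] at hs'
      refine ⟨t' + t₂, by omega, P', hP₁.trans hP', ?_⟩
      exact hs'.congr (fun c hc => hμ.le hc) fun u hu x hx =>
        entry_moveList ((length_of_mem_reachTables h1).trans hl) hu hx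

end Kernel

/-! ### The count and the search as computations on lists of numbers. -/

section ListCount

variable {n m : ℕ}

open Relation

/-- A state of the count in terms of numbers: remaining candidates, remaining voters, elected. -/
abbrev ListState : Type := List ℕ × List ℕ × List ℕ

/-- The remaining voters who rank `c` first, according to the table `T`. -/
def listSupporters (T : ℕ → ℕ → ℕ) (s : ListState) (c : ℕ) : List ℕ :=
  s.2.1.filter fun v => ∀ d ∈ s.1, T v c ≤ T v d

/-- The voter lists that occur are free of repetitions, so the sublists of length `q` represent all
possible sets of deleted voters. -/
def listElect (T : ℕ → ℕ → ℕ) (q : ℕ) (s : ListState) : List ListState :=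
  (s.1.filter fun c => q ≤ (listSupporters T s c).length).flatMap fun c =>
    ((listSupporters T s c).sublists.filter fun D => D.length = q).map fun D =>
      (s.1.filter fun x => x ≠ c, s.2.1.filter fun v => v ∉ D, c :: s.2.2)

def listEliminate (T : ℕ → ℕ → ℕ) (s : ListState) : List ListState :=
  (s.1.filter fun d => ∀ c ∈ s.1, (listSupporters T s d).length ≤ (listSupporters T s c).length).map
    fun d => (s.1.filter fun x => x ≠ d, s.2.1, s.2.2)

/-- All states that can follow the state `s`. -/
def listRound (T : ℕ → ℕ → ℕ) (q k : ℕ) (s : ListState) : List ListState :=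
  if s.2.2.length < k then
    if ∀ c ∈ s.1, (listSupporters T s c).length < q then listEliminate T s else listElect T q s
  else []

/-- All states that can be reached in at most `r` rounds. -/
def listReach (T : ℕ → ℕ → ℕ) (q k r : ℕ) (s : ListState) : List ListState :=
  (fun acc : List ListState => acc ++ acc.flatMap (listRound T q k))^[r] [s]

/-- The committees of size `k` that can be elected, as lists of numbers. -/
def listOutcomes (T : ℕ → ℕ → ℕ) (n N k : ℕ) : List (List ℕ) :=
  ((listReach T (quota n k) k N ((List.range N).map (· + 1), List.range n, [])).filter
    fun s => s.2.2.length = k).map fun s => s.2.2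

theorem mem_listReach_succ {T : ℕ → ℕ → ℕ} {q k r : ℕ} {s s' : ListState} :
    s' ∈ listReach T q k (r + 1) s ↔
      s' ∈ listReach T q k r s ∨ ∃ s₁ ∈ listReach T q k r s, s' ∈ listRound T q k s₁ := by
  simp only [listReach, Function.iterate_succ_apply', List.mem_append, List.mem_flatMap]

/-- The list `l` enumerates the image of `A` under `f`. -/
def Codes {α : Type} (f : α → ℕ) (A : Finset α) (l : List ℕ) : Prop :=
  l.Nodup ∧ ∀ x, x ∈ l ↔ ∃ a ∈ A, f a = x

theorem Codes.mem_iff {α : Type} {f : α → ℕ} {A S : Finset α} {l : List ℕ} (h : Codes f A l)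
    (hf : Set.InjOn f S) (hA : A ⊆ S) {a : α} (ha : a ∈ S) : f a ∈ l ↔ a ∈ A := by
  rw [h.2]
  constructor
  · rintro ⟨b, hb, hba⟩
    rwa [← hf (hA hb) ha hba]
  · exact fun h => ⟨a, h, rfl⟩

theorem Codes.length {α : Type} {f : α → ℕ} {A : Finset α} {l : List ℕ} (h : Codes f A l)
    (hf : Set.InjOn f A) : l.length = A.card := by
  classical
  have : l.toFinset = A.image f := by
    ext x
    rw [List.mem_toFinset, h.2, Finset.mem_image]
  rw [← List.toFinset_card_of_nodup h.1, this, Finset.card_image_of_injOn hf]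

theorem Codes.filter {α : Type} {f : α → ℕ} {A S B : Finset α} {l : List ℕ} (h : Codes f A l)
    (hA : A ⊆ S) (p : ℕ → Prop) [DecidablePred p]
    (hB : ∀ a ∈ S, a ∈ B ↔ a ∈ A ∧ p (f a)) (hBS : B ⊆ S) :
    Codes f B (l.filter fun x => p x) := by
  refine ⟨h.1.filter _, fun x => ?_⟩
  rw [List.mem_filter, h.2]
  constructor
  · rintro ⟨⟨a, ha, rfl⟩, hp⟩
    exact ⟨a, (hB a (hA ha)).2 ⟨ha, by simpa using hp⟩, rfl⟩
  · rintro ⟨a, ha, rfl⟩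
    obtain ⟨h1, h2⟩ := (hB a (hBS ha)).1 ha
    exact ⟨⟨a, h1, rfl⟩, by simpa using h2⟩

/-- The list state `l` describes the state `s` of a count among the candidates of `S`. -/
structure Describes (S : Finset (Fin m)) (μ : Fin m → ℕ) (s : State n m) (l : ListState) :
    Prop where
  cands_subset : s.cands ⊆ S
  elected_subset : s.elected ⊆ S
  disjoint : Disjoint s.cands s.elected
  cands : Codes μ s.cands l.1
  voters : Codes Fin.val s.voters l.2.1
  elected : Codes μ s.elected l.2.2

section

variable {P : Profile n m} {S : Finset (Fin m)} {μ : Fin m → ℕ} {T : ℕ → ℕ → ℕ}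
  {s s' : State n m} {l l' : ListState} {k : ℕ}

/-- All remaining candidates lie in `S`, so it suffices that the table orders `S` as each voter
does. -/
theorem Describes.supporters (h : Describes S μ s l)
    (hT : ∀ c ∈ S, ∀ d ∈ S, ∀ v : Fin n, pos P v c ≤ pos P v d ↔ T v (μ c) ≤ T v (μ d))
    {c : Fin m} (hc : c ∈ s.cands) :
    Codes Fin.val (supporters P s c) (listSupporters T l (μ c)) := by
  refine h.voters.filter (S := Finset.univ) (Finset.subset_univ _)
    _ (fun v _ => ?_) (Finset.subset_univ _)
  rw [mem_supporters]
  refine and_congr_right fun _ => ?_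
  constructor
  · rintro ⟨-, hmin⟩ x hx
    obtain ⟨d, hd, rfl⟩ := (h.cands.2 x).1 hx
    exact (hT c (h.cands_subset hc) d (h.cands_subset hd) v).1 (hmin d hd)
  · intro hmin
    refine ⟨hc, fun d hd => (hT c (h.cands_subset hc) d (h.cands_subset hd) v).2 ?_⟩
    exact hmin _ ((h.cands.2 _).2 ⟨d, hd, rfl⟩)

theorem Describes.card_supporters (h : Describes S μ s l)
    (hT : ∀ c ∈ S, ∀ d ∈ S, ∀ v : Fin n, pos P v c ≤ pos P v d ↔ T v (μ c) ≤ T v (μ d))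
    {c : Fin m} (hc : c ∈ s.cands) :
    (listSupporters T l (μ c)).length = (STVRobust.supporters P s c).card :=
  (h.supporters hT hc).length Fin.val_injective.injOn

theorem Describes.card_elected (h : Describes S μ s l) (hμ : Set.InjOn μ S) :
    l.2.2.length = s.elected.card :=
  h.elected.length (hμ.mono h.elected_subset)

theorem Describes.erase_cands (h : Describes S μ s l) (hμ : Set.InjOn μ S) {c : Fin m}
    (hc : c ∈ s.cands) : Codes μ (s.cands.erase c) (l.1.filter fun x => x ≠ μ c) := by
  refine h.cands.filter h.cands_subset _ (fun a ha => ?_)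
    ((Finset.erase_subset _ _).trans h.cands_subset)
  rw [Finset.mem_erase, and_comm, hμ.ne_iff ha (h.cands_subset hc)]

theorem Describes.elect (h : Describes S μ s l) (hμ : Set.InjOn μ S) {c : Fin m}
    (hc : c ∈ s.cands) {D : Finset (Fin n)} {D' : List ℕ} (hD : ∀ v : Fin n, v ∈ D ↔ (v : ℕ) ∈ D') :
    Describes S μ ⟨s.cands.erase c, s.voters \ D, insert c s.elected⟩
      (l.1.filter fun x => x ≠ μ c, l.2.1.filter fun v => v ∉ D', μ c :: l.2.2) where
  cands_subset := (Finset.erase_subset _ _).trans h.cands_subset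
  elected_subset := Finset.insert_subset (h.cands_subset hc) h.elected_subset
  disjoint := by
    rw [Finset.disjoint_insert_right]
    exact ⟨Finset.notMem_erase _ _, h.disjoint.mono_left (Finset.erase_subset _ _)⟩
  cands := h.erase_cands hμ hc
  voters := by
    refine h.voters.filter (S := Finset.univ) (Finset.subset_univ _)
      _ (fun v _ => ?_) (Finset.subset_univ _)
    rw [Finset.mem_sdiff, hD]
  elected := by
    refine ⟨List.nodup_cons.2 ⟨fun hmem => ?_, h.elected.1⟩, fun x => ?_⟩
    · rw [h.elected.mem_iff hμ h.elected_subset (h.cands_subset hc)] at hmem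
      exact Finset.disjoint_left.1 h.disjoint hc hmem
    · rw [List.mem_cons, h.elected.2, Finset.exists_mem_insert]
      exact or_congr_left eq_comm

theorem Describes.eliminate (h : Describes S μ s l) (hμ : Set.InjOn μ S) {d : Fin m}
    (hd : d ∈ s.cands) : Describes S μ ⟨s.cands.erase d, s.voters, s.elected⟩
      (l.1.filter fun x => x ≠ μ d, l.2.1, l.2.2) where
  cands_subset := (Finset.erase_subset _ _).trans h.cands_subset
  elected_subset := h.elected_subset
  disjoint := h.disjoint.mono_left (Finset.erase_subset _ _)
  cands := h.erase_cands hμ hd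
  voters := h.voters
  elected := h.elected

theorem Describes.noQuota_iff (h : Describes S μ s l)
    (hT : ∀ c ∈ S, ∀ d ∈ S, ∀ v : Fin n, pos P v c ≤ pos P v d ↔ T v (μ c) ≤ T v (μ d)) :
    (∀ c ∈ l.1, (listSupporters T l c).length < quota n k) ↔ NoQuota P k s := by
  constructor
  · intro hq c hc
    rw [← h.card_supporters hT hc]
    exact hq _ ((h.cands.2 _).2 ⟨c, hc, rfl⟩)
  · intro hq x hx
    obtain ⟨c, hc, rfl⟩ := (h.cands.2 x).1 hx
    rw [h.card_supporters hT hc]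
    exact hq c hc

theorem Describes.exists_listRound (h : Describes S μ s l) (hμ : Set.InjOn μ S)
    (hT : ∀ c ∈ S, ∀ d ∈ S, ∀ v : Fin n, pos P v c ≤ pos P v d ↔ T v (μ c) ≤ T v (μ d))
    (hr : Round P k s s') : ∃ l' ∈ listRound T (quota n k) k l, Describes S μ s' l' := by
  cases hr with
  | elect c D hk hc hq hD hDq =>
    have hno : ¬ NoQuota P k s := fun hno => (hno c hc).not_ge hq
    rw [← h.noQuota_iff hT] at hno
    rw [listRound, if_pos (by rwa [h.card_elected hμ]), if_neg hno]
    have hsup := h.supporters hT hc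
    -- Filtering the supporters, instead of listing `D` in any order, makes `D'` a sublist, as the
    -- enumeration in `listElect` requires.
    obtain ⟨D', hD'⟩ : ∃ D', D' = (listSupporters T l (μ c)).filter fun x =>
      ∃ v ∈ D, (v : ℕ) = x := ⟨_, rfl⟩
    have hmem : ∀ v : Fin n, v ∈ D ↔ (v : ℕ) ∈ D' := by
      intro v
      rw [hD', List.mem_filter, hsup.2]
      simp only [Fin.val_inj, exists_eq_right, decide_eq_true_eq]
      exact ⟨fun hv => ⟨hD hv, hv⟩, fun hv => hv.2⟩
    have hcodes : Codes Fin.val D D' := by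
      refine ⟨hD' ▸ hsup.1.filter _, fun x => ?_⟩
      rw [hD', List.mem_filter, hsup.2]
      simp only [decide_eq_true_eq]
      exact ⟨fun hv => hv.2, fun ⟨v, hv, hvx⟩ => ⟨⟨v, hD hv, hvx⟩, v, hv, hvx⟩⟩
    refine ⟨_, ?_, h.elect hμ hc hmem⟩
    rw [listElect, List.mem_flatMap]
    refine ⟨μ c, List.mem_filter.2 ⟨(h.cands.2 _).2 ⟨c, hc, rfl⟩, ?_⟩, List.mem_map.2
      ⟨D', List.mem_filter.2 ⟨List.mem_sublists.2 (hD' ▸ List.filter_sublist), ?_⟩, rfl⟩⟩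
    · simpa [h.card_supporters hT hc] using hq
    · simpa [hcodes.length Fin.val_injective.injOn] using hDq
  | eliminate d hk hq hd hmin =>
    rw [listRound, if_pos (by rwa [h.card_elected hμ]), if_pos ((h.noQuota_iff hT).2 hq)]
    refine ⟨_, ?_, h.eliminate hμ hd⟩
    refine List.mem_map.2 ⟨μ d, List.mem_filter.2 ⟨(h.cands.2 _).2 ⟨d, hd, rfl⟩, ?_⟩, rfl⟩
    simp only [decide_eq_true_eq]
    intro x hx
    obtain ⟨c, hc, rfl⟩ := (h.cands.2 x).1 hx
    rw [h.card_supporters hT hc, h.card_supporters hT hd]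
    exact hmin c hc

theorem Describes.exists_round (h : Describes S μ s l) (hμ : Set.InjOn μ S)
    (hT : ∀ c ∈ S, ∀ d ∈ S, ∀ v : Fin n, pos P v c ≤ pos P v d ↔ T v (μ c) ≤ T v (μ d))
    (hr : l' ∈ listRound T (quota n k) k l) : ∃ s', Round P k s s' ∧ Describes S μ s' l' := by
  rw [listRound] at hr
  split_ifs at hr with hk hno
  · rw [h.card_elected hμ] at hk
    obtain ⟨x, hx, rfl⟩ := List.mem_map.1 hr
    obtain ⟨hx, hmin⟩ := List.mem_filter.1 hx
    obtain ⟨d, hd, rfl⟩ := (h.cands.2 x).1 hx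
    refine ⟨_, .eliminate s d hk ((h.noQuota_iff hT).1 hno) hd fun c hc => ?_, h.eliminate hμ hd⟩
    simp only [decide_eq_true_eq] at hmin
    rw [← h.card_supporters hT hc, ← h.card_supporters hT hd]
    exact hmin _ ((h.cands.2 _).2 ⟨c, hc, rfl⟩)
  · rw [h.card_elected hμ] at hk
    obtain ⟨x, hx, hr⟩ := List.mem_flatMap.1 hr
    obtain ⟨D', hD', rfl⟩ := List.mem_map.1 hr
    obtain ⟨hx, hq⟩ := List.mem_filter.1 hx
    obtain ⟨c, hc, rfl⟩ := (h.cands.2 x).1 hx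
    obtain ⟨hD', hDq⟩ := List.mem_filter.1 hD'
    simp only [decide_eq_true_eq] at hq hDq
    rw [List.mem_sublists] at hD'
    have hsup := h.supporters hT hc
    have hmem : ∀ v : Fin n, v ∈ Finset.univ.filter (fun v : Fin n => (v : ℕ) ∈ D') ↔
      (v : ℕ) ∈ D' := by simp
    have hcodes : Codes Fin.val (Finset.univ.filter (fun v : Fin n => (v : ℕ) ∈ D')) D' := by
      refine ⟨hsup.1.sublist hD', fun x => ⟨fun hx => ?_, ?_⟩⟩
      · obtain ⟨v, -, rfl⟩ := (hsup.2 x).1 (hD'.subset hx)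
        exact ⟨v, by simpa using hx, rfl⟩
      · rintro ⟨v, hv, rfl⟩
        simpa using hv
    refine ⟨_, .elect s c _ hk hc ?_ (fun v hv => ?_) ?_, h.elect hμ hc hmem⟩
    · rwa [← h.card_supporters hT hc]
    · rw [hmem] at hv
      obtain ⟨w, hw, hwv⟩ := (hsup.2 _).1 (hD'.subset hv)
      rwa [← Fin.val_injective hwv]
    · rw [← hcodes.length Fin.val_injective.injOn, hDq]
  · simp at hr

theorem Describes.init {N : ℕ} (hμ : Lettering S N μ) :
    Describes (n := n) S μ ⟨S, Finset.univ, ∅⟩ ((List.range N).map (· + 1), List.range n, []) where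
  cands_subset := subset_rfl
  elected_subset := Finset.empty_subset _
  disjoint := by simp
  cands := by
    refine ⟨List.nodup_range.map (add_left_injective 1), fun x => ?_⟩
    rw [hμ.range]
    simp only [List.mem_map, List.mem_range]
    constructor
    · rintro ⟨a, ha, rfl⟩; omega
    · exact fun h => ⟨x - 1, by omega, by omega⟩
  voters := by
    refine ⟨List.nodup_range, fun x => ?_⟩
    rw [List.mem_range]
    exact ⟨fun h => ⟨⟨x, h⟩, Finset.mem_univ _, rfl⟩, fun ⟨v, _, hv⟩ => hv ▸ v.isLt⟩
  elected := ⟨List.nodup_nil, by simp⟩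

theorem Lettering.card {N : ℕ} (hμ : Lettering S N μ) : S.card = N := by
  have h := (Describes.init (n := 0) hμ).cands.length hμ.injOn
  simpa using h.symm

/-- Every round removes exactly one candidate, so `N` iterations exhaust the count. -/
theorem exists_mem_listReach {N : ℕ} (hμ : Lettering S N μ)
    (hT : ∀ c ∈ S, ∀ d ∈ S, ∀ v : Fin n, pos P v c ≤ pos P v d ↔ T v (μ c) ≤ T v (μ d))
    (h : ReflTransGen (Round P k) ⟨S, Finset.univ, ∅⟩ s) :
    ∃ r, r + s.cands.card = N ∧ ∃ l ∈ listReach T (quota n k) k r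
      ((List.range N).map (· + 1), List.range n, []), Describes S μ s l := by
  induction h with
  | refl => exact ⟨0, by simpa using hμ.card, _, by simp [listReach], .init hμ⟩
  | @tail s₁ s₂ _ hr ih =>
    obtain ⟨r, hrN, l, hl, hd⟩ := ih
    obtain ⟨l', hl', hd'⟩ := hd.exists_listRound hμ.injOn hT hr
    refine ⟨r + 1, ?_, l', mem_listReach_succ.2 (.inr ⟨l, hl, hl'⟩), hd'⟩
    cases hr with
    | elect c D hk hc hq hD hDq =>
      have := Finset.card_erase_add_one hc
      simp only; omega
    | eliminate d hk hq hd hmin =>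
      have := Finset.card_erase_add_one hd
      simp only; omega

theorem exists_reachable_of_mem_listReach {N : ℕ} (hμ : Lettering S N μ)
    (hT : ∀ c ∈ S, ∀ d ∈ S, ∀ v : Fin n, pos P v c ≤ pos P v d ↔ T v (μ c) ≤ T v (μ d)) {r : ℕ}
    (h : l ∈ listReach T (quota n k) k r ((List.range N).map (· + 1), List.range n, [])) :
    ∃ s, ReflTransGen (Round P k) ⟨S, Finset.univ, ∅⟩ s ∧ Describes S μ s l := by
  induction r generalizing l with
  | zero =>
    obtain rfl : l = _ := by simpa [listReach] using h
    exact ⟨_, .refl, .init hμ⟩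
  | succ r ih =>
    rcases mem_listReach_succ.1 h with h | ⟨l₁, h1, h2⟩
    · exact ih h
    · obtain ⟨s, hs, hd⟩ := ih h1
      obtain ⟨s', hr, hd'⟩ := hd.exists_round hμ.injOn hT h2
      exact ⟨s', hs.tail hr, hd'⟩

theorem listReach_mono {q r r' : ℕ} (h : r ≤ r') (hl : l' ∈ listReach T q k r l) :
    l' ∈ listReach T q k r' l := by
  induction h with
  | refl => exact hl
  | step _ ih => exact mem_listReach_succ.2 (.inl ih)

theorem exists_mem_listOutcomes {N : ℕ} (hμ : Lettering S N μ)
    (hS : ∀ c ∉ S, ∀ v, n < pos P v c)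
    (hT : ∀ c ∈ S, ∀ d ∈ S, ∀ v : Fin n, pos P v c ≤ pos P v d ↔ T v (μ c) ≤ T v (μ d))
    {W : Finset (Fin m)} (hW : W ∈ STV P k) :
    W ⊆ S ∧ ∃ e ∈ listOutcomes T n N k, Codes μ W e := by
  obtain ⟨hk, s, hs, rfl⟩ := (mem_STV_iff_restricted hS).1 hW
  obtain ⟨r, hr, l, hl, hd⟩ := exists_mem_listReach hμ hT hs
  refine ⟨hd.elected_subset, l.2.2, List.mem_map.2 ⟨l, List.mem_filter.2
    ⟨listReach_mono (by omega) hl, ?_⟩, rfl⟩, hd.elected⟩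
  simpa [hd.card_elected hμ.injOn] using hk

theorem exists_mem_STV {N : ℕ} (hμ : Lettering S N μ) (hS : ∀ c ∉ S, ∀ v, n < pos P v c)
    (hT : ∀ c ∈ S, ∀ d ∈ S, ∀ v : Fin n, pos P v c ≤ pos P v d ↔ T v (μ c) ≤ T v (μ d))
    {e : List ℕ} (he : e ∈ listOutcomes T n N k) : ∃ W ∈ STV P k, Codes μ W e := by
  obtain ⟨l, hl, rfl⟩ := List.mem_map.1 he
  obtain ⟨hl, hk⟩ := List.mem_filter.1 hl
  obtain ⟨s, hs, hd⟩ := exists_reachable_of_mem_listReach hμ hT hl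
  refine ⟨s.elected, (mem_STV_iff_restricted hS).2 ⟨?_, s, hs, rfl⟩, hd.elected⟩
  simpa [hd.card_elected hμ.injOn] using hk

/-- Every list of `A` has the same members as some list of `B`. -/
def ListsCovered (A B : List (List ℕ)) : Prop := ∀ e ∈ A, ∃ e' ∈ B, ∀ x ∈ e, x ∈ e'

/-- Winning committees all have size `k`, so containment of one in another already forces equality;
the order within the lists plays no role. -/
theorem listsCovered_iff {P' : Profile n m} {T' : ℕ → ℕ → ℕ} {N : ℕ} (hμ : Lettering S N μ)
    (hS : ∀ c ∉ S, ∀ v, n < pos P v c) (hS' : ∀ c ∉ S, ∀ v, n < pos P' v c)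
    (hT : ∀ c ∈ S, ∀ d ∈ S, ∀ v : Fin n, pos P v c ≤ pos P v d ↔ T v (μ c) ≤ T v (μ d))
    (hT' : ∀ c ∈ S, ∀ d ∈ S, ∀ v : Fin n, pos P' v c ≤ pos P' v d ↔ T' v (μ c) ≤ T' v (μ d)) :
    ListsCovered (listOutcomes T n N k) (listOutcomes T' n N k) ↔ STV P k ⊆ STV P' k := by
  constructor
  · intro h W hW
    obtain ⟨hWS, e, he, hc⟩ := exists_mem_listOutcomes hμ hS hT hW
    obtain ⟨e', he', hsub⟩ := h e he
    obtain ⟨W', hW', hc'⟩ := exists_mem_STV hμ hS' hT' he'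
    obtain ⟨hWS', -⟩ := exists_mem_listOutcomes hμ hS' hT' hW'
    have : W ⊆ W' := fun c hcW => by
      have := hsub _ ((hc.2 _).2 ⟨c, hcW, rfl⟩)
      rwa [hc'.mem_iff hμ.injOn hWS' (hWS hcW)] at this
    rwa [Finset.eq_of_subset_of_card_le this (by rw [hW.1, hW'.1])]
  · intro h e he
    obtain ⟨W, hW, hc⟩ := exists_mem_STV hμ hS hT he
    obtain ⟨-, e', he', hc'⟩ := exists_mem_listOutcomes hμ hS' hT' (h hW)
    exact ⟨e', he', fun x hx => by rwa [hc'.2, ← hc.2]⟩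

end

theorem reachTables_mono {n N t B : ℕ} (h : t ≤ B) {l l' : List ℕ}
    (hl : l' ∈ reachTables n N t l) : l' ∈ reachTables n N B l := by
  induction h with
  | refl => exact hl
  | step _ ih => exact mem_reachTables_succ.2 (.inl ih)

/-- The decision procedure on a table: do at most `B` moves change the outcomes? -/
def TableAnswer (n k B N : ℕ) (l : List ℕ) : Prop :=
  ∃ l' ∈ reachTables n N B l,
    ¬ (ListsCovered (listOutcomes (entry N l') n N k) (listOutcomes (entry N l) n N k) ∧
      ListsCovered (listOutcomes (entry N l) n N k) (listOutcomes (entry N l') n N k))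

/-- The margin `B` serves twice: candidates outside `S` stay below place `n` during `B` swaps, and
similarity up to `B` still leaves threshold `0`, enough to compare positions, at the end. -/
theorem canChangeWith_iff_tableAnswer {P : Profile n m} {S : Finset (Fin m)} {μ : Fin m → ℕ}
    {N B k : ℕ} (hμ : Lettering S N μ) (hS : ∀ c ∉ S, ∀ v, B + n < pos P v c) {l : List ℕ}
    (hl : l.length = n * (N + 1)) (hs : Similar B P S μ (entry N l)) :
    CanChangeWith (S : Set (Fin m)) P k B ↔ TableAnswer n k B N l := by
  have key : ∀ P' l' t, t ≤ B → SwapsTo (S : Set (Fin m)) t P P' →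
      Similar 0 P' S μ (entry N l') → (STV P' k ≠ STV P k ↔
      ¬ (ListsCovered (listOutcomes (entry N l') n N k) (listOutcomes (entry N l) n N k) ∧
      ListsCovered (listOutcomes (entry N l) n N k) (listOutcomes (entry N l') n N k))) := by
    intro P' l' t ht hP' hs'
    have h1 : ∀ c ∉ S, ∀ v, n < pos P v c := fun c hc v => by have := hS c hc v; omega
    have h2 : ∀ c ∉ S, ∀ v, n < pos P' v c := fun c hc v => by
      have := hS c hc v
      have := hP'.pos_le v c
      omega
    rw [not_iff_not.2 (and_congr
      (listsCovered_iff hμ h2 h1 (fun c hc d hd v => hs'.pos_le_iff hc hd v)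
        (fun c hc d hd v => hs.pos_le_iff hc hd v))
      (listsCovered_iff hμ h1 h2 (fun c hc d hd v => hs.pos_le_iff hc hd v)
        (fun c hc d hd v => hs'.pos_le_iff hc hd v))),
      ← Set.Subset.antisymm_iff]
  constructor
  · rintro ⟨t, ht, P', hP', hne⟩
    obtain ⟨l', hl', hs'⟩ := hP'.exists_reachTables hμ hl (r := B - t)
      (by rwa [Nat.sub_add_cancel ht])
    refine ⟨l', ?_, (key P' l' t ht hP' (hs'.mono (Nat.zero_le _))).1 hne⟩
    exact reachTables_mono ht hl'
  · rintro ⟨l', hl', hne⟩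
    obtain ⟨t, ht, P', hP', hs'⟩ := exists_swapsTo_of_mem_reachTables hμ hl hl' (r := 0)
      (by rwa [Nat.zero_add])
    exact ⟨t, ht, P', hP', (key P' l' t ht hP' hs').2 hne⟩

end ListCount

/-! ### The search on tables is primitive recursive. -/

section PrimrecAnswer

open Primrec

variable {α β σ : Type} [Primcodable α] [Primcodable β] [Primcodable σ]

theorem primrecPred_forall_mem {f : α → List β} (hf : Primrec f) {p : α → β → Prop}
    (hp : PrimrecPred fun y : β × α => p y.2 y.1) : PrimrecPred fun x => ∀ b ∈ f x, p x b :=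
  (PrimrecRel.forall_mem_list (R := fun b x => p x b) hp).comp hf .id

theorem primrecPred_exists_mem {f : α → List β} (hf : Primrec f) {p : α → β → Prop}
    (hp : PrimrecPred fun y : β × α => p y.2 y.1) : PrimrecPred fun x => ∃ b ∈ f x, p x b :=
  (PrimrecRel.exists_mem_list (R := fun b x => p x b) hp).comp hf .id

theorem primrec_filter {f : α → List β} (hf : Primrec f) {p : α → β → Prop}
    [∀ x b, Decidable (p x b)] (hp : PrimrecPred fun y : β × α => p y.2 y.1) :
    Primrec fun x => (f x).filter fun b => p x b :=
  (PrimrecRel.listFilter (R := fun b x => p x b) hp).comp hf .id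

theorem primrec_sublists : Primrec (List.sublists : List α → List (List α)) := by
  have h : Primrec fun l : List α =>
      l.foldr (fun a acc => acc.flatMap fun x => [x, a :: x]) [[]] := by
    refine list_foldr (f := fun l : List α => l) (g := fun _ => [[]])
      (h := fun _ (p : α × List (List α)) => p.2.flatMap fun x => [x, p.1 :: x]) .id (.const _) ?_
    refine list_flatMap (snd.comp snd) ?_
    exact list_cons.comp snd
      (list_cons.comp (list_cons.comp (fst.comp (snd.comp fst)) snd) (.const []))
  exact h

theorem primrec_entry {N v a : α → ℕ} {l : α → List ℕ} (hN : Primrec N) (hl : Primrec l)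
    (hv : Primrec v) (ha : Primrec a) : Primrec fun x => entry (N x) (l x) (v x) (a x) :=
  (list_getD 0).comp hl (nat_add.comp (nat_mul.comp hv (succ.comp hN)) ha)

theorem primrec_moveTable {N v a u y : α → ℕ} {l : α → List ℕ} {up : α → Bool}
    (hN : Primrec N) (hl : Primrec l) (hv : Primrec v) (ha : Primrec a) (hup : Primrec up)
    (hu : Primrec u) (hy : Primrec y) :
    Primrec fun x => moveTable (entry (N x) (l x)) (v x) (a x) (up x) (u x) (y x) := by
  have e1 := primrec_entry hN hl hv ha
  have e2 := primrec_entry hN hl hv hy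
  have e3 := primrec_entry hN hl hv (.const 0)
  have e4 := primrec_entry hN hl hu hy
  have ht : Primrec fun x => moveTarget (entry (N x) (l x)) (v x) (a x) (up x) :=
    cond hup (nat_sub.comp e1 (.const 1)) (nat_add.comp e1 (.const 1))
  refine ite ((Primrec.eq.comp hu hv).and ?_)
    (ite (Primrec.eq.comp e2 e1) ht (ite (Primrec.eq.comp e2 ht) e1 e2)) e4
  exact ((Primrec.eq.comp hup (.const true)).and (nat_lt.comp (.const 0) e1)).or
    ((Primrec.eq.comp hup (.const false)).and (nat_lt.comp (nat_add.comp e1 (.const 1)) e3))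

theorem primrec_moveList {N v a : α → ℕ} {l : α → List ℕ} {up : α → Bool}
    (hN : Primrec N) (hl : Primrec l) (hv : Primrec v) (ha : Primrec a) (hup : Primrec up) :
    Primrec fun x => moveList (N x) (l x) (v x) (a x) (up x) :=
  list_map (list_range.comp (list_length.comp hl)) (primrec_moveTable (hN.comp fst)
    (hl.comp fst) (hv.comp fst) (ha.comp fst) (hup.comp fst)
    (nat_div.comp snd (succ.comp (hN.comp fst))) (nat_mod.comp snd (succ.comp (hN.comp fst))))

theorem primrec_moveAll {n N : α → ℕ} {l : α → List ℕ} (hn : Primrec n) (hN : Primrec N)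
    (hl : Primrec l) : Primrec fun x => moveAll (n x) (N x) (l x) := by
  refine list_flatMap (list_range.comp hn) (list_flatMap (list_range.comp (hN.comp fst)) ?_)
  have h : ∀ up : Bool, Primrec fun y : (α × ℕ) × ℕ =>
      moveList (N y.1.1) (l y.1.1) y.1.2 (y.2 + 1) up := fun up =>
    primrec_moveList (hN.comp (fst.comp fst)) (hl.comp (fst.comp fst)) (snd.comp fst)
      (succ.comp snd) (.const up)
  exact list_cons.comp (h false) (list_cons.comp (h true) (.const []))

theorem primrec_reachTables {n N B : α → ℕ} {l : α → List ℕ} (hn : Primrec n) (hN : Primrec N)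
    (hB : Primrec B) (hl : Primrec l) : Primrec fun x => reachTables (n x) (N x) (B x) (l x) :=
  nat_iterate hB (list_cons.comp hl (.const [])) (list_append.comp snd
    (list_flatMap snd (primrec_moveAll (hn.comp (fst.comp fst)) (hN.comp (fst.comp fst)) snd)))

theorem primrec_listSupporters {N c : α → ℕ} {l : α → List ℕ} {s : α → ListState}
    (hN : Primrec N) (hl : Primrec l) (hs : Primrec s) (hc : Primrec c) :
    Primrec fun x => listSupporters (entry (N x) (l x)) (s x) (c x) := by
  refine primrec_filter (fst.comp (snd.comp hs))
    (primrecPred_forall_mem (fst.comp (hs.comp snd)) ?_)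
  have h2 : Primrec fun y : ℕ × ℕ × α => y.2.2 := snd.comp snd
  exact nat_le.comp
    (primrec_entry (hN.comp h2) (hl.comp h2) (fst.comp snd) (hc.comp h2))
    (primrec_entry (hN.comp h2) (hl.comp h2) (fst.comp snd) fst)

theorem primrec_listElect {N q : α → ℕ} {l : α → List ℕ} {s : α → ListState}
    (hN : Primrec N) (hl : Primrec l) (hq : Primrec q) (hs : Primrec s) :
    Primrec fun x => listElect (entry (N x) (l x)) (q x) (s x) := by
  refine list_flatMap (primrec_filter (fst.comp hs) (nat_le.comp (hq.comp snd) (list_length.comp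
    (primrec_listSupporters (hN.comp snd) (hl.comp snd) (hs.comp snd) fst)))) ?_
  refine list_map (primrec_filter (primrec_sublists.comp
    (primrec_listSupporters (hN.comp fst) (hl.comp fst) (hs.comp fst) snd))
    (Primrec.eq.comp (list_length.comp fst) (hq.comp (fst.comp snd)))) ?_
  have hx : Primrec fun y : (α × ℕ) × List ℕ => s y.1.1 := hs.comp (fst.comp fst)
  refine Primrec.pair (primrec_filter (fst.comp hx)
    (Primrec.eq.comp fst (snd.comp (fst.comp snd))).not) (Primrec.pair
    (primrec_filter (fst.comp (snd.comp hx)) (PrimrecPred.not ?_))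
    (list_cons.comp (snd.comp fst) (snd.comp (snd.comp hx))))
  -- List membership is rewritten as a bounded existential quantifier.
  refine (primrecPred_exists_mem (f := fun y : ℕ × (α × ℕ) × List ℕ => y.2.2)
    (p := fun y w => w = y.1) (snd.comp snd) ?_).of_eq fun y => by simp
  exact Primrec.eq.comp fst (fst.comp snd)

theorem primrec_listEliminate {N : α → ℕ} {l : α → List ℕ} {s : α → ListState}
    (hN : Primrec N) (hl : Primrec l) (hs : Primrec s) :
    Primrec fun x => listEliminate (entry (N x) (l x)) (s x) := by
  refine list_map (primrec_filter (fst.comp hs)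
    (primrecPred_forall_mem (fst.comp (hs.comp snd)) ?_)) ?_
  · have h2 : Primrec fun y : ℕ × ℕ × α => y.2.2 := snd.comp snd
    exact nat_le.comp
      (list_length.comp (primrec_listSupporters (hN.comp h2) (hl.comp h2) (hs.comp h2)
        (fst.comp snd)))
      (list_length.comp (primrec_listSupporters (hN.comp h2) (hl.comp h2) (hs.comp h2) fst))
  · have hx : Primrec fun y : α × ℕ => s y.1 := hs.comp fst
    exact Primrec.pair (primrec_filter (fst.comp hx) (Primrec.eq.comp fst (snd.comp snd)).not)
      (Primrec.pair (fst.comp (snd.comp hx)) (snd.comp (snd.comp hx)))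

theorem primrec_listRound {N q k : α → ℕ} {l : α → List ℕ} {s : α → ListState}
    (hN : Primrec N) (hl : Primrec l) (hq : Primrec q) (hk : Primrec k) (hs : Primrec s) :
    Primrec fun x => listRound (entry (N x) (l x)) (q x) (k x) (s x) := by
  refine ite (nat_lt.comp (list_length.comp (snd.comp (snd.comp hs))) hk)
    (ite (primrecPred_forall_mem (fst.comp hs) ?_) (primrec_listEliminate hN hl hs)
      (primrec_listElect hN hl hq hs)) (.const [])
  exact nat_lt.comp (list_length.comp (primrec_listSupporters (hN.comp snd) (hl.comp snd)
    (hs.comp snd) fst)) (hq.comp snd)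

theorem primrec_listReach {N q k r : α → ℕ} {l : α → List ℕ} {s : α → ListState}
    (hN : Primrec N) (hl : Primrec l) (hq : Primrec q) (hk : Primrec k) (hr : Primrec r)
    (hs : Primrec s) : Primrec fun x => listReach (entry (N x) (l x)) (q x) (k x) (r x) (s x) := by
  have h2 : Primrec fun y : (α × List ListState) × ListState => y.1.1 := fst.comp fst
  exact nat_iterate hr (list_cons.comp hs (.const [])) (list_append.comp snd
    (list_flatMap snd
      (primrec_listRound (hN.comp h2) (hl.comp h2) (hq.comp h2) (hk.comp h2) snd)))

theorem primrec_listOutcomes {n N k : α → ℕ} {l : α → List ℕ} (hn : Primrec n) (hN : Primrec N)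
    (hk : Primrec k) (hl : Primrec l) :
    Primrec fun x => listOutcomes (entry (N x) (l x)) (n x) (N x) (k x) := by
  have hq : Primrec fun x => quota (n x) (k x) := succ.comp (nat_div.comp hn (succ.comp hk))
  refine list_map (primrec_filter (primrec_listReach hN hl hq hk hN (Primrec.pair
    (list_map (g := fun _ (a : ℕ) => a + 1) (list_range.comp hN) (succ.comp snd)) (Primrec.pair (list_range.comp hn)
      (.const [])))) ?_) (snd.comp (snd.comp snd))
  exact Primrec.eq.comp (list_length.comp (snd.comp (snd.comp fst))) (hk.comp snd)

theorem primrecPred_listsCovered {A B : α → List (List ℕ)} (hA : Primrec A) (hB : Primrec B) :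
    PrimrecPred fun x => ListsCovered (A x) (B x) := by
  refine primrecPred_forall_mem hA (primrecPred_exists_mem (hB.comp snd)
    (primrecPred_forall_mem (fst.comp snd) ?_))
  refine (primrecPred_exists_mem (f := fun y : ℕ × List ℕ × List ℕ × α => y.2.1)
    (p := fun y w => w = y.1) (fst.comp snd) ?_).of_eq fun y => by simp
  exact Primrec.eq.comp fst (fst.comp snd)

theorem primrecPred_tableAnswer {n k B N : α → ℕ} {l : α → List ℕ} (hn : Primrec n)
    (hk : Primrec k) (hB : Primrec B) (hN : Primrec N) (hl : Primrec l) :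
    PrimrecPred fun x => TableAnswer (n x) (k x) (B x) (N x) (l x) := by
  refine primrecPred_exists_mem (primrec_reachTables hn hN hB hl) (PrimrecPred.not ?_)
  have h1 := primrec_listOutcomes (l := fun y : List ℕ × α => y.1) (hn.comp snd) (hN.comp snd)
    (hk.comp snd) fst
  have h2 := primrec_listOutcomes (l := fun y : List ℕ × α => l y.2) (hn.comp snd) (hN.comp snd)
    (hk.comp snd) (hl.comp snd)
  exact (primrecPred_listsCovered h1 h2).and (primrecPred_listsCovered h2 h1)

open Classical in
/-- The decision procedure on an encoded list `n, k, B, N` followed by the table. -/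
noncomputable def answerCode (x : ℕ) : ℕ :=
  let L : List ℕ := ((Encodable.decode x).getD [])
  if TableAnswer (L.getD 0 0) (L.getD 1 0) (L.getD 2 0) (L.getD 3 0) (L.drop 4) then 1 else 0

open Classical in
theorem primrec_answerCode : Primrec answerCode := by
  have hL : Primrec fun x : ℕ => ((Encodable.decode x : Option (List ℕ)).getD []) :=
    option_getD.comp .decode (.const [])
  have hd : ∀ i, Primrec fun x : ℕ =>
      ((Encodable.decode x : Option (List ℕ)).getD []).getD i 0 := fun i =>
    (list_getD 0).comp hL (.const i)
  exact Primrec.ite (primrecPred_tableAnswer (hd 0) (hd 1) (hd 2) (hd 3)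
    (list_drop.comp (.const 4) hL)) (.const 1) (.const 0)

theorem answerCode_encode (n k B N : ℕ) (l : List ℕ) :
    answerCode (Encodable.encode (n :: k :: B :: N :: l)) ≠ 0 ↔ TableAnswer n k B N l := by
  rw [answerCode, Encodable.encodek]
  simp

end PrimrecAnswer

/-! ### Execution rules and compilation of primitive recursive functions. -/

section Machine

/-- The program `p`, started in `s`, halts within `T` steps in a memory that satisfies `Q`. -/
def Runs (p : Prog) (s : Memory) (T : ℕ) (Q : Memory → Prop) : Prop :=
  ∃ t s', Exec p s t s' ∧ t ≤ T ∧ Q s'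

theorem Runs.mono {p : Prog} {s : Memory} {T T' : ℕ} {Q Q' : Memory → Prop} (h : Runs p s T Q)
    (hT : T ≤ T') (hQ : ∀ s', Q s' → Q' s') : Runs p s T' Q' := by
  obtain ⟨t, s', h1, h2, h3⟩ := h
  exact ⟨t, s', h1, h2.trans hT, hQ s' h3⟩

theorem Runs.assign {x : ℕ} {e : Expr} {s : Memory} {T : ℕ} {Q : Memory → Prop}
    (hT : e.cost + 1 ≤ T) (hQ : Q (s.setVar x (e.eval s))) : Runs (.assign x e) s T Q :=
  ⟨_, _, .assign x e s, hT, hQ⟩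

theorem Runs.put {a : ℕ} {i e : Expr} {s : Memory} {T : ℕ} {Q : Memory → Prop}
    (hT : i.cost + e.cost + 1 ≤ T) (hQ : Q (s.setArr a (i.eval s) (e.eval s))) :
    Runs (.put a i e) s T Q :=
  ⟨_, _, .put a i e s, hT, hQ⟩

theorem Runs.seq {p q : Prog} {s : Memory} {T T' : ℕ} {Q Q' : Memory → Prop} (h : Runs p s T Q)
    (h' : ∀ s', Q s' → Runs q s' T' Q') : Runs (.seq p q) s (T + T') Q' := by
  obtain ⟨t, s', h1, h2, h3⟩ := h
  obtain ⟨t', s'', g1, g2, g3⟩ := h' s' h3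
  exact ⟨_, s'', .seq h1 g1, Nat.add_le_add h2 g2, g3⟩

theorem Runs.ite {e : Expr} {p q : Prog} {s : Memory} {T : ℕ} {Q : Memory → Prop}
    (hp : e.eval s ≠ 0 → Runs p s T Q) (hq : e.eval s = 0 → Runs q s T Q) :
    Runs (.ite e p q) s (e.cost + 1 + T) Q := by
  by_cases he : e.eval s = 0
  · obtain ⟨t, s', h1, h2, h3⟩ := hq he
    exact ⟨_, s', .ite_false he h1, Nat.add_le_add_left h2 _, h3⟩
  · obtain ⟨t, s', h1, h2, h3⟩ := hp he
    exact ⟨_, s', .ite_true he h1, Nat.add_le_add_left h2 _, h3⟩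

/-- The rule for a loop that is executed `K` times, with the invariant `I`. -/
theorem Runs.loop_sum {e : Expr} {p : Prog} (K : ℕ) (τ : ℕ → ℕ) (I : ℕ → Memory → Prop)
    (hstep : ∀ j < K, ∀ s, I j s → e.eval s ≠ 0 ∧ Runs p s (τ j) (I (j + 1)))
    (hend : ∀ s, I K s → e.eval s = 0) {s : Memory} (h0 : I 0 s) :
    Runs (.loop e p) s ((∑ j ∈ Finset.range K, (e.cost + 1 + τ j)) + (e.cost + 1)) (I K) := by
  induction K generalizing τ I s with
  | zero => exact ⟨_, s, .loop_done (hend s h0), by simp, h0⟩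
  | succ K ih =>
    obtain ⟨he, t, s', h1, h2, h3⟩ := hstep 0 (by omega) s h0
    obtain ⟨t', s'', g1, g2, g3⟩ := ih (fun j => τ (j + 1)) (fun j => I (j + 1))
      (fun j hj s hs => hstep (j + 1) (by omega) s hs) hend h3
    refine ⟨_, s'', .loop_step he h1 g1, ?_, g3⟩
    rw [Finset.sum_range_succ']
    omega

theorem Runs.loop {e : Expr} {p : Prog} (K τ : ℕ) (I : ℕ → Memory → Prop)
    (hstep : ∀ j < K, ∀ s, I j s → e.eval s ≠ 0 ∧ Runs p s τ (I (j + 1)))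
    (hend : ∀ s, I K s → e.eval s = 0) {s : Memory} (h0 : I 0 s) :
    Runs (.loop e p) s (K * (e.cost + 1 + τ) + (e.cost + 1)) (I K) := by
  simpa using Runs.loop_sum K (fun _ => τ) I hstep hend h0

theorem Memory.setVar_var (s : Memory) (x a y : ℕ) :
    (s.setVar x a).var y = if y = x then a else s.var y := by
  simp [Memory.setVar, Function.update_apply]

theorem Memory.setVar_arr (s : Memory) (x a : ℕ) : (s.setVar x a).arr = s.arr := rfl

theorem Memory.setArr_var (s : Memory) (a i b : ℕ) : (s.setArr a i b).var = s.var := rfl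

theorem Memory.setArr_arr (s : Memory) (a i b c j : ℕ) :
    (s.setArr a i b).arr c j = if c = a ∧ j = i then b else s.arr c j := by
  simp only [Memory.setArr, Function.update_apply]
  split_ifs with h1 h2 h3 <;> simp_all

/-- `f` can be computed within `T` steps from arguments in registers below any given `b`, with the
value put into register `b` and the memory below `b` left unchanged. -/
def ComputableIn {n : ℕ} (f T : List.Vector ℕ n → ℕ) : Prop :=
  ∀ (b : ℕ) (a : Fin n → ℕ), (∀ i, a i < b) → ∃ p, ∀ s : Memory,
    Runs p s (T (.ofFn fun i => s.var (a i))) fun s' =>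
      s'.var b = f (.ofFn fun i => s.var (a i)) ∧ (∀ x < b, s'.var x = s.var x) ∧ s'.arr = s.arr

/-- The values go to consecutive registers from `b` on. Each program leaves everything below its own
target register unchanged, so the arguments and the earlier values survive. -/
theorem exists_chain {n m : ℕ} (g : Fin n → List.Vector ℕ m → ℕ)
    (hg : ∀ i, ∃ T, Primrec T ∧ ComputableIn (g i) T) (j : ℕ) (hj : j ≤ n) :
    ∃ T : List.Vector ℕ m → ℕ, Primrec T ∧ ∀ (b : ℕ) (a : Fin m → ℕ), (∀ i, a i < b) →
      ∃ p, ∀ s : Memory, Runs p s (T (.ofFn fun i => s.var (a i))) fun s' =>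
        (∀ i : Fin n, (i : ℕ) < j → s'.var (b + i) = g i (.ofFn fun i => s.var (a i))) ∧
          (∀ x < b, s'.var x = s.var x) ∧ s'.arr = s.arr := by
  induction j with
  | zero =>
    -- There is no empty program; a harmless assignment takes its place.
    refine ⟨fun _ => 2, .const 2, fun b a ha => ⟨.assign b (.num 0), fun s => ?_⟩⟩
    refine .assign le_rfl ⟨by simp, fun x hx => ?_, rfl⟩
    rw [Memory.setVar_var, if_neg hx.ne]
  | succ j ih =>
    obtain ⟨T, hT, h⟩ := ih (by omega)
    obtain ⟨T', hT', h'⟩ := hg ⟨j, hj⟩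
    refine ⟨fun v => T v + T' v, Primrec.nat_add.comp hT hT', fun b a ha => ?_⟩
    obtain ⟨p, hp⟩ := h b a ha
    obtain ⟨p', hp'⟩ := h' (b + j) a fun i => (ha i).trans_le (Nat.le_add_right _ _)
    refine ⟨.seq p p', fun s => (hp s).seq fun s₁ ⟨h1, h2, h3⟩ => ?_⟩
    have he : ∀ i, s₁.var (a i) = s.var (a i) := fun i => h2 _ (ha i)
    refine ((hp' s₁).mono (by simp only [he]; exact le_rfl) fun s₂ ⟨g1, g2, g3⟩ =>
      ⟨fun i hi => ?_, fun x hx => ?_, g3.trans h3⟩)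
    · simp only [he] at g1
      rcases Nat.lt_succ_iff_lt_or_eq.1 hi with hi | hi
      · rw [g2 _ (by omega), h1 i hi]
      · subst hi
        exact g1
    · rw [g2 x (by omega), h2 x hx]

/-- By induction on the construction of `f`. The time bound is built along with the program and is
itself primitive recursive, which finally makes the dependence on the parameter computable. -/
theorem exists_computableIn {n : ℕ} {f : List.Vector ℕ n → ℕ} (hf : Nat.Primrec' f) :
    ∃ T, Primrec T ∧ ComputableIn f T := by
  induction hf with
  | zero =>
    refine ⟨fun _ => 2, .const 2, fun b a ha => ⟨.assign b (.num 0), fun s => ?_⟩⟩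
    refine .assign le_rfl ⟨by simp [Memory.setVar_var, Expr.eval], fun x hx => ?_, rfl⟩
    rw [Memory.setVar_var, if_neg hx.ne]
  | succ =>
    refine ⟨fun _ => 4, .const 4, fun b a ha =>
      ⟨.assign b (.add (.var (a 0)) (.num 1)), fun s => ?_⟩⟩
    refine .assign le_rfl ⟨by simp [Memory.setVar_var, Expr.eval, List.Vector.ofFn], fun x hx => ?_,
      rfl⟩
    rw [Memory.setVar_var, if_neg hx.ne]
  | get i =>
    refine ⟨fun _ => 2, .const 2, fun b a ha => ⟨.assign b (.var (a i)), fun s => ?_⟩⟩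
    refine .assign le_rfl ⟨by simp [Memory.setVar_var, Expr.eval], fun x hx => ?_, rfl⟩
    rw [Memory.setVar_var, if_neg hx.ne]
  | @comp m n f g hf hg ihf ihg =>
    obtain ⟨T, hT, h⟩ := exists_chain g ihg _ le_rfl
    obtain ⟨T', hT', h'⟩ := ihf
    refine ⟨fun v => T v + (T' (.ofFn fun i => g i v) + 2), ?_, fun b a ha => ?_⟩
    · exact Primrec.nat_add.comp hT (Primrec.nat_add.comp
        (hT'.comp (.vector_ofFn fun i => (hg i).to_prim)) (.const 2))
    obtain ⟨p, hp⟩ := h b a ha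
    obtain ⟨p', hp'⟩ := h' (b + n) (fun i => b + i) fun i => by omega
    refine ⟨.seq p (.seq p' (.assign b (.var (b + n)))), fun s =>
      (hp s).seq fun s₁ ⟨h1, h2, h3⟩ => ?_⟩
    have he : (fun i : Fin n => s₁.var (b + i)) =
      fun i => g i (.ofFn fun i => s.var (a i)) := funext fun i => h1 i i.isLt
    have hp₁ := hp' s₁
    rw [he] at hp₁
    refine hp₁.seq fun s₂ ⟨g1, g2, g3⟩ => .assign le_rfl ⟨?_, fun x hx => ?_, g3.trans h3⟩
    · simp [Memory.setVar_var, Expr.eval, g1]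
    · rw [Memory.setVar_var, if_neg hx.ne, g2 x (by omega), h2 x hx]
  | @prec n f g hf hg ihf ihg =>
    obtain ⟨T, hT, h⟩ := ihf
    obtain ⟨T', hT', h'⟩ := ihg
    obtain ⟨R, hR⟩ : ∃ R : List.Vector ℕ n → ℕ → ℕ, R = fun w y =>
      Nat.rec (f w) (fun y IH => g (y ::ᵥ IH ::ᵥ w)) y := ⟨_, rfl⟩
    have hRs : ∀ w y, R w (y + 1) = g (y ::ᵥ R w y ::ᵥ w) := fun w y => by rw [hR]
    have hRp : Primrec₂ R := by
      rw [hR]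
      refine Primrec.nat_rec' (h := fun (x : List.Vector ℕ n × ℕ) (p : ℕ × ℕ) =>
        g (p.1 ::ᵥ p.2 ::ᵥ x.1)) Primrec.snd (hf.to_prim.comp Primrec.fst) ?_
      refine hg.to_prim.comp (Primrec.vector_cons.comp (Primrec.fst.comp .snd)
        (Primrec.vector_cons.comp (Primrec.snd.comp .snd) (Primrec.fst.comp .fst)))
    refine ⟨fun v => v.head.rec (T v.tail + 2 + 4)
      (fun y t => t + (T' (y ::ᵥ R v.tail y ::ᵥ v.tail) + 10)), ?_, fun b a ha => ?_⟩
    · refine Primrec.nat_rec' (h := fun (x : List.Vector ℕ (n + 1)) (p : ℕ × ℕ) =>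
        p.2 + (T' (p.1 ::ᵥ R x.tail p.1 ::ᵥ x.tail) + 10)) .vector_head (Primrec.nat_add.comp (Primrec.nat_add.comp
        (hT.comp Primrec.vector_tail) (.const 2)) (.const 4)) ?_
      have ht : Primrec fun x : List.Vector ℕ (n + 1) × ℕ × ℕ => x.1.tail :=
        Primrec.vector_tail.comp .fst
      have hy : Primrec fun x : List.Vector ℕ (n + 1) × ℕ × ℕ => x.2.1 := Primrec.fst.comp .snd
      exact Primrec.nat_add.comp (Primrec.snd.comp .snd) (Primrec.nat_add.comp
        (hT'.comp (Primrec.vector_cons.comp hy (Primrec.vector_cons.comp (hRp.comp ht hy) ht)))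
        (.const 10))
    obtain ⟨p, hp⟩ := h b (fun i => a i.succ) fun i => ha _
    -- Register `b` holds the current value and `b + 1` the counter; the step function writes to `b
    -- + 2`, which is then copied back to `b`.
    obtain ⟨p', hp'⟩ := h' (b + 2) (Fin.cons (b + 1) (Fin.cons b fun i => a i.succ)) fun i => by
      refine Fin.cases (by simp) (fun i => Fin.cases (by simp) (fun i => ?_) i) i
      simpa using (ha i.succ).trans (by omega)
    refine ⟨.seq p (.seq (.assign (b + 1) (.num 0))
      (.loop (.sub (.var (a 0)) (.var (b + 1)))
        (.seq p' (.seq (.assign b (.var (b + 2)))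
          (.assign (b + 1) (.add (.var (b + 1)) (.num 1))))))), fun s => ?_⟩
    obtain ⟨w, hw⟩ : ∃ w : List.Vector ℕ n, w = .ofFn fun i => s.var (a i.succ) := ⟨_, rfl⟩
    have hhead : (List.Vector.ofFn fun i => s.var (a i)).head = s.var (a 0) := by
      simp [List.Vector.ofFn]
    have htail : (List.Vector.ofFn fun i => s.var (a i)).tail = w := by
      simp [List.Vector.ofFn, hw]
    -- The recursive time bound unrolled: each pass takes `4` for the loop test, `2` for copying and
    -- `4` for counting.
    have hfin : ∀ K, (Nat.rec (T w + 2 + 4) (fun y t => t + (T' (y ::ᵥ R w y ::ᵥ w) + 10)) K : ℕ) =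
        T w + (2 + ((∑ j ∈ Finset.range K,
          (4 + (T' (j ::ᵥ R w j ::ᵥ w) + (2 + 4)))) + 4)) := by
      intro K
      induction K with
      | zero => simp
      | succ K ih => rw [Finset.sum_range_succ]; simp only [ih]; omega
    beta_reduce
    rw [hhead, htail, hfin]
    have hp₀ := hp s
    rw [← hw] at hp₀
    refine hp₀.seq fun s₁ ⟨h1, h2, h3⟩ => ?_
    refine (Runs.assign (Q := fun s₂ => s₂.var b = f w ∧ s₂.var (b + 1) = 0 ∧
      (∀ x < b, s₂.var x = s.var x) ∧ s₂.arr = s.arr) le_rfl ?_).seq fun s₂ hs₂ => ?_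
    · refine ⟨?_, ?_, fun x hx => ?_, h3⟩
      · simp [Memory.setVar_var, h1]
      · simp [Memory.setVar_var, Expr.eval]
      · rw [Memory.setVar_var, if_neg (by omega), h2 x hx]
    refine (Runs.loop_sum (e := .sub (.var (a 0)) (.var (b + 1))) (s.var (a 0))
      (fun j => T' (j ::ᵥ R w j ::ᵥ w) + (2 + 4))
      (fun j s₂ => s₂.var b = R w j ∧ s₂.var (b + 1) = j ∧
        (∀ x < b, s₂.var x = s.var x) ∧ s₂.arr = s.arr) ?_ ?_ ?_).mono le_rfl ?_
    · rintro j hj s₃ ⟨e1, e2, e3, e4⟩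
      refine ⟨?_, ?_⟩
      · simp only [Expr.eval, e2, e3 _ (ha 0)]; omega
      have hvec : (List.Vector.ofFn fun i => s₃.var
          ((Fin.cons (b + 1) (Fin.cons b fun i => a i.succ) : Fin (n + 2) → ℕ) i)) =
          j ::ᵥ R w j ::ᵥ w := by
        simp only [List.Vector.ofFn, Fin.cons_zero, Fin.cons_succ, e1, e2, hw]
        congr 2
        congr 1
        funext i
        exact e3 _ (ha _)
      have hp₃ := hp' s₃
      rw [hvec] at hp₃
      refine hp₃.seq fun s₄ ⟨g1, g2, g3⟩ => ?_
      refine (Runs.assign (Q := fun s₅ => s₅.var b = R w (j + 1) ∧ s₅.var (b + 1) = j ∧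
        (∀ x < b, s₅.var x = s.var x) ∧ s₅.arr = s.arr) le_rfl ?_).seq fun s₅ hs₅ => ?_
      · refine ⟨?_, ?_, fun x hx => ?_, g3.trans e4⟩
        · simp [Memory.setVar_var, Expr.eval, g1, hRs]
        · rw [Memory.setVar_var, if_neg (by omega), g2 _ (by omega), e2]
        · rw [Memory.setVar_var, if_neg (by omega), g2 _ (by omega), e3 x hx]
      · obtain ⟨f1, f2, f3, f4⟩ := hs₅
        refine .assign le_rfl ⟨?_, ?_, fun x hx => ?_, f4⟩
        · rw [Memory.setVar_var, if_neg (by omega), f1]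
        · simp [Memory.setVar_var, Expr.eval, f2]
        · rw [Memory.setVar_var, if_neg (by omega), f3 x hx]
    · rintro s₃ ⟨e1, e2, e3, e4⟩
      simp only [Expr.eval, e2, e3 _ (ha 0)]; omega
    · obtain ⟨f1, f2, f3, f4⟩ := hs₂
      exact ⟨by rw [f1, hR]; rfl, f2, f3, f4⟩
    · rintro s₃ ⟨e1, e2, e3, e4⟩
      exact ⟨by rw [e1, hR], e3, e4⟩

theorem exists_prog_of_primrec {f : ℕ → ℕ} (hf : Primrec f) : ∃ T : ℕ → ℕ, Primrec T ∧
    ∀ b a, a < b → ∃ p, ∀ s : Memory, Runs p s (T (s.var a)) fun s' =>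
      s'.var b = f (s.var a) ∧ (∀ x < b, s'.var x = s.var x) ∧ s'.arr = s.arr := by
  obtain ⟨T, hT, h⟩ := exists_computableIn (Nat.Primrec'.prim_iff₁.2 hf)
  refine ⟨fun x => T (x ::ᵥ .nil), hT.comp (Primrec.vector_cons.comp .id (.const _)),
    fun b a hab => ?_⟩
  obtain ⟨p, hp⟩ := h b (fun _ => a) fun _ => hab
  exact ⟨p, fun s => hp s⟩

theorem exists_prog_of_primrec₂ {f : ℕ → ℕ → ℕ} (hf : Primrec₂ f) : ∃ T : ℕ → ℕ → ℕ, Primrec₂ T ∧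
    ∀ b a a', a < b → a' < b → ∃ p, ∀ s : Memory, Runs p s (T (s.var a) (s.var a')) fun s' =>
      s'.var b = f (s.var a) (s.var a') ∧ (∀ x < b, s'.var x = s.var x) ∧ s'.arr = s.arr := by
  obtain ⟨T, hT, h⟩ := exists_computableIn (Nat.Primrec'.prim_iff₂.2 hf)
  refine ⟨fun x y => T (x ::ᵥ y ::ᵥ .nil), hT.comp (Primrec.vector_cons.comp .fst
    (Primrec.vector_cons.comp .snd (.const _))), fun b a a' hab hab' => ?_⟩
  obtain ⟨p, hp⟩ := h b (Fin.cons a fun _ => a') fun i => by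
    refine Fin.cases ?_ (fun _ => ?_) i <;> simpa
  exact ⟨p, fun s => hp s⟩

end Machine

/-! ### Compressed places, the relevant candidates, and bounds on codes. -/

section Compression

variable {n m : ℕ}

/-- Walking through a ranking whose `i`-th candidate has the letter `q i` (`0` if irrelevant):
the compressed place after `i` steps, and the number of irrelevant candidates counted since the
last relevant one. Runs of irrelevant candidates are cut to length `R + 1`. -/
def walk (R : ℕ) (q : ℕ → ℕ) : ℕ → ℕ × ℕ
  | 0 => (0, 0)
  | i + 1 =>
    if q i ≠ 0 then ((walk R q i).1 + 1, 0)
    else if (walk R q i).2 ≤ R then ((walk R q i).1 + 1, (walk R q i).2 + 1)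
    else walk R q i

theorem walk_succ_of_ne {R : ℕ} {q : ℕ → ℕ} {i : ℕ} (h : q i ≠ 0) :
    walk R q (i + 1) = ((walk R q i).1 + 1, 0) := by
  rw [walk, if_pos h]

/-- The counter never exceeds the advance since `i`. A place is skipped only when the counter
exceeds `R`, so by then the advance exceeds `R` as well. -/
theorem walk_add {R : ℕ} {q : ℕ → ℕ} {i : ℕ} (h : (walk R q i).2 = 0) (d : ℕ) :
    ((walk R q (i + d)).1 = (walk R q i).1 + d ∨
      R < d ∧ (walk R q i).1 + R < (walk R q (i + d)).1) ∧
    (walk R q i).1 + (walk R q (i + d)).2 ≤ (walk R q (i + d)).1 ∧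
    (walk R q (i + d)).1 ≤ (walk R q i).1 + d := by
  induction d with
  | zero => simp [h]
  | succ d ih =>
    rw [← add_assoc, walk]
    split_ifs <;> (try dsimp only) <;> omega

theorem walk_sim {R : ℕ} {q : ℕ → ℕ} {i : ℕ} (h : q i ≠ 0) {j : ℕ} (hij : i < j) :
    Sim R ((j : ℤ) - i) ((walk R q j).1 - (walk R q i).1) := by
  have h1 := walk_succ_of_ne (R := R) h
  have h2 := walk_add (R := R) (q := q) (i := i + 1) (by rw [h1]) (j - (i + 1))
  rw [Nat.add_sub_cancel' hij, h1] at h2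
  unfold Sim
  simp only at h2
  omega

/-- The offset `1` accounts for the virtual point `-1` above the first place. -/
theorem walk_sim_zero (R : ℕ) (q : ℕ → ℕ) (j : ℕ) :
    Sim R ((j : ℤ) + 1) ((walk R q j).1 + 1) := by
  have h2 := walk_add (R := R) (q := q) (i := 0) (by rw [walk]) j
  rw [Nat.zero_add] at h2
  have : (walk R q 0).1 = 0 := by rw [walk]
  rw [this] at h2
  unfold Sim
  omega

theorem Sim.symm_neg {r : ℕ} {a b c d : ℤ} (h : Sim r (a - b) (c - d)) :
    Sim r (b - a) (d - c) := by
  unfold Sim at *; omega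

/-- Every relevant candidate accounts for itself and at most `R + 1` irrelevant ones counted before
it. -/
theorem walk_le (R : ℕ) (q : ℕ → ℕ) (i : ℕ) :
    (walk R q i).1 ≤ ((Finset.range i).filter fun j => q j ≠ 0).card * (R + 2) + (walk R q i).2 ∧
      (walk R q i).2 ≤ R + 1 := by
  induction i with
  | zero => simp [walk]
  | succ i ih =>
    rw [walk, Finset.range_add_one, Finset.filter_insert]
    by_cases h : q i ≠ 0
    · rw [if_pos h, if_pos h, Finset.card_insert_of_notMem (by simp), add_mul]
      simp only; omega
    · rw [if_neg h, if_neg h]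
      split_ifs <;> (try dsimp only) <;> omega

/-- The letter of the candidate in place `i` of the ranking of `v`. -/
def letterAt (P : Profile n m) (μ : Fin m → ℕ) (v : Fin n) (i : ℕ) : ℕ :=
  if h : i < m then μ (P v ⟨i, h⟩) else 0

theorem letterAt_place (P : Profile n m) (μ : Fin m → ℕ) (v : Fin n) (c : Fin m) :
    letterAt P μ v ((P v).symm c) = μ c := by
  simp [letterAt]

theorem card_letterAt_le {P : Profile n m} {S : Finset (Fin m)} {N : ℕ} {μ : Fin m → ℕ}
    (hμ : Lettering S N μ) (h0 : ∀ c ∉ S, μ c = 0) (v : Fin n) (i : ℕ) :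
    ((Finset.range i).filter fun j => letterAt P μ v j ≠ 0).card ≤ N := by
  have key : ∀ j, letterAt P μ v j ≠ 0 → ∃ h : j < m, P v ⟨j, h⟩ ∈ S := by
    intro j hj
    by_cases h : j < m
    · refine ⟨h, ?_⟩
      by_contra hS
      exact hj (by rw [letterAt, dif_pos h, h0 _ hS])
    · exact absurd (by rw [letterAt, dif_neg h]) hj
  have : ((Finset.range i).filter fun j => letterAt P μ v j ≠ 0).card ≤
      (Finset.Icc 1 N).card := by
    refine Finset.card_le_card_of_injOn (letterAt P μ v) (fun j hj => ?_) fun j hj j' hj' he => ?_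
    · obtain ⟨h, hS⟩ := key j (Finset.mem_filter.1 hj).2
      rw [letterAt, dif_pos h]
      exact Finset.mem_coe.2 (Finset.mem_Icc.2 ((hμ.range _).1 ⟨_, hS, rfl⟩))
    · obtain ⟨h, hS⟩ := key j (Finset.mem_filter.1 hj).2
      obtain ⟨h', hS'⟩ := key j' (Finset.mem_filter.1 hj').2
      rw [letterAt, letterAt, dif_pos h, dif_pos h'] at he
      simpa using (P v).injective (hμ.injOn hS hS' he)
  simpa using this

/-- The bound is free of `m`; this is what the compression is for. -/
theorem walk_letterAt_le {P : Profile n m} {S : Finset (Fin m)} {N : ℕ} {μ : Fin m → ℕ}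
    (hμ : Lettering S N μ) (h0 : ∀ c ∉ S, μ c = 0) (R : ℕ) (v : Fin n) (i : ℕ) :
    (walk R (letterAt P μ v) i).1 ≤ N * (R + 2) + (R + 1) := by
  obtain ⟨h1, h2⟩ := walk_le R (letterAt P μ v) i
  exact h1.trans (Nat.add_le_add (Nat.mul_le_mul_right _ (card_letterAt_le hμ h0 v i)) h2)

/-- The compressed places describe the profile up to the threshold `R`. -/
theorem similar_of_walk {P : Profile n m} {S : Finset (Fin m)} {N R : ℕ} {μ : Fin m → ℕ}
    (hμ : Lettering S N μ) {T : ℕ → ℕ → ℕ}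
    (hT : ∀ v : Fin n, ∀ c ∈ S, T v (μ c) = (walk R (letterAt P μ v) ((P v).symm c)).1)
    (hT0 : ∀ v : Fin n, T v 0 = (walk R (letterAt P μ v) m).1) : Similar R P S μ T := by
  have hq : ∀ v : Fin n, ∀ c ∈ S, letterAt P μ v ((P v).symm c) ≠ 0 := by
    intro v c hc
    rw [letterAt_place]
    have := ((hμ.range _).1 ⟨c, hc, rfl⟩).1
    omega
  have refl : ∀ x y : ℤ, Sim R (x - x) (y - y) := fun x y => .inl (by omega)
  intro v
  have h1 : ∀ c : S, Sim R (points P S v (some (some c)) - points P S v none)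
      (tablePoints T S μ v (some (some c)) - tablePoints T S μ v none) := by
    intro c
    simp only [points, tablePoints, hT v c c.2, sub_neg_eq_add]
    exact walk_sim_zero _ _ _
  have h2 : Sim R (points P S v (some none) - points P S v none)
      (tablePoints T S μ v (some none) - tablePoints T S μ v none) := by
    simp only [points, tablePoints, hT0, sub_neg_eq_add]
    exact walk_sim_zero _ _ _
  have h3 : ∀ c : S, Sim R (points P S v (some none) - points P S v (some (some c)))
      (tablePoints T S μ v (some none) - tablePoints T S μ v (some (some c))) := by
    intro c
    simp only [points, tablePoints, hT0, hT v c c.2]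
    exact walk_sim (hq v c c.2) ((P v).symm c).isLt
  rintro (_ | _ | c) (_ | _ | d)
  · exact refl _ _
  · exact h2.symm_neg
  · exact (h1 d).symm_neg
  · exact h2
  · exact refl _ _
  · exact h3 d
  · exact h1 c
  · exact (h3 c).symm_neg
  · simp only [points, tablePoints, hT v c c.2, hT v d d.2]
    rcases lt_trichotomy ((P v).symm c : ℕ) ((P v).symm d : ℕ) with h | h | h
    · exact (walk_sim (hq v c c.2) h).symm_neg
    · rw [h]; exact refl _ _
    · exact walk_sim (hq v d d.2) h

theorem Lettering.empty : Lettering (∅ : Finset (Fin m)) 0 fun _ => 0 :=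
  ⟨by simp, fun a => by simp; omega⟩

theorem Lettering.congr {S : Finset (Fin m)} {N : ℕ} {μ μ' : Fin m → ℕ} (h : Lettering S N μ)
    (he : ∀ c ∈ S, μ' c = μ c) : Lettering S N μ' := by
  refine ⟨fun c hc d hd hcd => h.injOn hc hd ?_, fun a => ?_⟩
  · rwa [he c hc, he d hd] at hcd
  · rw [← h.range]
    exact exists_congr fun c => and_congr_right fun hc => by rw [he c hc]

theorem Lettering.insert {S : Finset (Fin m)} {N : ℕ} {μ : Fin m → ℕ} (h : Lettering S N μ)
    {c : Fin m} (hc : c ∉ S) (hμ : μ c = N + 1) : Lettering (insert c S) (N + 1) μ := by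
  refine ⟨?_, fun a => ?_⟩
  · rw [Finset.coe_insert, Set.injOn_insert (by simpa using hc)]
    refine ⟨h.injOn, ?_⟩
    rintro ⟨d, hd, hdc⟩
    have := h.le (Finset.mem_coe.1 hd)
    omega
  · rw [Finset.exists_mem_insert, h.range]
    omega

/-- The candidates in the first `lim` places of the voters before `v` and in the first `i` places
of voter `v`. -/
def seen (P : Profile n m) (lim v i : ℕ) : Finset (Fin m) :=
  Finset.univ.filter fun c => ∃ u : Fin n, ((u : ℕ) < v ∧ ((P u).symm c : ℕ) < lim) ∨
    ((u : ℕ) = v ∧ ((P u).symm c : ℕ) < i)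

theorem mem_seen {P : Profile n m} {lim v i : ℕ} {c : Fin m} : c ∈ seen P lim v i ↔
    ∃ u : Fin n, ((u : ℕ) < v ∧ ((P u).symm c : ℕ) < lim) ∨
      ((u : ℕ) = v ∧ ((P u).symm c : ℕ) < i) := by
  simp [seen]

theorem seen_zero (P : Profile n m) (lim : ℕ) : seen P lim 0 0 = ∅ := by
  ext c; simp [mem_seen]

theorem seen_succ (P : Profile n m) (lim : ℕ) (v : Fin n) (i : ℕ) (hi : i < m) :
    seen P lim v (i + 1) = insert (P v ⟨i, hi⟩) (seen P lim v i) := by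
  ext c
  rw [Finset.mem_insert, mem_seen, mem_seen]
  constructor
  · rintro ⟨u, h | ⟨h, h'⟩⟩
    · exact .inr ⟨u, .inl h⟩
    · obtain h' | h' := Nat.lt_succ_iff_lt_or_eq.1 h'
      · exact .inr ⟨u, .inr ⟨h, h'⟩⟩
      · left
        obtain rfl : u = v := Fin.ext h
        rw [← Equiv.symm_apply_eq]
        exact Fin.ext h'
  · rintro (rfl | ⟨u, h | ⟨h, h'⟩⟩)
    · exact ⟨v, .inr ⟨rfl, by simp⟩⟩
    · exact ⟨u, .inl h⟩
    · exact ⟨u, .inr ⟨h, by omega⟩⟩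

theorem seen_row (P : Profile n m) (lim v : ℕ) : seen P lim (v + 1) 0 = seen P lim v lim := by
  ext c
  rw [mem_seen, mem_seen]
  refine exists_congr fun u => ?_
  omega

theorem lt_pos_of_notMem_seen {P : Profile n m} {L : ℕ} {c : Fin m}
    (hc : c ∉ seen P (min m L) n 0) (v : Fin n) : L < pos P v c := by
  rw [mem_seen] at hc
  push Not at hc
  have h1 := (hc v).1 v.isLt
  have h2 := ((P v).symm c).isLt
  rw [pos]
  omega

/-- Some voter attains the rank. Without voters the infimum would be `0` and nobody would be seen.
-/
theorem mem_seen_of_rank_le {P : Profile n m} {L : ℕ} (hn : 0 < n) {c : Fin m}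
    (hc : rank P c ≤ L) : c ∈ seen P (min m L) n 0 := by
  by_contra h
  obtain ⟨v, hv⟩ : ∃ v, pos P v c = rank P c := by
    have : Nonempty (Fin n) := ⟨⟨0, hn⟩⟩
    exact exists_eq_ciInf_of_finite (f := fun v => pos P v c)
  have := lt_pos_of_notMem_seen h v
  omega

/-- The question is decided by a compressed table. -/
theorem canChange_iff_tableAnswer {P : Profile n m} {k B N : ℕ} (hN : Normal n k)
    {μ : Fin m → ℕ} (hμ : Lettering (seen P (min m (n ^ 2 + n + 1)) n 0) N μ) {l : List ℕ}
    (hl : l.length = n * (N + 1))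
    (hs : Similar (n ^ 2) P (seen P (min m (n ^ 2 + n + 1)) n 0) μ (entry N l)) :
    CanChange P k B ↔ TableAnswer n k (min B (n ^ 2)) N l := by
  rw [← canChangeWith_iff_tableAnswer hμ (fun c hc v => ?_) hl (hs.mono (min_le_right _ _))]
  · constructor
    · intro h
      -- A changeable outcome forces `k ≥ 1`, and normality gives `k ≤ n`.
      have hn : 0 < n := (CanChangeWith.bounds hN h).1.trans hN.le
      exact (h.kernel hN).mono (fun c hc => mem_seen_of_rank_le hn hc) le_rfl
    · exact fun h => h.mono (Set.subset_univ _) (min_le_left _ _)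
  -- The cutoff `n ^ 2 + n + 1` exceeds the truncated budget plus `n`.
  · have := lt_pos_of_notMem_seen hc v
    have := min_le_right B (n ^ 2)
    omega

/-- The code of a list of length `len` all of whose entries are `E`. -/
def codeBound (E len : ℕ) : ℕ := Nat.rec 0 (fun _ x => Nat.succ (Nat.pair E x)) len

theorem codeBound_mono (E : ℕ) {a b : ℕ} (h : a ≤ b) : codeBound E a ≤ codeBound E b := by
  induction h with
  | refl => exact le_rfl
  | step _ ih => exact ih.trans ((Nat.right_le_pair _ _).trans (Nat.le_succ _))

theorem pair_le_pair {a b c d : ℕ} (h : a ≤ c) (h' : b ≤ d) : Nat.pair a b ≤ Nat.pair c d :=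
  (pair_le_left h b).trans (pair_le_right c h')
where
  pair_le_left {a c : ℕ} (h : a ≤ c) (b : ℕ) : Nat.pair a b ≤ Nat.pair c b := by
    obtain h | h := h.eq_or_lt
    · rw [h]
    · exact (Nat.pair_lt_pair_left b h).le
  pair_le_right (c : ℕ) {b d : ℕ} (h : b ≤ d) : Nat.pair c b ≤ Nat.pair c d := by
    obtain h | h := h.eq_or_lt
    · rw [h]
    · exact (Nat.pair_lt_pair_right c h).le

/-- Running times depend on the code of a list; this controls the code by the length and an entry
bound alone. -/
theorem encode_le_codeBound {E : ℕ} {l : List ℕ} (h : ∀ a ∈ l, a ≤ E) :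
    Encodable.encode l ≤ codeBound E l.length := by
  induction l with
  | nil => exact Nat.zero_le _
  | cons a l ih =>
    rw [Encodable.encode_list_cons]
    exact Nat.succ_le_succ (pair_le_pair (h a (by simp)) (ih fun b hb => h b (by simp [hb])))

theorem primrec_codeBound {α : Type} [Primcodable α] {E len : α → ℕ} (hE : Primrec E)
    (hl : Primrec len) : Primrec fun x => codeBound (E x) (len x) :=
  Primrec.nat_rec' (h := fun x (p : ℕ × ℕ) => Nat.succ (Nat.pair (E x) p.2)) hl (.const 0)
    (Primrec.succ.comp (Primrec₂.natPair.comp (hE.comp .fst) (Primrec.snd.comp .snd)))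

/-- A monotone bound for `f`. -/
def sumUpTo (f : ℕ → ℕ) (N : ℕ) : ℕ := Nat.rec (f 0) (fun y x => x + f (y + 1)) N

theorem le_sumUpTo (f : ℕ → ℕ) {i N : ℕ} (h : i ≤ N) : f i ≤ sumUpTo f N := by
  induction h with
  | refl => cases i with
    | zero => exact le_rfl
    | succ i => exact Nat.le_add_left _ _
  | step _ ih => exact ih.trans (Nat.le_add_right _ _)

theorem primrec_sumUpTo {f : ℕ → ℕ} (hf : Primrec f) {α : Type} [Primcodable α] {N : α → ℕ}
    (hN : Primrec N) : Primrec fun x => sumUpTo f (N x) :=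
  Primrec.nat_rec' (h := fun _ (p : ℕ × ℕ) => p.2 + f (p.1 + 1)) hN (.const _)
    (Primrec.nat_add.comp (Primrec.snd.comp .snd)
      (hf.comp (Primrec.succ.comp (Primrec.fst.comp .snd))))

theorem getD_flatMap {α : Type} {f : α → List ℕ} {w : ℕ} (hf : ∀ a, (f a).length = w)
    (l : List α) {j i : ℕ} (hj : j < l.length) (hi : i < w) :
    (l.flatMap f).getD (j * w + i) 0 = (f l[j]).getD i 0 := by
  induction l generalizing j with
  | nil => simp at hj
  | cons a l ih =>
    rw [List.flatMap_cons]
    cases j with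
    | zero =>
      rw [List.getD_append _ _ _ _ (by rw [hf]; omega)]
      simp
    | succ j =>
      rw [List.getD_append_right _ _ _ _ (by rw [hf, add_mul]; omega), hf,
        show (j + 1) * w + i - w = j * w + i by rw [add_mul]; omega]
      exact ih (by simpa using hj)

theorem encode_getD (I : Instance) (v : Fin I.n) {i : ℕ} (hi : i < I.m) :
    I.encode.getD (4 + v * I.m + i) 0 = I.P v ⟨i, hi⟩ := by
  rw [Instance.encode, List.getD_append_right _ _ _ _ (by simp; omega)]
  rw [show 4 + (v : ℕ) * I.m + i - [I.n, I.m, I.k, I.B].length = v * I.m + i by simp; omega]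
  rw [getD_flatMap (w := I.m) (by simp) _ (by simp) hi, List.getD_eq_getElem _ _ (by simpa)]
  simp

theorem length_encode (I : Instance) : I.encode.length = 4 + I.n * I.m := by
  simp [Instance.encode, List.length_flatMap]
  omega

theorem length_le_bitLength (x : List ℕ) : x.length ≤ bitLength x := by
  rw [bitLength]
  induction x with
  | nil => simp
  | cons a x ih => simp only [List.length_cons, List.map_cons, List.sum_cons]; omega

end Compression

/-! ### The two scans that build the compressed table. -/

section Program

theorem Runs.seq_assign {x : ℕ} {e : Expr} {q : Prog} {s : Memory} {T : ℕ} {Q : Memory → Prop}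
    (h : Runs q (s.setVar x (e.eval s)) T Q) : Runs (.seq (.assign x e) q) s (e.cost + 1 + T) Q :=
  (Runs.assign (Q := fun s' => s' = s.setVar x (e.eval s)) le_rfl rfl).seq fun _ h' => h' ▸ h

theorem Runs.seq_put {a : ℕ} {i e : Expr} {q : Prog} {s : Memory} {T : ℕ} {Q : Memory → Prop}
    (h : Runs q (s.setArr a (i.eval s) (e.eval s)) T Q) :
    Runs (.seq (.put a i e) q) s (i.cost + e.cost + 1 + T) Q :=
  (Runs.put (Q := fun s' => s' = s.setArr a (i.eval s) (e.eval s)) le_rfl rfl).seq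
    fun _ h' => h' ▸ h

/-- The input has been read into the variables `1` to `5`. -/
structure InputRead (I : Instance) (s : Memory) : Prop where
  voters : s.var 1 = I.n
  cands : s.var 2 = I.m
  size : s.var 3 = I.k
  budget : s.var 4 = min I.B (I.n ^ 2)
  square : s.var 5 = I.n ^ 2
  input : ∀ i, s.arr 0 i = I.encode.getD i 0

theorem InputRead.setVar {I : Instance} {s : Memory} (h : InputRead I s) {x : ℕ} (hx : 5 < x)
    (a : ℕ) : InputRead I (s.setVar x a) := by
  have key : ∀ y ≤ 5, (s.setVar x a).var y = s.var y := fun y hy => by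
    rw [Memory.setVar_var, if_neg (by omega)]
  exact ⟨(key 1 (by omega)).trans h.1, (key 2 (by omega)).trans h.2, (key 3 (by omega)).trans h.3,
    (key 4 (by omega)).trans h.4, (key 5 (by omega)).trans h.5, h.6⟩

theorem InputRead.setArr {I : Instance} {s : Memory} (h : InputRead I s) {x : ℕ} (hx : 0 < x)
    (i a : ℕ) : InputRead I (s.setArr x i a) :=
  ⟨h.1, h.2, h.3, h.4, h.5, fun j => by
    rw [Memory.setArr_arr, if_neg (by omega)]; exact h.6 j⟩

/-! #### Marking the relevant candidates -/

/-- State of the marking: variable `7` counts the candidates marked so far, array `1` holds their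
letters. -/
structure Marking (I : Instance) (lim v i : ℕ) (s : Memory) : Prop where
  read : InputRead I s
  limit : s.var 17 = lim
  voter : s.var 8 = v
  base : s.var 9 = 4 + v * I.m
  place : s.var 10 = i
  letter : Lettering (seen I.P lim v i) (s.var 7) fun c => s.arr 1 c
  unmarked : ∀ c ∉ seen I.P lim v i, s.arr 1 (c : ℕ) = 0
  count : s.var 7 ≤ v * lim + i

/-- Register `9` points to the current ranking in the input, `10` is the place in it and `11` the
candidate read. Assigning `11` to itself is the idle branch for a candidate already marked. -/
def markBody : Prog :=
  .seq (.assign 11 (.get 0 (.add (.var 9) (.var 10))))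
  (.seq (.assign 10 (.add (.var 10) (.num 1)))
  (.ite (.get 1 (.var 11)) (.assign 11 (.var 11))
    (.seq (.assign 7 (.add (.var 7) (.num 1))) (.put 1 (.var 11) (.var 7)))))

theorem Marking.body {I : Instance} {lim : ℕ} {v : Fin I.n} {i : ℕ} {s : Memory}
    (h : Marking I lim v i s) (hi : i < I.m) :
    Runs markBody s 19 (Marking I lim v (i + 1)) := by
  obtain ⟨c, hc⟩ : ∃ c, c = I.P v ⟨i, hi⟩ := ⟨_, rfl⟩
  have hget : (Expr.get 0 (.add (.var 9) (.var 10))).eval s = c := by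
    rw [Expr.eval, Expr.eval, Expr.eval, Expr.eval, h.base, h.place, h.read.input, hc,
      encode_getD I v hi]
  have hseen := seen_succ I.P lim v i hi
  rw [← hc] at hseen
  refine Runs.mono (Runs.seq_assign (Runs.seq_assign (Runs.ite (T := 7) (fun he => ?_)
    fun he => ?_))) (T' := 19) (by simp [Expr.cost]) fun _ h => h
  · rw [hget] at he ⊢
    have hc1 : s.arr 1 (c : ℕ) ≠ 0 := by
      simpa [Expr.eval, Memory.setVar_var, Memory.setVar_arr] using he
    have hcs : c ∈ seen I.P lim v i := by
      by_contra hcs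
      exact hc1 (h.unmarked c hcs)
    rw [Finset.insert_eq_self.2 hcs] at hseen
    refine .assign (by simp [Expr.cost]) ⟨?_, ?_, ?_, ?_, ?_, ?_, ?_, ?_⟩
    · exact ((h.read.setVar (by omega) _).setVar (by omega) _).setVar (by omega) _
    · simpa [Memory.setVar_var] using h.limit
    · simpa [Memory.setVar_var] using h.voter
    · simpa [Memory.setVar_var] using h.base
    · simpa [Memory.setVar_var, Expr.eval] using h.place
    · rw [hseen]
      simpa [Memory.setVar_var, Memory.setVar_arr] using h.letter
    · rw [hseen]
      simpa [Memory.setVar_arr] using h.unmarked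
    · have := h.count
      simp [Memory.setVar_var]
      omega
  · rw [hget] at he ⊢
    have hc1 : s.arr 1 (c : ℕ) = 0 := by
      simpa [Expr.eval, Memory.setVar_var, Memory.setVar_arr] using he
    have hcs : c ∉ seen I.P lim v i := by
      intro hcs
      have := ((h.letter.range _).1 ⟨c, hcs, rfl⟩).1
      omega
    refine Runs.mono (Runs.seq_assign (.put le_rfl ?_)) (T' := 7) (by simp [Expr.cost])
      fun _ h => h
    refine ⟨?_, ?_, ?_, ?_, ?_, ?_, ?_, ?_⟩
    · exact (((h.read.setVar (by omega) _).setVar (by omega) _).setVar (by omega) _).setArr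
        (by omega) _ _
    · simpa [Memory.setVar_var, Memory.setArr_var] using h.limit
    · simpa [Memory.setVar_var, Memory.setArr_var] using h.voter
    · simpa [Memory.setVar_var, Memory.setArr_var] using h.base
    · simpa [Memory.setVar_var, Memory.setArr_var, Expr.eval] using h.place
    · rw [hseen]
      have h7 : ((((s.setVar 11 (c : ℕ)).setVar 10 ((Expr.add (.var 10) (.num 1)).eval
        (s.setVar 11 (c : ℕ)))).setVar 7 ((Expr.add (.var 7) (.num 1)).eval ((s.setVar 11
          (c : ℕ)).setVar 10 ((Expr.add (.var 10) (.num 1)).eval (s.setVar 11 (c : ℕ))))))).var 7 =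
          s.var 7 + 1 := by simp [Memory.setVar_var, Expr.eval]
      rw [Memory.setArr_var, h7]
      refine (h.letter.congr fun d hd => ?_).insert hcs ?_
      · have hdc : d ≠ c := fun hdc => hcs (hdc ▸ hd)
        simp [Memory.setArr_arr, Memory.setVar_arr, Memory.setVar_var, Expr.eval, Fin.val_inj, hdc]
      · simp [Memory.setArr_arr, Memory.setVar_var, Expr.eval]
    · rw [hseen]
      intro d hd
      rw [Finset.mem_insert, not_or] at hd
      simpa [Memory.setArr_arr, Memory.setVar_arr, Memory.setVar_var, Expr.eval, Fin.val_inj, hd.1]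
        using h.unmarked d hd.2
    · have := h.count
      simp [Memory.setArr_var, Memory.setVar_var, Expr.eval]
      omega

/-- Only `lim` places are read, but register `9` advances by the full length of a ranking. -/
def markRow : Prog :=
  .seq (.loop (.sub (.var 17) (.var 10)) markBody)
  (.seq (.assign 9 (.add (.var 9) (.var 2)))
  (.seq (.assign 8 (.add (.var 8) (.num 1))) (.assign 10 (.num 0))))

theorem Marking.row {I : Instance} {lim : ℕ} (hlim : lim ≤ I.m) {v : Fin I.n} {s : Memory}
    (h : Marking I lim v 0 s) : Runs markRow s (I.m * 23 + 14) (Marking I lim (v + 1) 0) := by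
  refine Runs.mono (Runs.seq (Runs.loop lim 19 (fun i s => Marking I lim v i s)
    (fun j hj s hs => ⟨?_, hs.body (hj.trans_le hlim)⟩) (fun s hs => ?_) h) (T' := 10)
    fun s hs => ?_) (T' := I.m * 23 + 14) ?_ fun _ h => h
  · simp only [Expr.eval, hs.limit, hs.place]; omega
  · simp only [Expr.eval, hs.limit, hs.place]; omega
  · refine Runs.mono (Runs.seq_assign (Runs.seq_assign (.assign le_rfl ?_))) (T' := 10)
      (by simp [Expr.cost]) fun _ h => h
    refine ⟨?_, ?_, ?_, ?_, ?_, ?_, ?_, ?_⟩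
    · exact ((hs.read.setVar (by omega) _).setVar (by omega) _).setVar (by omega) _
    · simpa [Memory.setVar_var] using hs.limit
    · simpa [Memory.setVar_var, Expr.eval] using hs.voter
    · simp [Memory.setVar_var, Expr.eval, hs.base, hs.read.cands]
      ring
    · simp [Memory.setVar_var, Expr.eval]
    · rw [seen_row]
      simpa [Memory.setVar_var, Memory.setVar_arr] using hs.letter
    · rw [seen_row]
      simpa [Memory.setVar_arr] using hs.unmarked
    · have := hs.count
      simp [Memory.setVar_var]
      rw [add_mul]
      omega
  · have := Nat.mul_le_mul_right 23 hlim
    simp only [Expr.cost]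
    omega

def markAll : Prog := .loop (.sub (.var 1) (.var 8)) markRow

theorem Marking.all {I : Instance} {lim : ℕ} (hlim : lim ≤ I.m) {s : Memory}
    (h : Marking I lim 0 0 s) :
    Runs markAll s (I.n * (I.m * 23 + 18) + 4) (Marking I lim I.n 0) := by
  refine Runs.mono (Runs.loop I.n (I.m * 23 + 14) (fun v s => Marking I lim v 0 s)
    (fun j hj s hs => ⟨?_, Marking.row (v := ⟨j, hj⟩) hlim hs⟩) (fun s hs => ?_) h) ?_ fun _ h => h
  · simp only [Expr.eval, hs.read.voters, hs.voter]; omega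
  · simp only [Expr.eval, hs.read.voters, hs.voter]; omega
  · simp only [Expr.cost]
    apply le_of_eq
    ring

/-! #### Filling the table -/

/-- State of the filling of the table in array `2`. -/
structure Filling (I : Instance) (S : Finset (Fin I.m)) (N : ℕ) (μ : Fin I.m → ℕ) (v i : ℕ)
    (s : Memory) : Prop where
  read : InputRead I s
  count : s.var 7 = N
  marks : ∀ c : Fin I.m, s.arr 1 c = μ c
  voter : s.var 8 = v
  base : s.var 9 = 4 + v * I.m
  place : s.var 10 = i
  row : s.var 14 = v * (N + 1)
  walk : ∀ u : Fin I.n, (u : ℕ) = v →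
    (s.var 12, s.var 13) = walk (I.n ^ 2) (letterAt I.P μ u) i
  entries : ∀ u : Fin I.n, ∀ c ∈ S, (u : ℕ) < v ∨ (u : ℕ) = v ∧ ((I.P u).symm c : ℕ) < i →
    s.arr 2 (u * (N + 1) + μ c) =
      (STVRobust.walk (I.n ^ 2) (letterAt I.P μ u) ((I.P u).symm c)).1
  ends : ∀ u : Fin I.n, (u : ℕ) < v →
    s.arr 2 (u * (N + 1)) = (STVRobust.walk (I.n ^ 2) (letterAt I.P μ u) I.m).1

/-- Registers `12` and `13` hold the two components of `walk`. A place is stored before register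
`12` advances, since `walk` at `i` counts the places strictly above. The inner test is nonzero
exactly when register `13` is at most `n ^ 2`. -/
def fillBody : Prog :=
  .seq (.assign 11 (.get 0 (.add (.var 9) (.var 10))))
  (.seq (.assign 10 (.add (.var 10) (.num 1)))
  (.ite (.get 1 (.var 11))
    (.seq (.put 2 (.add (.var 14) (.get 1 (.var 11))) (.var 12))
      (.seq (.assign 12 (.add (.var 12) (.num 1))) (.assign 13 (.num 0))))
    (.ite (.sub (.add (.var 5) (.num 1)) (.var 13))
      (.seq (.assign 12 (.add (.var 12) (.num 1))) (.assign 13 (.add (.var 13) (.num 1))))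
      (.assign 11 (.var 11)))))

theorem index_inj {N a b u v : ℕ} (ha : a ≤ N) (hb : b ≤ N)
    (h : u * (N + 1) + a = v * (N + 1) + b) : u = v ∧ a = b := by
  rcases lt_trichotomy u v with huv | rfl | huv
  · have := Nat.mul_le_mul_right (N + 1) (Nat.succ_le_of_lt huv)
    rw [Nat.succ_mul] at this
    omega
  · omega
  · have := Nat.mul_le_mul_right (N + 1) (Nat.succ_le_of_lt huv)
    rw [Nat.succ_mul] at this
    omega

section

variable {I : Instance} {S : Finset (Fin I.m)} {N : ℕ} {μ : Fin I.m → ℕ}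

/-- Passing to the next place without changing the table. -/
theorem Filling.next {v : Fin I.n} {i : ℕ} {s s' : Memory} (h : Filling I S N μ v i s)
    (hi : i < I.m) (hS : I.P v ⟨i, hi⟩ ∉ S) (hread : InputRead I s')
    (h7 : s'.var 7 = s.var 7) (h8 : s'.var 8 = s.var 8) (h9 : s'.var 9 = s.var 9)
    (h10 : s'.var 10 = s.var 10 + 1) (h14 : s'.var 14 = s.var 14) (ha : s'.arr = s.arr)
    (hw : (s'.var 12, s'.var 13) = STVRobust.walk (I.n ^ 2) (letterAt I.P μ v) (i + 1)) :
    Filling I S N μ v (i + 1) s' := by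
  refine ⟨hread, h7.trans h.count, fun c => by rw [ha, h.marks], h8.trans h.voter, h9.trans h.base,
    by rw [h10, h.place], h14.trans h.row, fun u hu => ?_, fun u c hc hu => ?_, fun u hu => ?_⟩
  · obtain rfl : u = v := Fin.ext hu
    exact hw
  · rw [ha]
    refine h.entries u c hc (hu.imp_right fun ⟨h1, h2⟩ => ⟨h1, ?_⟩)
    obtain h2 | h2 := Nat.lt_succ_iff_lt_or_eq.1 h2
    · exact h2
    · obtain rfl : u = v := Fin.ext h1
      have : (I.P u).symm c = ⟨i, hi⟩ := Fin.ext h2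
      rw [Equiv.symm_apply_eq] at this
      exact absurd (this ▸ hc) hS
  · rw [ha, h.ends u hu]

theorem Filling.body (hμ : Lettering S N μ) (h0 : ∀ c ∉ S, μ c = 0) {v : Fin I.n} {i : ℕ}
    {s : Memory} (h : Filling I S N μ v i s) (hi : i < I.m) :
    Runs fillBody s 26 (Filling I S N μ v (i + 1)) := by
  obtain ⟨c, hc⟩ : ∃ c, c = I.P v ⟨i, hi⟩ := ⟨_, rfl⟩
  have hget : (Expr.get 0 (.add (.var 9) (.var 10))).eval s = c := by
    rw [Expr.eval, Expr.eval, Expr.eval, Expr.eval, h.base, h.place, h.read.input, hc,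
      encode_getD I v hi]
  have hlet : letterAt I.P μ v i = μ c := by rw [letterAt, dif_pos hi, hc]
  have hpl : ((I.P v).symm c : ℕ) = i := by rw [hc]; simp
  have hw := h.walk v rfl
  have hw1 : s.var 12 = (STVRobust.walk (I.n ^ 2) (letterAt I.P μ v) i).1 := by rw [← hw]
  have hw2 : s.var 13 = (STVRobust.walk (I.n ^ 2) (letterAt I.P μ v) i).2 := by rw [← hw]
  refine Runs.mono (Runs.seq_assign (Runs.seq_assign (Runs.ite (T := 14) (fun he => ?_)
    fun he => ?_))) (T' := 26) (by simp [Expr.cost]) fun _ h => h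
  · rw [hget] at he ⊢
    have hc1 : μ c ≠ 0 := by
      simpa [Expr.eval, Memory.setVar_var, Memory.setVar_arr, h.marks] using he
    have hcS : c ∈ S := by
      by_contra hcS
      exact hc1 (h0 c hcS)
    have hcN := hμ.le hcS
    have hws := walk_succ_of_ne (R := I.n ^ 2) (q := letterAt I.P μ v) (i := i)
      (by rwa [hlet])
    refine Runs.mono (Runs.seq_put (Runs.seq_assign (.assign le_rfl ?_))) (T' := 14)
      (by simp [Expr.cost]) fun _ h => h
    refine ⟨?_, ?_, fun d => ?_, ?_, ?_, ?_, ?_, fun u hu => ?_, fun u d hd hu => ?_,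
      fun u hu => ?_⟩
    · exact ((((h.read.setVar (by omega) _).setVar (by omega) _).setArr (by omega) _ _).setVar
        (by omega) _).setVar (by omega) _
    · simpa [Memory.setVar_var, Memory.setArr_var] using h.count
    · simpa [Memory.setVar_arr, Memory.setArr_arr] using h.marks d
    · simpa [Memory.setVar_var, Memory.setArr_var] using h.voter
    · simpa [Memory.setVar_var, Memory.setArr_var] using h.base
    · simpa [Memory.setVar_var, Memory.setArr_var, Expr.eval] using h.place
    · simpa [Memory.setVar_var, Memory.setArr_var] using h.row
    · obtain rfl : u = v := Fin.ext hu
      rw [hws, ← hw1]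
      simp [Memory.setVar_var, Memory.setArr_var, Expr.eval]
    · simp only [Memory.setVar_arr, Memory.setArr_arr, Expr.eval, Memory.setVar_var]
      simp only [true_and, Nat.reduceEqDiff, if_false, if_true, h.row,
        h.marks]
      split_ifs with hidx
      · obtain ⟨e1, e2⟩ := index_inj (hμ.le hd) hcN hidx
        obtain rfl : u = v := Fin.ext e1
        obtain rfl : d = c := hμ.injOn hd hcS e2
        rw [hw1, hpl]
      · refine h.entries u d hd (hu.imp_right fun ⟨h1, h2⟩ => ⟨h1, ?_⟩)
        obtain h2 | h2 := Nat.lt_succ_iff_lt_or_eq.1 h2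
        · exact h2
        · obtain rfl : u = v := Fin.ext h1
          have : (I.P u).symm d = ⟨i, hi⟩ := Fin.ext h2
          rw [Equiv.symm_apply_eq, ← hc] at this
          exact absurd (by rw [this]) hidx
    · simp only [Memory.setVar_arr, Memory.setArr_arr, Expr.eval, Memory.setVar_var]
      simp only [true_and, Nat.reduceEqDiff, if_false, if_true, h.row,
        h.marks]
      -- Letters are nonzero, so column `0`, reserved for the ends, is not overwritten.
      have hne : ¬ (u : ℕ) * (N + 1) = v * (N + 1) + μ c := fun hidx =>
        hc1 (index_inj (a := 0) (u := u) (Nat.zero_le N) hcN (by rwa [add_zero])).2.symm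
      rw [if_neg hne, h.ends u hu]
  · rw [hget] at he ⊢
    have hc0 : μ c = 0 := by
      simpa [Expr.eval, Memory.setVar_var, Memory.setVar_arr, h.marks] using he
    have hcS : I.P v ⟨i, hi⟩ ∉ S := by
      rw [← hc]
      intro hcS
      have := ((hμ.range _).1 ⟨c, hcS, rfl⟩).1
      omega
    refine Runs.mono (Runs.ite (T := 8) (fun he' => ?_) fun he' => ?_) (T' := 14)
      (by simp [Expr.cost]) fun _ h => h
    · refine Runs.mono (Runs.seq_assign (.assign le_rfl ?_)) (T' := 8)
        (by simp [Expr.cost]) fun _ h => h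
      have hle : (STVRobust.walk (I.n ^ 2) (letterAt I.P μ v) i).2 ≤ I.n ^ 2 := by
        simp [Expr.eval, Memory.setVar_var, h.read.square, hw2] at he'
        omega
      refine h.next hi hcS ?_ ?_ ?_ ?_ ?_ ?_ ?_ ?_
      · exact (((h.read.setVar (by omega) _).setVar (by omega) _).setVar (by omega) _).setVar
          (by omega) _
      · simp [Memory.setVar_var]
      · simp [Memory.setVar_var]
      · simp [Memory.setVar_var]
      · simp [Memory.setVar_var, Expr.eval]
      · simp [Memory.setVar_var]
      · rfl
      · rw [STVRobust.walk, if_neg (by rw [hlet]; omega), if_pos hle, ← hw1, ← hw2]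
        simp [Memory.setVar_var, Expr.eval]
    · have hle : ¬ (STVRobust.walk (I.n ^ 2) (letterAt I.P μ v) i).2 ≤ I.n ^ 2 := by
        simp [Expr.eval, Memory.setVar_var, h.read.square, hw2] at he'
        omega
      refine .assign (by simp [Expr.cost]) (h.next hi hcS ?_ ?_ ?_ ?_ ?_ ?_ ?_ ?_)
      · exact ((h.read.setVar (by omega) _).setVar (by omega) _).setVar (by omega) _
      · simp [Memory.setVar_var]
      · simp [Memory.setVar_var]
      · simp [Memory.setVar_var]
      · simp [Memory.setVar_var, Expr.eval]
      · simp [Memory.setVar_var]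
      · rfl
      · rw [STVRobust.walk, if_neg (by rw [hlet]; omega), if_neg hle, ← hw]
        simp [Memory.setVar_var]

/-- At the end of a row register `12` is the compressed length of the ranking, stored in column `0`
as its bottom end. -/
def fillRow : Prog :=
  .seq (.loop (.sub (.var 2) (.var 10)) fillBody)
  (.seq (.put 2 (.var 14) (.var 12))
  (.seq (.assign 9 (.add (.var 9) (.var 2)))
  (.seq (.assign 8 (.add (.var 8) (.num 1)))
  (.seq (.assign 14 (.add (.add (.var 14) (.var 7)) (.num 1)))
  (.seq (.assign 10 (.num 0))
  (.seq (.assign 12 (.num 0)) (.assign 13 (.num 0))))))))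

theorem Filling.newRow (hμ : Lettering S N μ) (h0 : ∀ c ∉ S, μ c = 0) {v : Fin I.n} {s : Memory}
    (h : Filling I S N μ v 0 s) :
    Runs fillRow s (I.m * 30 + 27) (Filling I S N μ (v + 1) 0) := by
  refine Runs.mono (Runs.seq (Runs.loop I.m 26 (fun i s => Filling I S N μ v i s)
    (fun j hj s hs => ⟨?_, hs.body hμ h0 hj⟩) (fun s hs => ?_) h) (T' := 23)
    fun s hs => ?_) (T' := I.m * 30 + 27) ?_ fun _ h => h
  · simp only [Expr.eval, hs.read.cands, hs.place]; omega
  · simp only [Expr.eval, hs.read.cands, hs.place]; omega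
  · have hw1 : s.var 12 = (STVRobust.walk (I.n ^ 2) (letterAt I.P μ v) I.m).1 := by
      rw [← hs.walk v rfl]
    refine Runs.mono (Runs.seq_put (Runs.seq_assign (Runs.seq_assign (Runs.seq_assign
      (Runs.seq_assign (Runs.seq_assign (.assign le_rfl ?_))))))) (T' := 23)
      (by simp [Expr.cost]) fun _ h => h
    refine ⟨?_, ?_, fun d => ?_, ?_, ?_, ?_, ?_, fun u hu => ?_, fun u d hd hu => ?_,
      fun u hu => ?_⟩
    · exact ((((((hs.read.setArr (by omega) _ _).setVar (by omega) _).setVar (by omega) _).setVar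
        (by omega) _).setVar (by omega) _).setVar (by omega) _).setVar (by omega) _
    · simpa [Memory.setVar_var, Memory.setArr_var] using hs.count
    · simpa [Memory.setVar_arr, Memory.setArr_arr] using hs.marks d
    · simpa [Memory.setVar_var, Memory.setArr_var, Expr.eval] using hs.voter
    · simp [Memory.setVar_var, Memory.setArr_var, Expr.eval, hs.base, hs.read.cands]
      ring
    · simp [Memory.setVar_var, Expr.eval]
    · simp [Memory.setVar_var, Memory.setArr_var, Expr.eval, hs.row, hs.count]
      ring
    · simp [Memory.setVar_var, Expr.eval, STVRobust.walk]
    · have hd1 := ((hμ.range _).1 ⟨d, hd, rfl⟩).1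
      simp only [Memory.setVar_arr, Memory.setArr_arr, Expr.eval, true_and, hs.row]
      rw [if_neg fun hidx => ?_]
      · refine hs.entries u d hd ?_
        have := ((I.P u).symm d).isLt
        omega
      · have := (index_inj (hμ.le hd) (Nat.zero_le N) hidx).2
        omega
    · simp only [Memory.setVar_arr, Memory.setArr_arr, Expr.eval, true_and, hs.row]
      split_ifs with hidx
      · obtain rfl : u = v := Fin.ext
          (index_inj (Nat.zero_le N) (Nat.zero_le N) hidx).1
        exact hw1
      · refine hs.ends u ?_
        obtain hu | hu := Nat.lt_succ_iff_lt_or_eq.1 hu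
        · exact hu
        · exact absurd (by rw [hu]) hidx
  · simp only [Expr.cost]
    omega

def fillAll : Prog := .loop (.sub (.var 1) (.var 8)) fillRow

theorem Filling.all (hμ : Lettering S N μ) (h0 : ∀ c ∉ S, μ c = 0) {s : Memory}
    (h : Filling I S N μ 0 0 s) :
    Runs fillAll s (I.n * (I.m * 30 + 31) + 4) (Filling I S N μ I.n 0) := by
  refine Runs.mono (Runs.loop I.n (I.m * 30 + 27) (fun v s => Filling I S N μ v 0 s)
    (fun j hj s hs => ⟨?_, Filling.newRow hμ h0 (v := ⟨j, hj⟩) hs⟩) (fun s hs => ?_) h) ?_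
    fun _ h => h
  · simp only [Expr.eval, hs.read.voters, hs.voter]; omega
  · simp only [Expr.eval, hs.read.voters, hs.voter]; omega
  · simp only [Expr.cost]
    apply le_of_eq
    ring

/-- The table in array `2`, as a list. -/
def tableList (a : ℕ → ℕ) (n N : ℕ) : List ℕ := (List.range (n * (N + 1))).map a

theorem entry_tableList (a : ℕ → ℕ) {n N u x : ℕ} (hu : u < n) (hx : x ≤ N) :
    entry N (tableList a n N) u x = a (u * (N + 1) + x) := by
  have h1 : u * (N + 1) + x < n * (N + 1) :=
    calc u * (N + 1) + x < (u + 1) * (N + 1) := by rw [add_mul]; omega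
      _ ≤ n * (N + 1) := Nat.mul_le_mul_right _ hu
  rw [entry, List.getD_eq_getElem _ _ (by simpa [tableList] using h1)]
  simp [tableList]

theorem Filling.similar (hμ : Lettering S N μ) {s : Memory} (h : Filling I S N μ I.n 0 s) :
    Similar (I.n ^ 2) I.P S μ (entry N (tableList (s.arr 2) I.n N)) := by
  refine similar_of_walk hμ (fun v c hc => ?_) fun v => ?_
  · rw [entry_tableList _ v.isLt (hμ.le hc)]
    exact h.entries v c hc (.inl v.isLt)
  · rw [entry_tableList _ v.isLt (Nat.zero_le _), add_zero]
    exact h.ends v v.isLt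

/-- The letters exhaust `1, …, N`, so every cell is an end or the place of a relevant candidate. -/
theorem Filling.entry_le (hμ : Lettering S N μ) (h0 : ∀ c ∉ S, μ c = 0) {s : Memory}
    (h : Filling I S N μ I.n 0 s) {x : ℕ} (hx : x ∈ tableList (s.arr 2) I.n N) :
    x ≤ N * (I.n ^ 2 + 2) + (I.n ^ 2 + 1) := by
  obtain ⟨j, hj, rfl⟩ := List.mem_map.1 hx
  rw [List.mem_range] at hj
  have hv : j / (N + 1) < I.n := Nat.div_lt_of_lt_mul (by rwa [mul_comm])
  have hj' : j = j / (N + 1) * (N + 1) + j % (N + 1) := by rw [mul_comm, Nat.div_add_mod]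
  have ha : j % (N + 1) < N + 1 := Nat.mod_lt _ (by omega)
  rw [hj']
  by_cases ha0 : j % (N + 1) = 0
  · rw [ha0, add_zero]
    refine (h.ends ⟨_, hv⟩ hv).trans_le ?_
    exact walk_letterAt_le hμ h0 _ _ _
  · obtain ⟨c, hc, hca⟩ := (hμ.range (j % (N + 1))).2 ⟨by omega, by omega⟩
    rw [← hca]
    refine (h.entries ⟨_, hv⟩ c hc (.inl hv)).trans_le ?_
    exact walk_letterAt_le hμ h0 _ _ _

end

end Program

/-! ### Assembly of the algorithm and its running time. -/

section Algorithm

/-- Multiplication is no instruction, so `n ^ 2` comes from a compiled program, at a cost depending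
on `n` alone. It works from register `20` upward and leaves the initial zeros below untouched. -/
theorem exists_setup : ∃ (p : Prog) (T : ℕ → ℕ), Primrec T ∧ ∀ I : Instance,
    Runs p (initMemory I.encode) (T I.n) (Marking I (min I.m (I.n ^ 2 + I.n + 1)) 0 0) := by
  have hsq : Primrec fun x : ℕ => x ^ 2 :=
    (Primrec.nat_mul.comp .id .id).of_eq fun x => (sq x).symm
  obtain ⟨T, hT, h⟩ := exists_prog_of_primrec hsq
  obtain ⟨p, hp⟩ := h 20 1 (by omega)
  refine ⟨.seq (.assign 1 (.get 0 (.num 0))) (.seq (.assign 2 (.get 0 (.num 1)))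
    (.seq (.assign 3 (.get 0 (.num 2))) (.seq (.assign 4 (.get 0 (.num 3)))
    (.seq p (.seq (.assign 5 (.var 20))
    -- With truncated subtraction, `a - (a - b)` is the minimum of `a` and `b`.
    (.seq (.assign 4 (.sub (.var 4) (.sub (.var 4) (.var 5))))
    (.seq (.assign 17 (.sub (.var 2) (.sub (.var 2)
      (.add (.add (.var 5) (.var 1)) (.num 1)))))
    (.assign 9 (.num 4))))))))), fun n => T n + 40,
    Primrec.nat_add.comp hT (.const _), fun I => ?_⟩
  have henc : ∀ i, (initMemory I.encode).arr 0 i = I.encode.getD i 0 := fun i => rfl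
  obtain ⟨s, hs⟩ : ∃ s, s =
    ((((initMemory I.encode).setVar 1 I.n).setVar 2 I.m).setVar 3 I.k).setVar 4 I.B := ⟨_, rfl⟩
  have hs1 : s.var 1 = I.n := by simp [hs, Memory.setVar_var]
  have hs2 : s.var 2 = I.m := by simp [hs, Memory.setVar_var]
  have hs3 : s.var 3 = I.k := by simp [hs, Memory.setVar_var]
  have hs4 : s.var 4 = I.B := by simp [hs, Memory.setVar_var]
  have hsv : ∀ x, 4 < x → s.var x = 0 := fun x hx => by
    simp only [hs, Memory.setVar_var]
    rw [if_neg (by omega), if_neg (by omega), if_neg (by omega), if_neg (by omega)]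
    rfl
  have hsa : s.arr = (initMemory I.encode).arr := by rw [hs]; rfl
  have hps := hp s
  rw [hs1] at hps
  refine Runs.mono (Runs.seq_assign (Runs.seq_assign (Runs.seq_assign (Runs.seq_assign
    (T := T I.n + 25) ?_)))) (by simp [Expr.cost]; omega) fun _ h => h
  refine cast (congrArg (fun s => Runs _ s _ _) ?_) (hps.seq (T' := 25)
    (Q' := Marking I (min I.m (I.n ^ 2 + I.n + 1)) 0 0) fun s' ⟨h1, h2, h3⟩ => ?_)
  · rw [hs]; rfl
  refine Runs.mono (Runs.seq_assign (Runs.seq_assign (Runs.seq_assign (.assign le_rfl ?_))))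
    (by simp [Expr.cost]) fun _ h => h
  have e1 := (h2 1 (by omega)).trans hs1
  have e2 := (h2 2 (by omega)).trans hs2
  have e3 := (h2 3 (by omega)).trans hs3
  have e4 := (h2 4 (by omega)).trans hs4
  have e7 := (h2 7 (by omega)).trans (hsv 7 (by omega))
  have e8 := (h2 8 (by omega)).trans (hsv 8 (by omega))
  have e10 := (h2 10 (by omega)).trans (hsv 10 (by omega))
  have earr : ∀ j, s'.arr 1 j = 0 := fun j => by rw [h3, hsa]; rfl
  refine ⟨⟨?_, ?_, ?_, ?_, ?_, fun i => ?_⟩, ?_, ?_, ?_, ?_, ?_, fun c _ => ?_, ?_⟩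
  · simpa [Memory.setVar_var] using e1
  · simpa [Memory.setVar_var] using e2
  · simpa [Memory.setVar_var] using e3
  · simp [Memory.setVar_var, Expr.eval, e4, h1]
    omega
  · simpa [Memory.setVar_var, Expr.eval] using h1
  · simp only [Memory.setVar_arr, h3, hsa]
    exact henc i
  · simp [Memory.setVar_var, Expr.eval, e1, e2, h1]
    omega
  · simpa [Memory.setVar_var] using e8
  · simp [Memory.setVar_var, Expr.eval]
  · simpa [Memory.setVar_var] using e10
  · rw [seen_zero]
    simpa [Memory.setVar_var, Memory.setVar_arr, e7, earr] using Lettering.empty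
  · exact earr c
  · simp [Memory.setVar_var, e7]

def resetProg : Prog :=
  .seq (.assign 8 (.num 0)) (.seq (.assign 9 (.num 4)) (.seq (.assign 10 (.num 0))
  (.seq (.assign 12 (.num 0)) (.seq (.assign 13 (.num 0)) (.assign 14 (.num 0))))))

theorem Marking.reset {I : Instance} {lim : ℕ} {s : Memory} (h : Marking I lim I.n 0 s) :
    Runs resetProg s 12
      (Filling I (seen I.P lim I.n 0) (s.var 7) (fun c => s.arr 1 c) 0 0) := by
  refine Runs.mono (Runs.seq_assign (Runs.seq_assign (Runs.seq_assign (Runs.seq_assign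
    (Runs.seq_assign (.assign le_rfl ?_)))))) (by simp [Expr.cost]) fun _ h => h
  refine ⟨?_, ?_, fun d => ?_, ?_, ?_, ?_, ?_, fun u hu => ?_, fun u d hd hu => ?_,
    fun u hu => ?_⟩
  · exact (((((h.read.setVar (by omega) _).setVar (by omega) _).setVar (by omega) _).setVar
      (by omega) _).setVar (by omega) _).setVar (by omega) _
  · simp [Memory.setVar_var]
  · simp [Memory.setVar_arr]
  · simp [Memory.setVar_var, Expr.eval]
  · simp [Memory.setVar_var, Expr.eval]
  · simp [Memory.setVar_var, Expr.eval]
  · simp [Memory.setVar_var, Expr.eval]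
  · simp [Memory.setVar_var, Expr.eval, walk]
  · omega
  · omega

theorem primrec₂_cons_code : Primrec₂ fun a x : ℕ => Nat.succ (Nat.pair a x) :=
  Primrec.succ.comp₂ Primrec₂.natPair

/-- Programs that put the value of a variable in front of the list with code in variable `15`. -/
theorem exists_push : ∃ T : ℕ → ℕ → ℕ, Primrec₂ T ∧ ∀ x < 20, ∃ p, ∀ (s : Memory) (l : List ℕ)
    (E len : ℕ), s.var x ≤ E → s.var 15 = Encodable.encode l → (∀ a ∈ l, a ≤ E) →
    l.length ≤ len → Runs p s (T E len) fun s' =>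
      s'.var 15 = Encodable.encode (s.var x :: l) ∧ (∀ y < 15, s'.var y = s.var y) ∧
        s'.arr = s.arr := by
  obtain ⟨T, hT, h⟩ := exists_prog_of_primrec₂ primrec₂_cons_code
  -- `T` need not be monotone; summing it up to the largest possible code gives a bound in terms of
  -- `E` and `len` only.
  refine ⟨fun E len => sumUpTo (fun z => T z.unpair.1 z.unpair.2)
    (Nat.pair E (codeBound E len)) + 2, ?_, fun x hx => ?_⟩
  · refine Primrec.nat_add.comp (primrec_sumUpTo (hT.comp (Primrec.fst.comp .unpair)
      (Primrec.snd.comp .unpair)) (Primrec₂.natPair.comp .fst (primrec_codeBound .fst .snd)))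
      (.const 2)
  · obtain ⟨p, hp⟩ := h 20 x 15 hx (by omega)
    refine ⟨.seq p (.assign 15 (.var 20)), fun s l E len hE hl ha hlen => ?_⟩
    have hps := hp s
    rw [hl] at hps
    refine ((hps.mono ?_ fun _ h => h).seq fun s' ⟨h1, h2, h3⟩ =>
      .assign le_rfl ⟨?_, fun y hy => ?_, h3⟩)
    · have := le_sumUpTo (fun z => T z.unpair.1 z.unpair.2) (pair_le_pair hE
        ((encode_le_codeBound ha).trans (codeBound_mono E hlen)))
      simpa using this
    · simp [Memory.setVar_var, Expr.eval, h1, Encodable.encode_list_cons]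
    · rw [Memory.setVar_var, if_neg (by omega), h2 y (by omega)]

/-- A program that computes the code of the list of the first entries of array `2`, whose number is
in variable `14`. -/
theorem exists_encodeTable : ∃ (p : Prog) (T : ℕ → ℕ → ℕ), Primrec₂ T ∧
    ∀ (s : Memory) (E len : ℕ), s.var 14 ≤ len → (∀ j < s.var 14, s.arr 2 j ≤ E) →
    Runs p s (T E len) fun s' =>
      s'.var 15 = Encodable.encode ((List.range (s.var 14)).map (s.arr 2)) ∧
        ∀ y < 14, s'.var y = s.var y := by
  obtain ⟨T, hT, h⟩ := exists_push
  obtain ⟨p, hp⟩ := h 16 (by omega)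
  refine ⟨.seq (.assign 15 (.num 0)) (.loop (.var 14)
    (.seq (.assign 14 (.sub (.var 14) (.num 1))) (.seq (.assign 16 (.get 2 (.var 14))) p))),
    fun E len => len * (T E len + 9) + 4, ?_, fun s E len hlen hE => ?_⟩
  · exact Primrec.nat_add.comp (Primrec.nat_mul.comp .snd
      (Primrec.nat_add.comp hT (.const 9))) (.const 4)
  obtain ⟨M, hM⟩ : ∃ M, M = s.var 14 := ⟨_, rfl⟩
  rw [← hM] at hlen hE ⊢
  -- The table is read backwards: after `j` passes register `15` encodes its last `j` entries.
  have key := Runs.loop (e := .var 14) (p := .seq (.assign 14 (.sub (.var 14) (.num 1)))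
    (.seq (.assign 16 (.get 2 (.var 14))) p)) M (T E len + 7) (fun j s' => s'.var 14 = M - j ∧
      s'.var 15 = Encodable.encode ((List.range' (M - j) j).map (s.arr 2)) ∧
      (∀ y < 14, s'.var y = s.var y) ∧ s'.arr = s.arr) ?_ ?_
    (s := s.setVar 15 0) ?_
  · refine Runs.mono (Runs.seq_assign key) ?_ fun s' ⟨_, h2, h3, _⟩ => ⟨?_, h3⟩
    · simp only [Expr.cost]
      have := Nat.mul_le_mul_right (T E len + 9) hlen
      have e : 1 + 1 + (T E len + 7) = T E len + 9 := by omega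
      rw [e]
      omega
    · rw [h2, Nat.sub_self, List.range_eq_range']
  · rintro j hj s' ⟨h1, h2, h3, h4⟩
    refine ⟨by simp only [Expr.eval, h1]; omega, ?_⟩
    refine Runs.mono (Runs.seq_assign (Runs.seq_assign (hp _
      ((List.range' (M - j) j).map (s.arr 2)) E len ?_ ?_ ?_ ?_)))
      (by simp [Expr.cost]; omega) fun s'' ⟨g1, g2, g3⟩ => ⟨?_, ?_, fun y hy => ?_, ?_⟩
    · simp [Memory.setVar_var, Memory.setVar_arr, Expr.eval, h1, h4]
      exact hE _ (by omega)
    · simpa [Memory.setVar_var] using h2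
    · intro a ha
      obtain ⟨i, hi, rfl⟩ := List.mem_map.1 ha
      rw [List.mem_range'_1] at hi
      exact hE i (by omega)
    · simp
      omega
    · rw [g2 14 (by omega)]
      simp [Memory.setVar_var, Expr.eval, h1]
      omega
    · rw [g1, List.range'_succ]
      simp only [Memory.setVar_var, Memory.setVar_arr, Expr.eval, h1, h4, if_true, List.map_cons]
      rw [show M - (j + 1) + 1 = M - j by omega, Nat.sub_sub]
    · rw [g2 y (by omega), Memory.setVar_var, if_neg (by omega), Memory.setVar_var,
        if_neg (by omega), h3 y hy]
    · rw [g3]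
      simpa [Memory.setVar_arr] using h4
  · rintro s' ⟨h1, -⟩
    simp [Expr.eval, h1]
  · refine ⟨?_, ?_, fun y hy => ?_, rfl⟩
    · simp [Memory.setVar_var, hM]
    · simp [Memory.setVar_var]
    · rw [Memory.setVar_var, if_neg (by omega)]

/-- Pushing the registers `7`, `4`, `3`, `1` in this order produces the header `n, k, B, N` that
`answerCode` expects; the `4` in `len + 4` leaves room for it. -/
theorem exists_answer : ∃ (p : Prog) (T : ℕ → ℕ → ℕ), Primrec₂ T ∧
    ∀ (s : Memory) (E len : ℕ), s.var 14 ≤ len → (∀ j < s.var 14, s.arr 2 j ≤ E) →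
    s.var 1 ≤ E → s.var 3 ≤ E → s.var 4 ≤ E → s.var 7 ≤ E →
    Runs p s (T E len) fun s' => s'.var 0 = answerCode (Encodable.encode
      (s.var 1 :: s.var 3 :: s.var 4 :: s.var 7 ::
        (List.range (s.var 14)).map (s.arr 2))) := by
  obtain ⟨p, T, hT, hp⟩ := exists_encodeTable
  obtain ⟨T', hT', h'⟩ := exists_push
  obtain ⟨p7, hp7⟩ := h' 7 (by omega)
  obtain ⟨p4, hp4⟩ := h' 4 (by omega)
  obtain ⟨p3, hp3⟩ := h' 3 (by omega)
  obtain ⟨p1, hp1⟩ := h' 1 (by omega)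
  obtain ⟨A, hA, ha⟩ := exists_prog_of_primrec primrec_answerCode
  obtain ⟨q, hq⟩ := ha 20 15 (by omega)
  refine ⟨.seq p (.seq p7 (.seq p4 (.seq p3 (.seq p1 (.seq q (.assign 0 (.var 20))))))),
    fun E len => T E len + (T' E (len + 4) + (T' E (len + 4) + (T' E (len + 4) +
      (T' E (len + 4) + (sumUpTo A (codeBound E (len + 4)) + 2))))), ?_,
    fun s E len hlen hE h1 h3 h4 h7 => ?_⟩
  · have hl : Primrec fun x : ℕ × ℕ => x.2 + 4 := Primrec.nat_add.comp .snd (.const 4)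
    have ht : Primrec fun x : ℕ × ℕ => T' x.1 (x.2 + 4) := hT'.comp .fst hl
    exact Primrec.nat_add.comp hT (Primrec.nat_add.comp ht (Primrec.nat_add.comp ht
      (Primrec.nat_add.comp ht (Primrec.nat_add.comp ht (Primrec.nat_add.comp
        (primrec_sumUpTo hA (primrec_codeBound .fst hl)) (.const 2))))))
  obtain ⟨l, hl⟩ : ∃ l, l = (List.range (s.var 14)).map (s.arr 2) := ⟨_, rfl⟩
  have hlE : ∀ a ∈ l, a ≤ E := by
    intro a ha
    rw [hl] at ha
    obtain ⟨i, hi, rfl⟩ := List.mem_map.1 ha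
    exact hE i (List.mem_range.1 hi)
  have hll : l.length ≤ len := by simpa [hl] using hlen
  have hps := hp s E len hlen hE
  rw [← hl] at hps ⊢
  refine hps.seq fun s₁ ⟨a1, b1⟩ => ?_
  have e7 := b1 7 (by omega)
  refine (hp7 s₁ l E (len + 4) (by omega) a1 hlE (by omega)).seq fun s₂ ⟨a2, b2, _⟩ => ?_
  rw [e7] at a2
  have e4 : s₂.var 4 = s.var 4 := by rw [b2 4 (by omega), b1 4 (by omega)]
  refine (hp4 s₂ _ E (len + 4) (by omega) a2 (by simpa [h7] using hlE)
    (by simp; omega)).seq fun s₃ ⟨a3, b3, _⟩ => ?_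
  rw [e4] at a3
  have e3 : s₃.var 3 = s.var 3 := by rw [b3 3 (by omega), b2 3 (by omega), b1 3 (by omega)]
  refine (hp3 s₃ _ E (len + 4) (by omega) a3 (by simpa [h7, h4] using hlE)
    (by simp; omega)).seq fun s₄ ⟨a4, b4, _⟩ => ?_
  rw [e3] at a4
  have e1 : s₄.var 1 = s.var 1 := by
    rw [b4 1 (by omega), b3 1 (by omega), b2 1 (by omega), b1 1 (by omega)]
  refine (hp1 s₄ _ E (len + 4) (by omega) a4 (by simpa [h7, h4, h3] using hlE)
    (by simp; omega)).seq fun s₅ ⟨a5, _, _⟩ => ?_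
  rw [e1] at a5
  have hqs := hq s₅
  rw [a5] at hqs
  refine (hqs.mono (le_sumUpTo A ((encode_le_codeBound (E := E)
    (by simpa [h7, h4, h3, h1] using hlE)).trans (codeBound_mono E (by simp; omega))))
    fun _ h => h).seq fun s₆ ⟨a6, _, _⟩ => .assign le_rfl ?_
  simp [Memory.setVar_var, Expr.eval, a6]

theorem isFPT_canChange : IsFPT (fun I : {I : Instance // Normal I.n I.k} => I.1.encode)
    (fun I => I.1.n) (fun I => CanChange I.1.P I.1.k I.1.B) := by
  obtain ⟨p, T, hT, hp⟩ := exists_setup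
  obtain ⟨q, U, hU, hq⟩ := exists_answer
  -- `G` bounds the number of letters: each voter contributes at most `n ^ 2 + n + 1` candidates.
  obtain ⟨G, hG⟩ : ∃ G : ℕ → ℕ, G = fun n => n * (n ^ 2 + n + 1) := ⟨_, rfl⟩
  -- `E` bounds the table entries; the extra `n` also covers the header entries `n` and `k ≤ n`.
  obtain ⟨E, hE⟩ : ∃ E : ℕ → ℕ, E = fun n => G n * (n ^ 2 + 2) + (n ^ 2 + 1) + n := ⟨_, rfl⟩
  have hsq : Primrec fun x : ℕ => x ^ 2 :=
    (Primrec.nat_mul.comp .id .id).of_eq fun x => (sq x).symm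
  have hGp : Primrec G := by
    rw [hG]
    exact Primrec.nat_mul.comp .id (Primrec.nat_add.comp (Primrec.nat_add.comp hsq .id) (.const 1))
  have hEp : Primrec E := by
    rw [hE]
    exact Primrec.nat_add.comp (Primrec.nat_add.comp (Primrec.nat_mul.comp hGp
      (Primrec.nat_add.comp hsq (.const 2))) (Primrec.nat_add.comp hsq (.const 1))) .id
  -- The scans cost `23 + 30 = 53` steps per entry of the rankings and `18 + 31 = 49` per voter;
  -- `73` is this `53` plus `20` steps of constant overhead.
  refine ⟨.seq p (.seq markAll (.seq resetProg (.seq fillAll q))),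
    fun n => T n + U (E n) (n * (G n + 1)) + n * 49 + 73, 1, ?_, fun ⟨I, hN⟩ => ?_⟩
  · refine Primrec.to_comp ?_
    exact Primrec.nat_add.comp (Primrec.nat_add.comp (Primrec.nat_add.comp hT (hU.comp hEp
      (Primrec.nat_mul.comp .id (Primrec.nat_add.comp hGp (.const 1)))))
      (Primrec.nat_mul.comp .id (.const 49))) (.const 73)
  simp only at hN ⊢
  have hlim : min I.m (I.n ^ 2 + I.n + 1) ≤ I.m := min_le_left _ _
  have main : Runs (.seq p (.seq markAll (.seq resetProg (.seq fillAll q))))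
      (initMemory I.encode) (T I.n + ((I.n * (I.m * 23 + 18) + 4) + (12 +
        ((I.n * (I.m * 30 + 31) + 4) + U (E I.n) (I.n * (G I.n + 1))))))
      fun s => s.var 0 ≠ 0 ↔ CanChange I.P I.k I.B := by
    refine (hp I).seq fun s₁ h₁ => (h₁.all hlim).seq fun s₂ h₂ => h₂.reset.seq fun s₃ h₃ =>
      (h₃.all h₂.letter h₂.unmarked).seq fun s₄ h₄ => ?_
    obtain ⟨N, hNs⟩ : ∃ N, N = s₂.var 7 := ⟨_, rfl⟩
    have hμ := h₂.letter
    have hent := fun x => h₄.entry_le (x := x) hμ h₂.unmarked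
    have hsim := h₄.similar hμ
    have hNG : N ≤ G I.n := by
      rw [hNs, hG]
      have := Nat.mul_le_mul_left I.n (min_le_right I.m (I.n ^ 2 + I.n + 1))
      exact h₂.count.trans this
    have h14 := h₄.row
    have h7 := h₄.count
    rw [← hNs] at hμ hent hsim h14 h7
    have hNE : N * (I.n ^ 2 + 2) + (I.n ^ 2 + 1) + I.n ≤ E I.n := by
      rw [hE]
      have := Nat.mul_le_mul_right (I.n ^ 2 + 2) hNG
      simp only
      omega
    have hNN : N ≤ N * (I.n ^ 2 + 2) := Nat.le_mul_of_pos_right _ (by omega)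
    have hkn := hN.le
    have hB := min_le_right I.B (I.n ^ 2)
    have hlist : (List.range (s₄.var 14)).map (s₄.arr 2) = tableList (s₄.arr 2) I.n N := by
      rw [h14, tableList]
    refine (hq s₄ (E I.n) (I.n * (G I.n + 1)) ?_ ?_ ?_ ?_ ?_ ?_).mono le_rfl fun s₅ h₅ => ?_
    · rw [h14]
      exact Nat.mul_le_mul_left _ (by omega)
    · intro j hj
      have := hent (s₄.arr 2 j) (by
        rw [← hlist]; exact List.mem_map_of_mem (List.mem_range.2 hj))
      omega
    · rw [h₄.read.voters]; omega
    · rw [h₄.read.size]; omega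
    · rw [h₄.read.budget]; omega
    · rw [h7]; omega
    · rw [h₅, hlist, h₄.read.voters, h₄.read.size, h₄.read.budget, h7, answerCode_encode]
      exact (canChange_iff_tableAnswer hN hμ (by simp [tableList]) hsim).symm
  obtain ⟨t, s, h1, h2, h3⟩ := main
  refine ⟨t, s, h1, h2.trans ?_, h3⟩
  have hlen : 1 + I.n * I.m ≤ bitLength I.encode := by
    have := length_le_bitLength I.encode
    rw [length_encode] at this
    omega
  rw [pow_one]
  refine le_trans ?_ (Nat.mul_le_mul_left _ hlen)
  obtain ⟨u, hu⟩ : ∃ u, u = U (E I.n) (I.n * (G I.n + 1)) := ⟨_, rfl⟩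
  rw [← hu]
  have h0 : 0 ≤ (T I.n + u + I.n * 49 + 20) * (I.n * I.m) := Nat.zero_le _
  linarith [h0]

end Algorithm

end STVRobust

theorem mainTheorem12 :
    -- STV Robustness Radius, for normal committee sizes, is FPT in the number of voters
    STVRobust.IsFPT
      (fun I : {I : STVRobust.Instance // STVRobust.Normal I.n I.k} => I.1.encode)
      (fun I => I.1.n)
      (fun I => STVRobust.CanChange I.1.P I.1.k I.1.B) ∧
    -- candidates of rank above `n` belong to no winning committee
    (∀ (n m k : ℕ) (P : STVRobust.Profile n m), STVRobust.Normal n k →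
      ∀ c : Fin m, n < STVRobust.rank P c → ∀ W ∈ STVRobust.STV P k, c ∉ W) ∧
    -- the robustness radius is at most `n ^ 2`
    (∀ (n m k : ℕ) (P : STVRobust.Profile n m), STVRobust.Normal n k → 1 ≤ k → k < m →
      STVRobust.CanChange P k (n ^ 2)) ∧
    -- only swaps that move a candidate of rank at most `n ^ 2 + n + 1` matter
    (∀ (n m k B : ℕ) (P : STVRobust.Profile n m), STVRobust.Normal n k →
      STVRobust.CanChange P k B →
      STVRobust.CanChangeWith {c | STVRobust.rank P c ≤ n ^ 2 + n + 1} P k (min B (n ^ 2))) :=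
  ⟨STVRobust.isFPT_canChange, fun _ _ _ _ _ _ hc _ hW => STVRobust.notMem_of_lt_rank hc hW,
    fun _ _ _ P hN h1 hk => STVRobust.canChange_sq P hN h1 hk, fun _ _ _ _ _ hN h => h.kernel hN⟩
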